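/- **Setting.** Let $E$ be a finite set and let $\mathcal M_D=(E,\mathcal I_D)$, $\mathcal M_H=(E,\mathcal I_H)$ be matroids in which every singleton is independent. For $S\in\{D,H\}$ let $\succsim_S$ be a transitive and complete relation on $E$ (ties are allowed), with strict part $\succ_S$. Let $E=E_1\cup E_2$ with $E_1\cap E_2=\emptyset$. Write $X+e=X\cup\{e\}$ and $X-e=X\setminus\{e\}$; let $\mathrm{rk}_S$, $\mathrm{cl}_S$ be the rank and closure of $\mathcal M_S$, and for $I\in\mathcal I_S$, $e\in\mathrm{cl}_S(I)\setminus I$ let $C_S(e,I)$ be the unique circuit of $\mathcal M_S$ with $e\in C_S(e,I)\subseteq I+e$. Let $I\in\mathcal I_D\cap\mathcal I_H$ and $e\in E\setminus I$. Then $e$ *weakly* (resp. *strongly*) blocks $I$ on $\mathcal M_S$ if $I+e\in\mathcal I_S$, or $I+e\notin\mathcal I_S$ and there is $f\in I$ with $e\succsim_S f$ (resp. $e\succ_S f$) and $I+e-f\in\mathcal I_S$. The element $e$ *blocks* $I$ if it weakly blocks $I$ on both $\mathcal M_D$ and $\mathcal M_H$ and, in case $e\in E_2$, also strongly blocks $I$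 on at least one of them. A set $I\in\mathcal I_D\cap\mathcal I_H$ is *non-uniformly stable* if no element of $E\setminus I$ blocks $I$. **Subroutines.** For $F\subseteq E$ let $\mathrm{he}_S(F)$ (resp. $\mathrm{ta}_S(F)$) be the set of $e\in F$ with $e\succsim_S f$ (resp. $f\succsim_S e$) for all $f\in F$. * $\mathcal M_D\langle F\rangle$: start with $\mathcal M'=\mathcal M_D$, $N=F$. While $N\ne\emptyset$, let $T=\mathrm{he}_D(N)$, record the matroid $\mathcal M'|T$, and replace $\mathcal M'$ by $\mathcal M'/T$ and $N$ by $N\setminus T$. The result is the direct sum of the recorded matroids. * $\mathcal M_H\langle F\rangle$: start with $\mathcal M'=\mathcal M_H$, $N=F$. While $N\ne\emptyset$, let $T=\mathrm{he}_H(N)$; record $\mathcal M'|(T\cap E_1)$ and replace $\mathcal M'$ by $\mathcal M'/(T\cap E_1)$; then record $\mathcal M'|(T\cap E_2)$ and replace $\mathcal M'$ by $\mathcal M'/(T\cap E_2)$; replace $N$ by $N\setminus T$. The result is the direct sum of the recorded matroids. * $\mathrm{Ch}_D(F)$: start with $\mathcal M'=\mathcal M_D$, $N=F$. While $N\neq\emptyset$,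 let $T=\mathrm{he}_D(N)$, select all $e\in T$ such that $\{e\}$ is independent in $\mathcal M'$, and replace $\mathcal M'$ by $\mathcal M'/T$ and $N$ by $N\setminus T$. The result is the set of selected elements. * $\mathrm{block}(I)$ is the set of $e\in\mathrm{cl}_H(I)\setminus I$ that block $I$. * The *critical subset* of matroids $\mathcal M_1,\mathcal M_2$ on $U$ is the inclusion-wise minimal minimizer $X\subseteq U$ of $\mathrm{rk}_{\mathcal M_1}(U\setminus X)+\mathrm{rk}_{\mathcal M_2}(X)$. **Main algorithm.** Start with $P=\emptyset$. 1. (Inner loop.) Let $K=\mathrm{Ch}_D(E\setminus P)$ and let $Q$ be any base of $\mathcal M_H\langle K\rangle$. If $\mathrm{rk}_D(E\setminus P)<\mathrm{rk}_H(K)$, output **No** and halt. If $Q\cap E_1\ne K\cap E_1$, let $P'=P\cup((K\setminus Q)\cap E_1)$. Otherwise let $I$ be any maximum-size common independent set of $\mathcal M_D\langle K\rangle,\mathcal M_H\langle K\rangle$; if $|I|<\mathrm{rk}_D(E\setminus P)$, let $P'=P\cup Z$ with $Z$ the critical subset of $\mathcal M_D\langle K\rangle,\mathcal M_H\langle K\rangle$;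 else let $P'=P$. If $P'\neq P$, replace $P$ by $P'$ and repeat 1; else go to 2. 2. If $P\cap\mathrm{block}(I)\ne\emptyset$, choose any $b$ in it and let $R=P\cup\mathrm{ta}_H(C_H(b,I))$; else let $R=P$. If $R\ne P$, replace $P$ by $R$ and go to 1; else go to 3. 3. If $I+e\in\mathcal I_H$ for some $e\in R$, output **No** and halt. Otherwise output $I$ and halt. **Theorem.** Whatever arbitrary choices are made, every step of the main algorithm is well defined, and the algorithm halts after a number of steps bounded by a polynomial in $|E|$ (a step being one iteration of 1 or one execution of 2 or 3). If a non-uniformly stable common independent set of $\mathcal M_D,\mathcal M_H$ exists, its output is such a set; otherwise its output is **No**. Given independence oracles for $\mathcal M_D$ and $\mathcal M_H$, the algorithm runs in polynomial time: on a random access machine with unit-cost addition, subtraction, comparison and memory access, unit-cost oracle calls and unit-cost look-ups of $\succsim_D,\succsim_H$ and $E_1$, there is a single program, for all instances with $E=\{0,\dots,n-1\}$, that carries out (some execution of) the main algorithm step by step, using time polynomial in $n$ for the initialization, for each step and in total. -/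

import Mathlib

universe u

/-! ### Instances and non-uniform stability -/

/-- The two sides `D` and `H` of an instance. -/
inductive Side
  | D
  | H

/-- Two loopless matroids `M D`, `M H` on the common finite ground set `E`, a transitive and complete
relation `weak S` on `E` for each side `S` (`weak S e f` means that `e` is at least as good as `f`),
and a partition of `E` into `E1` and `E2`. -/
structure StableInstance (E : Type*) where
  M : Side → Matroid E
  ground : ∀ S, (M S).E = Set.univ
  weak : Side → E → E → Prop
  weak_trans : ∀ S e f g, weak S e f → weak S f g → weak S e g
  weak_total : ∀ S e f, weak S e f ∨ weak S f e
  E1 : Set E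
  E2 : Set E
  disjoint_E1_E2 : Disjoint E1 E2
  E1_union_E2 : E1 ∪ E2 = Set.univ
  singleton_indep : ∀ S e, (M S).Indep {e}

/-- The direct sum of two matroids with disjoint ground sets (and a dummy value otherwise). -/
noncomputable def matroidDirectSum {E : Type*} (M N : Matroid E) : Matroid E :=
  open Classical in if h : Disjoint M.E N.E then M.disjointSum N h else Matroid.emptyOn E

/-- `I` is a maximum-size common independent set of `M` and `N`. -/
def IsMaxCommonIndep {E : Type*} (M N : Matroid E) (I : Set E) : Prop :=
  M.Indep I ∧ N.Indep I ∧ ∀ J, M.Indep J → N.Indep J → J.encard ≤ I.encard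

/-- The function `X ↦ rk_M (U \ X) + rk_N X`, where `U` is the ground set. -/
noncomputable def edmondsFun {E : Type*} (M N : Matroid E) (X : Set E) : ℕ∞ :=
  M.eRk (M.E \ X) + N.eRk X

/-- `Z` is an inclusion-wise minimal minimizer of `edmondsFun M N` over the subsets of the ground
set. -/
def IsCriticalSubset {E : Type*} (M N : Matroid E) (Z : Set E) : Prop :=
  Minimal (fun X => X ⊆ M.E ∧ ∀ Y ⊆ M.E, edmondsFun M N X ≤ edmondsFun M N Y) Z

/-- The configurations of the main algorithm: `inner P` at the beginning of the body of the inner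
loop, with the current set `P`; `outer P I` directly after the inner loop, with the current sets
`P` and `I`; `final R I` directly after the outer loop; `no` and `found I` after halting with
output "No" and output `I`, respectively. -/
inductive Config (E : Type*)
  | inner (P : Set E)
  | outer (P I : Set E)
  | final (R I : Set E)
  | no
  | found (I : Set E)

/-- The algorithm has halted. -/
def Config.Halted {E : Type*} (c : Config E) : Prop :=
  c = .no ∨ ∃ I, c = .found I

namespace StableInstance

variable {E : Type*}

/-- Strict preference. -/
def strict (X : StableInstance E) (S : Side) (e f : E) : Prop :=
  X.weak S e f ∧ ¬ X.weak S f e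

def IsCommonIndep (X : StableInstance E) (I : Set E) : Prop :=
  ∀ S, (X.M S).Indep I

/-- `e` weakly blocks `I` on the side `S`. -/
def WeaklyBlocks (X : StableInstance E) (S : Side) (I : Set E) (e : E) : Prop :=
  (X.M S).Indep (insert e I) ∨
    (¬ (X.M S).Indep (insert e I) ∧
      ∃ f ∈ I, X.weak S e f ∧ (X.M S).Indep (insert e I \ {f}))

/-- `e` strongly blocks `I` on the side `S`. -/
def StronglyBlocks (X : StableInstance E) (S : Side) (I : Set E) (e : E) : Prop :=
  (X.M S).Indep (insert e I) ∨
    (¬ (X.M S).Indep (insert e I) ∧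
      ∃ f ∈ I, X.strict S e f ∧ (X.M S).Indep (insert e I \ {f}))

/-- `e` blocks `I`. -/
def Blocks (X : StableInstance E) (I : Set E) (e : E) : Prop :=
  (e ∈ X.E1 → ∀ S, X.WeaklyBlocks S I e) ∧
    (e ∈ X.E2 → (∀ S, X.WeaklyBlocks S I e) ∧ ∃ S, X.StronglyBlocks S I e)

/-- `I` is a non-uniformly stable common independent set. -/
def IsStable (X : StableInstance E) (I : Set E) : Prop :=
  X.IsCommonIndep I ∧ ∀ e ∉ I, ¬ X.Blocks I e

/-! ### The subroutines -/

/-- The most preferred elements of `F`. -/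
def head (X : StableInstance E) (S : Side) (F : Set E) : Set E :=
  {e ∈ F | ∀ f ∈ F, X.weak S e f}

/-- The least preferred elements of `F`. -/
def tail (X : StableInstance E) (S : Side) (F : Set E) : Set E :=
  {e ∈ F | ∀ f ∈ F, X.weak S f e}

theorem head_subset (X : StableInstance E) (S : Side) (F : Set E) : X.head S F ⊆ F :=
  fun _ h => h.1

theorem head_nonempty [Finite E] (X : StableInstance E) (S : Side) {F : Set E}
    (hF : F.Nonempty) : (X.head S F).Nonempty := by
  let _ : Preorder E :=
    { le := X.weak S
      le_refl := fun e => (X.weak_total S e e).elim id id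
      le_trans := fun e f g => X.weak_trans S e f g }
  obtain ⟨m, hm⟩ := (Set.toFinite F).exists_minimal hF
  refine ⟨m, hm.1, fun f hf => ?_⟩
  rcases X.weak_total S m f with h | h
  · exact h
  · exact hm.2 hf h

theorem ncard_diff_head_lt [Finite E] (X : StableInstance E) (S : Side) {F : Set E}
    (hF : F ≠ ∅) : (F \ X.head S F).ncard < F.ncard := by
  obtain ⟨m, hm⟩ := X.head_nonempty S (Set.nonempty_iff_ne_empty.mpr hF)
  refine Set.ncard_lt_ncard ⟨Set.sdiff_subset, fun h => ?_⟩ (Set.toFinite F)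
  exact (h hm.1).2 hm

/-- One starts with `M' = M D` and `N = F`. In each pass, the head `T` of `N` contributes the summand
`M' ↾ T`; then `M'` is replaced by `M' ／ T` and `N` by `N \ T`. -/
noncomputable def layeredD [Finite E] (X : StableInstance E) (M' : Matroid E) (N : Set E) :
    Matroid E :=
  open Classical in
  if _h : N = ∅ then Matroid.emptyOn E
  else
    matroidDirectSum (M'.restrict (X.head .D N))
      (X.layeredD (M'.contract (X.head .D N)) (N \ X.head .D N))
termination_by N.ncard
decreasing_by exact X.ncard_diff_head_lt .D _h

/-- The matroid `M_D⟨F⟩` on the ground set `F`. -/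
noncomputable def matroidD [Finite E] (X : StableInstance E) (F : Set E) : Matroid E :=
  X.layeredD (X.M .D) F

/-- As `layeredD`, for the side `H`; each pass splits the head of `N` into its part in `E1`, which
comes first, and its part in `E2`. -/
noncomputable def layeredH [Finite E] (X : StableInstance E) (M' : Matroid E) (N : Set E) :
    Matroid E :=
  open Classical in
  if _h : N = ∅ then Matroid.emptyOn E
  else
    matroidDirectSum (M'.restrict (X.head .H N ∩ X.E1))
      (matroidDirectSum ((M'.contract (X.head .H N ∩ X.E1)).restrict (X.head .H N ∩ X.E2))
        (X.layeredH
          ((M'.contract (X.head .H N ∩ X.E1)).contract (X.head .H N ∩ X.E2))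
          (N \ X.head .H N)))
termination_by N.ncard
decreasing_by exact X.ncard_diff_head_lt .H _h

/-- The matroid `M_H⟨F⟩` on the ground set `F`. -/
noncomputable def matroidH [Finite E] (X : StableInstance E) (F : Set E) : Matroid E :=
  X.layeredH (X.M .H) F

/-- In each pass, the elements of the head `T` of `N` that are not loops of `M'` are chosen; then
`M'` is replaced by `M' ／ T` and `N` by `N \ T`. -/
noncomputable def layeredChoice [Finite E] (X : StableInstance E) (M' : Matroid E) (N : Set E) :
    Set E :=
  open Classical in
  if _h : N = ∅ then ∅
  else
    {e ∈ X.head .D N | M'.Indep {e}} ∪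
      X.layeredChoice (M'.contract (X.head .D N)) (N \ X.head .D N)
termination_by N.ncard
decreasing_by exact X.ncard_diff_head_lt .D _h

/-- The set `Ch_D(F)`. -/
noncomputable def choiceD [Finite E] (X : StableInstance E) (F : Set E) : Set E :=
  X.layeredChoice (X.M .D) F

/-- The elements `e` outside `I` in the closure of `I` in `M_H` that block `I`. -/
def blockSet (X : StableInstance E) (I : Set E) : Set E :=
  {e | e ∉ I ∧ e ∈ (X.M .H).closure I ∧ X.Blocks I e}

/-! ### The main algorithm -/

/-- One step of the main algorithm. The arbitrary choices of the algorithm (the base `Q`, the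
maximum-size common independent set `I`, the blocking element `b`) make it a relation. The
case `E1` has no successor if `P ∪ ((K \ Q) ∩ E1) = P`, since the algorithm would then use a set `I`
that was never defined. -/
inductive Step [Finite E] (X : StableInstance E) : Config E → Config E → Prop
  | rank {P K Q : Set E} (hK : K = X.choiceD Pᶜ) (hQ : (X.matroidH K).IsBase Q)
      (hrk : (X.M .D).eRk Pᶜ < (X.M .H).eRk K) :
      Step X (.inner P) .no
  | E1 {P K Q : Set E} (hK : K = X.choiceD Pᶜ) (hQ : (X.matroidH K).IsBase Q)
      (hrk : ¬ (X.M .D).eRk Pᶜ < (X.M .H).eRk K)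
      (hE1 : Q ∩ X.E1 ≠ K ∩ X.E1)
      (hP : P ∪ ((K \ Q) ∩ X.E1) ≠ P) :
      Step X (.inner P) (.inner (P ∪ ((K \ Q) ∩ X.E1)))
  | critical {P K Q I Z : Set E} (hK : K = X.choiceD Pᶜ) (hQ : (X.matroidH K).IsBase Q)
      (hrk : ¬ (X.M .D).eRk Pᶜ < (X.M .H).eRk K)
      (hE1 : Q ∩ X.E1 = K ∩ X.E1)
      (hI : IsMaxCommonIndep (X.matroidD K) (X.matroidH K) I)
      (hlt : I.encard < (X.M .D).eRk Pᶜ)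
      (hZ : IsCriticalSubset (X.matroidD K) (X.matroidH K) Z)
      (hP : P ∪ Z ≠ P) :
      Step X (.inner P) (.inner (P ∪ Z))
  | critical_exit {P K Q I Z : Set E} (hK : K = X.choiceD Pᶜ) (hQ : (X.matroidH K).IsBase Q)
      (hrk : ¬ (X.M .D).eRk Pᶜ < (X.M .H).eRk K)
      (hE1 : Q ∩ X.E1 = K ∩ X.E1)
      (hI : IsMaxCommonIndep (X.matroidD K) (X.matroidH K) I)
      (hlt : I.encard < (X.M .D).eRk Pᶜ)
      (hZ : IsCriticalSubset (X.matroidD K) (X.matroidH K) Z)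
      (hP : P ∪ Z = P) :
      Step X (.inner P) (.outer P I)
  | exit {P K Q I : Set E} (hK : K = X.choiceD Pᶜ) (hQ : (X.matroidH K).IsBase Q)
      (hrk : ¬ (X.M .D).eRk Pᶜ < (X.M .H).eRk K)
      (hE1 : Q ∩ X.E1 = K ∩ X.E1)
      (hI : IsMaxCommonIndep (X.matroidD K) (X.matroidH K) I)
      (hlt : ¬ I.encard < (X.M .D).eRk Pᶜ) :
      Step X (.inner P) (.outer P I)
  | repeat_outer {P I R : Set E} {b : E} (hb : b ∈ P ∩ X.blockSet I)
      (hR : R = P ∪ X.tail .H ((X.M .H).fundCircuit b I)) (hne : R ≠ P) :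
      Step X (.outer P I) (.inner R)
  | exit_outer {P I R : Set E} {b : E} (hb : b ∈ P ∩ X.blockSet I)
      (hR : R = P ∪ X.tail .H ((X.M .H).fundCircuit b I)) (heq : R = P) :
      Step X (.outer P I) (.final R I)
  | exit_outer_of_empty {P I : Set E} (hb : P ∩ X.blockSet I = ∅) :
      Step X (.outer P I) (.final P I)
  | output_no {R I : Set E} {e : E} (he : e ∈ R) (hI : (X.M .H).Indep (insert e I)) :
      Step X (.final R I) .no
  | output_found {R I : Set E} (hI : ∀ e ∈ R, ¬ (X.M .H).Indep (insert e I)) :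
      Step X (.final R I) (.found I)

/-- Some execution of the main algorithm is in the configuration `c` after exactly `k` steps. -/
inductive ReachesIn [Finite E] (X : StableInstance E) : ℕ → Config E → Prop
  | start : ReachesIn X 0 (.inner ∅)
  | step {k : ℕ} {c c' : Config E} (h : ReachesIn X k c) (hs : X.Step c c') :
      ReachesIn X (k + 1) c'

end StableInstance

/-! ### The machine model

A random access machine, programmed with assignments, conditionals and loops. Every executed
assignment, oracle call and test costs one unit of time. There is no multiplication, so that the bit
length of a number grows by at most a constant per unit of time. The instance on the ground set
`{0, …, n - 1}` is available only through the number `n`, an independence oracle for each matroid,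
and elementary look-ups of the preference relations and of the partition `E1`, `E2`. -/

/-- A memory state: number registers, and arrays of number registers. -/
structure Store where
  reg : ℕ → ℕ
  arr : ℕ → ℕ → ℕ

/-- Expressions; `size` is the number `n` of elements of the ground set, subtraction is truncated,
and `lt` has value `1` or `0`. -/
inductive Expr
  | num (k : ℕ)
  | size
  | reg (x : ℕ)
  | arr (a : ℕ) (i : Expr)
  | add (e f : Expr)
  | sub (e f : Expr)
  | lt (e f : Expr)

def Expr.eval (n : ℕ) (s : Store) : Expr → ℕ
  | .num k => k
  | .size => n
  | .reg x => s.reg x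
  | .arr a i => s.arr a (i.eval n s)
  | .add e f => e.eval n s + f.eval n s
  | .sub e f => e.eval n s - f.eval n s
  | .lt e f => if e.eval n s < f.eval n s then 1 else 0

inductive Prog
  | assign (x : ℕ) (e : Expr)
  | write (a : ℕ) (i e : Expr)
  | indep (S : Side) (x a : ℕ)
  | weak (S : Side) (x : ℕ) (e f : Expr)
  | memE1 (x : ℕ) (e : Expr)
  | seq (p q : Prog)
  | ite (e : Expr) (p q : Prog)
  | loop (e : Expr) (p : Prog)

def Store.setReg (s : Store) (x v : ℕ) : Store :=
  { s with reg := Function.update s.reg x v }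

def Store.setArr (s : Store) (a i v : ℕ) : Store :=
  { s with arr := Function.update s.arr a (Function.update (s.arr a) i v) }

/-- The subset of `{0, …, n - 1}` whose indicator is stored in the array `a`. -/
def Store.decode (n : ℕ) (s : Store) (a : ℕ) : Set (Fin n) :=
  {i | s.arr a i ≠ 0}

/-- The answer of an oracle. -/
noncomputable def answer (P : Prop) : ℕ :=
  open Classical in if P then 1 else 0

/-- `Exec X p s s' t`: on the instance `X`, the program `p`, started in the state `s`, halts in the
state `s'` after `t` units of time. -/
inductive Exec {n : ℕ} (X : StableInstance (Fin n)) : Prog → Store → Store → ℕ → Prop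
  | assign (x : ℕ) (e : Expr) (s : Store) :
      Exec X (.assign x e) s (s.setReg x (e.eval n s)) 1
  | write (a : ℕ) (i e : Expr) (s : Store) :
      Exec X (.write a i e) s (s.setArr a (i.eval n s) (e.eval n s)) 1
  | indep (S : Side) (x a : ℕ) (s : Store) :
      Exec X (.indep S x a) s (s.setReg x (answer ((X.M S).Indep (s.decode n a)))) 1
  | weak (S : Side) (x : ℕ) (e f : Expr) (s : Store) :
      Exec X (.weak S x e f) s
        (s.setReg x (answer (∃ i j : Fin n,
          (i : ℕ) = e.eval n s ∧ (j : ℕ) = f.eval n s ∧ X.weak S i j))) 1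
  | memE1 (x : ℕ) (e : Expr) (s : Store) :
      Exec X (.memE1 x e) s
        (s.setReg x (answer (∃ i : Fin n, (i : ℕ) = e.eval n s ∧ i ∈ X.E1))) 1
  | seq {p q : Prog} {s s' s'' : Store} {t t' : ℕ}
      (hp : Exec X p s s' t) (hq : Exec X q s' s'' t') :
      Exec X (.seq p q) s s'' (t + t')
  | ite_true {e : Expr} {p q : Prog} {s s' : Store} {t : ℕ}
      (he : e.eval n s ≠ 0) (hp : Exec X p s s' t) :
      Exec X (.ite e p q) s s' (t + 1)
  | ite_false {e : Expr} {p q : Prog} {s s' : Store} {t : ℕ}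
      (he : e.eval n s = 0) (hq : Exec X q s s' t) :
      Exec X (.ite e p q) s s' (t + 1)
  | loop_true {e : Expr} {p : Prog} {s s' s'' : Store} {t t' : ℕ}
      (he : e.eval n s ≠ 0) (hp : Exec X p s s' t) (hl : Exec X (.loop e p) s' s'' t') :
      Exec X (.loop e p) s s'' (t + t' + 1)
  | loop_false {e : Expr} {p : Prog} {s : Store} (he : e.eval n s = 0) :
      Exec X (.loop e p) s s 1

/-- The state `s` represents the configuration `c` of the main algorithm: register `0` holds the
kind of `c`, array `0` holds `P` or `R`, and array `1` holds `I`. -/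
def Represents {n : ℕ} (s : Store) : Config (Fin n) → Prop
  | .inner P => s.reg 0 = 0 ∧ s.decode n 0 = P
  | .outer P I => s.reg 0 = 1 ∧ s.decode n 0 = P ∧ s.decode n 1 = I
  | .final R I => s.reg 0 = 2 ∧ s.decode n 0 = R ∧ s.decode n 1 = I
  | .no => s.reg 0 = 3
  | .found I => s.reg 0 = 4 ∧ s.decode n 1 = I

/-- Run `setup`, and then `step` as long as register `0` says that the algorithm has not halted. -/
def iterateProg (setup step : Prog) : Prog :=
  .seq setup (.loop (.lt (.reg 0) (.num 3)) step)

/-! The set P collects elements that no stable set contains, and the proof works by turning every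
notion of the algorithm into a statement about closures. By fundamental circuits, an element e
outside I weakly blocks I on S exactly when the strictly better elements of I do not span e, and
strongly blocks exactly when the elements of I at least as good as e do not (`weaklyBlocks_iff`,
`stronglyBlocks_iff`). An element x is spanned by Y in a layered matroid iff, in the original
matroid, it is spanned by all earlier layers together with the part of Y in its own layer
(`IsLayering`). Ch_D(F) consists of what the strictly better elements of F do not span on the side D
(`mem_choiceD`).

The invariant `IsRejected` adds that no element of P is D-spanned by strictly better elements
outside P. Let K = Ch_D(E∖P) and let J be stable, hence disjoint from P. Every f in P ∪ K outside J
then weakly blocks J on D, so stability leaves two possibilities (`IsStable.not_blocks_cases`):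
strictly better elements of J span f on H, or f lies in E_2 and on both sides is spanned by elements
of J at least as good. All enlargements of P and all answers "No" follow from this dichotomy: by a
spanning argument for E_1 (`disjoint_of_isBase_matroidH`), by a rank count for the critical subset
(`disjoint_of_isCriticalSubset`), and by an H-independent set that would be too large for the tail
of a circuit (`false_of_mem_tail`). Conversely, when the inner loop ends, I is a base of both
layered matroids and contains K ∩ E_1, so only elements of P can block it; the last tests deal with
these (`IsSettled.isStable`, `IsSettled.not_exists_isStable`). Each return to the inner loop
enlarges P, so twice the size of P plus the number of the phase increases at every step.

For the running time, each step is written with a small query language whose primitives include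
closure and comparison of cardinalities. Queries compile to nested loops over the ground set, with
polynomial time by induction on the formula. Only matroid intersection needs real iteration. Instead
of augmenting along a whole shortest path, the program exchanges along the last edge only, which
shortens the path (`Matroid.exchange`); the pair of size and distance then bounds the number of
rounds. -/

namespace Matroid

/-! ### Closure, exchange and greedy bases. -/

variable {α : Type*} {M N : Matroid α} {X Y I J C : Set α} {e f x : α}

theorem mem_closure_of_subset (he : e ∈ M.closure X) (h : X ⊆ Y) : e ∈ M.closure Y :=
  M.closure_subset_closure h he

theorem mem_closure_of_forall_mem_closure (he : e ∈ M.closure X) (h : ∀ f ∈ X, f ∈ M.closure Y) :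
    e ∈ M.closure Y :=
  M.closure_subset_closure_of_subset_closure h he

theorem mem_closure_disjointSum_left {h : Disjoint M.E N.E} (hx : x ∈ M.E) (hY : Y ⊆ M.E ∪ N.E) :
    x ∈ (M.disjointSum N h).closure Y ↔ x ∈ M.closure (Y ∩ M.E) := by
  obtain ⟨I, hI⟩ := M.exists_isBasis (Y ∩ M.E)
  obtain ⟨J, hJ⟩ := N.exists_isBasis (Y ∩ N.E)
  have hIM := hI.indep.subset_ground
  have hJN := hJ.indep.subset_ground
  have e1 : (I ∪ J) ∩ M.E = I := by
    rw [Set.union_inter_distrib_right, Set.inter_eq_left.2 hIM,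
      (h.symm.mono_left hJN).inter_eq, Set.union_empty]
  have e2 : (I ∪ J) ∩ N.E = J := by
    rw [Set.union_inter_distrib_right, Set.inter_eq_left.2 hJN,
      (h.mono_left hIM).inter_eq, Set.empty_union]
  have hB : (M.disjointSum N h).IsBasis (I ∪ J) Y := by
    rw [disjointSum_isBasis_iff, e1, e2]
    exact ⟨hI, hJ, Set.union_subset (hI.subset.trans Set.inter_subset_left)
      (hJ.subset.trans Set.inter_subset_left), hY⟩
  rw [← hB.closure_eq_closure, ← hI.closure_eq_closure, hB.indep.mem_closure_iff',
    hI.indep.mem_closure_iff', disjointSum_indep_iff]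
  have hxN : x ∉ N.E := fun h' => h.le_bot ⟨hx, h'⟩
  have hxJ : x ∉ J := fun h' => hxN (hJN h')
  rw [Set.insert_inter_of_mem hx, Set.insert_inter_of_notMem hxN, e1, e2]
  simp only [disjointSum_ground_eq, Set.mem_union, hx, true_or, true_and, hJ.indep, hxJ, or_false]
  have : insert x (I ∪ J) ⊆ M.E ∪ N.E :=
    Set.insert_subset (Or.inl hx) (Set.union_subset_union hIM hJN)
  simp [this]

theorem mem_closure_disjointSum_right {h : Disjoint M.E N.E} (hx : x ∈ N.E)
    (hY : Y ⊆ M.E ∪ N.E) :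
    x ∈ (M.disjointSum N h).closure Y ↔ x ∈ N.closure (Y ∩ N.E) := by
  rw [disjointSum_comm, mem_closure_disjointSum_left hx (by rwa [Set.union_comm])]

/-- The elements of an independent set `J` whose exchange for `e` keeps independence span `e`
in the only way. -/
theorem Indep.insert_indep_or_exists_exchange_iff (hJ : M.Indep J) (he : e ∈ M.E) (heJ : e ∉ J)
    (p : α → Prop) :
    (M.Indep (insert e J) ∨ (¬ M.Indep (insert e J) ∧ ∃ f ∈ J, p f ∧ M.Indep (insert e J \ {f})))
      ↔ e ∉ M.closure {f ∈ J | ¬ p f} := by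
  constructor
  · rintro (h | ⟨-, f, hf, hpf, h⟩) hcl
    · exact ((hJ.notMem_closure_iff_of_notMem heJ he).2 h)
        (M.closure_subset_closure (Set.sep_subset _ _) hcl)
    · have hne : e ≠ f := fun h' => heJ (h' ▸ hf)
      rw [← Set.insert_sdiff_singleton_comm hne] at h
      have := ((hJ.subset Set.sdiff_subset).notMem_closure_iff_of_notMem
        (fun h' => heJ h'.1) he).2 h
      have hsub : {g ∈ J | ¬ p g} ⊆ J \ {f} := fun g hg => ⟨hg.1, by
        rintro rfl; exact hg.2 hpf⟩
      exact this (M.closure_subset_closure hsub hcl)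
  · intro h
    by_cases hi : M.Indep (insert e J)
    · exact Or.inl hi
    refine Or.inr ⟨hi, ?_⟩
    have heJ' : e ∈ M.closure J := by
      by_contra h'
      exact hi ((hJ.notMem_closure_iff_of_notMem heJ he).1 h')
    by_contra! hcon
    have hC := hJ.fundCircuit_isCircuit heJ' heJ
    refine h (M.closure_subset_closure ?_ (hC.mem_closure_sdiff_singleton_of_mem
      (M.mem_fundCircuit e J)))
    rintro g ⟨hg, hge⟩
    have hgJ : g ∈ J := by
      rcases M.fundCircuit_subset_insert e J hg with h' | h'
      · exact absurd h' hge
      · exact h'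
    exact ⟨hgJ, fun hp => hcon g hgJ hp ((hJ.mem_fundCircuit_iff heJ' heJ).1 hg)⟩

theorem Indep.insert_sdiff_singleton_indep_iff (hJ : M.Indep J) (he : e ∈ M.E) (heJ : e ∉ J)
    (hf : f ∈ J) : M.Indep (insert e J \ {f}) ↔ e ∉ M.closure (J \ {f}) := by
  have hne : e ≠ f := fun h' => heJ (h' ▸ hf)
  rw [← Set.insert_sdiff_singleton_comm hne,
    (hJ.subset Set.sdiff_subset).notMem_closure_iff_of_notMem (fun h' => heJ h'.1) he]

theorem union_indep_of_forall_notMem_closure (hI : M.Indep I) (hJE : J ⊆ M.E)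
    (h : ∀ e ∈ J, e ∉ M.closure (I ∪ J \ {e})) : M.Indep (I ∪ J) := by
  have hJ : M.Indep J := (indep_iff_forall_notMem_closure_sdiff hJE).2 fun e he h' =>
    h e he (M.closure_subset_closure Set.subset_union_right h')
  exact (hI.union_indep_iff_forall_notMem_closure_right hJ).2 fun e he => h e he.1

theorem eRk_add_encard_le_of_forall_notMem_closure (hJE : J ⊆ M.E)
    (h : ∀ e ∈ J, e ∉ M.closure (X ∪ J \ {e})) : M.eRk X + J.encard ≤ M.eRk (X ∪ J) := by
  obtain ⟨I, hI⟩ := M.exists_isBasis' X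
  have hsub : ∀ Y, M.closure (I ∪ Y) = M.closure (X ∪ Y) := fun Y =>
    M.closure_union_congr_left hI.closure_eq_closure
  have hIJ := union_indep_of_forall_notMem_closure hI.indep hJE
    (fun e he => by rw [hsub]; exact h e he)
  have hdis : Disjoint I J := Set.disjoint_left.2 fun e he heJ =>
    h e heJ (by rw [← hsub]; exact M.mem_closure_of_mem' (Or.inl he) (hJE heJ))
  rw [← hI.encard_eq_eRk, ← Set.encard_union_eq hdis]
  exact hIJ.encard_le_eRk_of_subset (Set.union_subset_union_left _ hI.subset)

/-- The greedy set with respect to an injective ordering of the ground set is a base. -/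
theorem isBasis_greedy [Finite α] (hX : X ⊆ M.E) {r : α → ℕ}
    (hr : Function.Injective r) : M.IsBasis {x ∈ X | x ∉ M.closure {y ∈ X | r y < r x}} X := by
  have hspan : ∀ m, ∀ x ∈ X, r x = m →
      x ∈ M.closure {y ∈ {x ∈ X | x ∉ M.closure {y ∈ X | r y < r x}} | r y ≤ m} := by
    intro m
    induction m using Nat.strong_induction_on with
    | _ m ih =>
      rintro x hx rfl
      by_cases h : x ∈ M.closure {y ∈ X | r y < r x}
      · refine M.closure_subset_closure_of_subset_closure ?_ h
        rintro y ⟨hy, hyx⟩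
        refine M.closure_subset_closure ?_ (ih (r y) hyx y hy rfl)
        exact fun z hz => ⟨hz.1, hz.2.trans hyx.le⟩
      · exact M.mem_closure_of_mem' ⟨⟨hx, h⟩, le_rfl⟩ (hX hx)
  rw [isBasis_iff_indep_subset_closure]
  refine ⟨?_, Set.sep_subset _ _, fun x hx =>
    M.closure_subset_closure (Set.sep_subset _ _) (hspan (r x) x hx rfl)⟩
  by_contra hdep
  have hdep' := (not_indep_iff ((Set.sep_subset _ _).trans hX)).1 hdep
  obtain ⟨C, hCsub, hC⟩ := hdep'.exists_isCircuit_subset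
  obtain ⟨e, he, hmax⟩ := (Set.toFinite C).exists_maximalFor r C hC.nonempty
  -- The member of a circuit that comes last in the order is spanned by earlier members, so the
  -- greedy rule would have skipped it.
  refine (hCsub he).2 (M.closure_subset_closure ?_ (hC.mem_closure_sdiff_singleton_of_mem he))
  rintro f ⟨hf, hfe⟩
  refine ⟨(hCsub hf).1, lt_of_le_of_ne ?_ fun h => hfe (hr h)⟩
  by_contra hlt
  exact hlt (hmax hf (not_le.1 hlt).le)

end Matroid

/-! ### Layered matroids, preference levels and the choice set. -/

section Layering

variable {E : Type*}

/-- `N` is the direct sum, over the values `m` of `ℓ`, of the minors of `M` obtained from the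
elements of `K` of level at most `m` by contracting those of level less than `m`. -/
structure IsLayering (M N : Matroid E) (K : Set E) (ℓ : E → ℕ) : Prop where
  ground : N.E = K
  mem_closure_iff : ∀ Y ⊆ K, ∀ x ∈ K,
    (x ∈ N.closure Y ↔ x ∈ M.closure ({y ∈ K | ℓ y < ℓ x} ∪ {y ∈ Y | ℓ y = ℓ x}))

namespace IsLayering

variable {M N : Matroid E} {K T I : Set E} {ℓ : E → ℕ}

theorem emptyOn (M : Matroid E) (ℓ : E → ℕ) : IsLayering M (Matroid.emptyOn E) ∅ ℓ :=
  ⟨rfl, fun _ _ _ hx => hx.elim⟩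

/-- T is the lowest layer: nothing precedes its own elements, and for every later element
contracting T means adding T to the spanning set. One pass of a subroutine thus extends a layering
of the contraction. -/
theorem directSum (hKM : K ⊆ M.E) (hT : T ⊆ K) (hlt : ∀ t ∈ T, ∀ x ∈ K \ T, ℓ t < ℓ x)
    (heq : ∀ t ∈ T, ∀ t' ∈ T, ℓ t = ℓ t') (h : IsLayering (M.contract T) N (K \ T) ℓ) :
    IsLayering M (matroidDirectSum (M.restrict T) N) K ℓ := by
  have hTE := hT.trans hKM
  have hd : Disjoint (M.restrict T).E N.E := by
    rw [h.ground]; exact Set.disjoint_sdiff_right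
  have hTK : T ∪ K \ T = K := Set.union_sdiff_cancel hT
  refine ⟨by rw [matroidDirectSum, dif_pos hd, Matroid.disjointSum_ground_eq, h.ground,
    Matroid.restrict_ground_eq, hTK], fun Y hY x hx => ?_⟩
  have hYE : Y ⊆ (M.restrict T).E ∪ N.E := by
    rw [h.ground, Matroid.restrict_ground_eq, hTK]; exact hY
  rw [matroidDirectSum, dif_pos hd]
  by_cases hxT : x ∈ T
  · rw [Matroid.mem_closure_disjointSum_left hxT hYE, Matroid.restrict_ground_eq,
      Matroid.restrict_closure_eq _ Set.inter_subset_right]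
    have : {y ∈ K | ℓ y < ℓ x} ∪ {y ∈ Y | ℓ y = ℓ x} = Y ∩ T := by
      ext y
      constructor
      · rintro (⟨hy, hyx⟩ | ⟨hy, hyx⟩)
        · by_cases hyT : y ∈ T
          · exact absurd (heq y hyT x hxT) hyx.ne
          · exact absurd (hlt x hxT y ⟨hy, hyT⟩) hyx.not_gt
        · by_cases hyT : y ∈ T
          · exact ⟨hy, hyT⟩
          · exact absurd (hlt x hxT y ⟨hY hy, hyT⟩) hyx.not_gt
      · exact fun hy => Or.inr ⟨hy.1, heq y hy.2 x hxT⟩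
    rw [this]
    simp [hxT]
  · rw [Matroid.mem_closure_disjointSum_right (by rw [h.ground]; exact ⟨hx, hxT⟩) hYE, h.ground,
      h.mem_closure_iff _ Set.inter_subset_right _ ⟨hx, hxT⟩, Matroid.contract_closure_eq]
    have : {y ∈ K \ T | ℓ y < ℓ x} ∪ {y ∈ Y ∩ (K \ T) | ℓ y = ℓ x} ∪ T
        = {y ∈ K | ℓ y < ℓ x} ∪ {y ∈ Y | ℓ y = ℓ x} := by
      ext y
      by_cases hyT : y ∈ T
      · have := hlt y hyT x ⟨hx, hxT⟩
        simp [hyT, this, hT hyT]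
      · have := @hY y
        simp only [Set.mem_union, Set.mem_ofPred_eq, Set.mem_sdiff, Set.mem_inter_iff, hyT]
        tauto
    rw [this]
    simp [hxT]

variable (h : IsLayering M N K ℓ)
include h

/-- In a circuit of M inside I, an element of top level is spanned by the others. Those of lower
level count as already contracted and those of equal level lie in I, so the element would be spanned
in N as well. -/
theorem indep_of_indep (hKM : K ⊆ M.E) [Finite E] (hI : N.Indep I) : M.Indep I := by
  have hIK : I ⊆ K := h.ground ▸ hI.subset_ground
  by_contra hdep
  obtain ⟨C, hCI, hC⟩ := ((Matroid.not_indep_iff (hIK.trans hKM)).1 hdep).exists_isCircuit_subset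
  obtain ⟨e, he, hmax⟩ := (Set.toFinite C).exists_maximalFor ℓ C hC.nonempty
  refine hI.notMem_closure_sdiff_of_mem (hCI he)
    ((h.mem_closure_iff _ (Set.sdiff_subset.trans hIK) e (hIK (hCI he))).2
      (M.closure_subset_closure ?_ (hC.mem_closure_sdiff_singleton_of_mem he)))
  rintro f ⟨hf, hfe⟩
  rcases lt_trichotomy (ℓ f) (ℓ e) with hlt | heq | hgt
  · exact Or.inl ⟨hIK (hCI hf), hlt⟩
  · exact Or.inr ⟨⟨hCI hf, hfe⟩, heq⟩
  · exact absurd (hmax hf hgt.le) hgt.not_ge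

/-- By induction on the level: the earlier layers that N contracts are already spanned by the part
of I in them. This is what makes a base of the layered matroid optimal, level by level. -/
theorem subset_closure_of_isBase (hKM : K ⊆ M.E) (hI : N.IsBase I) (m : ℕ) :
    {x ∈ K | ℓ x ≤ m} ⊆ M.closure {x ∈ I | ℓ x ≤ m} := by
  have hIK : I ⊆ K := h.ground ▸ hI.subset_ground
  have key : ∀ m, ∀ x ∈ K, ℓ x = m → x ∈ M.closure {y ∈ I | ℓ y ≤ m} := by
    intro m
    induction m using Nat.strong_induction_on with
    | _ m ih =>
      rintro x hx rfl
      have hx' : x ∈ N.closure I := by rw [hI.closure_eq, h.ground]; exact hx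
      rw [h.mem_closure_iff I hIK x hx] at hx'
      refine M.closure_subset_closure_of_subset_closure ?_ hx'
      rintro y (⟨hy, hyx⟩ | ⟨hy, hyx⟩)
      · exact Matroid.mem_closure_of_subset (ih _ hyx y hy rfl) fun z hz => ⟨hz.1, hz.2.trans hyx.le⟩
      · exact M.mem_closure_of_mem' ⟨hy, hyx.le⟩ (hKM (hIK hy))
  rintro x ⟨hx, hxm⟩
  exact Matroid.mem_closure_of_subset (key _ x hx rfl) fun z hz => ⟨hz.1, hz.2.trans hxm⟩

theorem isBasis_of_isBase (hKM : K ⊆ M.E) [Finite E] (hI : N.IsBase I) : M.IsBasis I K := by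
  have hIK : I ⊆ K := h.ground ▸ hI.subset_ground
  rw [Matroid.isBasis_iff_indep_subset_closure]
  exact ⟨h.indep_of_indep hKM hI.indep, hIK, fun x hx => M.closure_subset_closure
    (Set.sep_subset _ _) (h.subset_closure_of_isBase hKM hI (ℓ x) ⟨hx, le_rfl⟩)⟩

theorem eRank_eq (hKM : K ⊆ M.E) [Finite E] : N.eRank = M.eRk K := by
  obtain ⟨B, hB⟩ := N.exists_isBase
  rw [← hB.encard_eq_eRank, (h.isBasis_of_isBase hKM hB).encard_eq_eRk]

end IsLayering

namespace StableInstance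

variable (X : StableInstance E) (S : Side)

/-- The number of elements that are strictly better than `e`. -/
noncomputable def level (e : E) : ℕ := {f | X.strict S f e}.ncard

open Classical in
/-- The levels on the side `H`, with ties broken in favour of `E1`. -/
noncomputable def levelH (e : E) : ℕ := 2 * X.level .H e + if e ∈ X.E1 then 0 else 1

theorem weak_refl (e : E) : X.weak S e e := (X.weak_total S e e).elim id id

theorem mem_E2_iff {e : E} : e ∈ X.E2 ↔ e ∉ X.E1 := by
  have h1 : e ∈ X.E1 ∪ X.E2 := X.E1_union_E2 ▸ Set.mem_univ e
  exact ⟨fun h h' => Set.disjoint_left.1 X.disjoint_E1_E2 h' h, fun h => h1.resolve_left h⟩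

theorem strict_iff_not_weak {e f : E} : X.strict S e f ↔ ¬ X.weak S f e :=
  ⟨fun h => h.2, fun h => ⟨(X.weak_total S e f).resolve_right h, h⟩⟩

variable [Finite E]

/-- By transitivity the sets of strictly better elements are nested, so their sizes represent the
preference numerically, ties included. -/
theorem level_lt_iff {e f : E} : X.level S e < X.level S f ↔ X.strict S e f := by
  constructor
  · intro h
    rw [strict_iff_not_weak]
    intro hw
    refine h.not_ge (Set.ncard_le_ncard (fun g hg => ?_) (Set.toFinite _))
    rw [Set.mem_ofPred_eq, strict_iff_not_weak] at hg ⊢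
    exact fun hw' => hg (X.weak_trans S _ _ _ hw hw')
  · intro h
    refine Set.ncard_lt_ncard ⟨fun g hg => ?_, fun hsub => ?_⟩ (Set.toFinite _)
    · rw [Set.mem_ofPred_eq, strict_iff_not_weak] at hg ⊢
      exact fun hw => hg (X.weak_trans S _ _ _ h.1 hw)
    · exact (hsub h).2 (X.weak_refl S e)

theorem level_le_iff {e f : E} : X.level S e ≤ X.level S f ↔ X.weak S e f := by
  rw [← not_lt, level_lt_iff, strict_iff_not_weak, not_not]

theorem mem_head_iff {F : Set E} {e : E} :
    e ∈ X.head S F ↔ e ∈ F ∧ ∀ f ∈ F, X.level S e ≤ X.level S f := by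
  simp [head, level_le_iff]

theorem mem_tail_iff {F : Set E} {e : E} :
    e ∈ X.tail S F ↔ e ∈ F ∧ ∀ f ∈ F, X.level S f ≤ X.level S e := by
  simp [tail, level_le_iff]

theorem level_lt_of_head {F : Set E} {e f : E} (he : e ∈ X.head S F) (hf : f ∈ F \ X.head S F) :
    X.level S e < X.level S f := by
  rw [mem_head_iff] at he
  by_contra h
  exact hf.2 ((X.mem_head_iff S).2 ⟨hf.1, fun g hg => (not_lt.1 h).trans (he.2 g hg)⟩)

theorem level_eq_of_head {F : Set E} {e f : E} (he : e ∈ X.head S F) (hf : f ∈ X.head S F) :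
    X.level S e = X.level S f := by
  rw [mem_head_iff] at he hf
  exact le_antisymm (he.2 f hf.1) (hf.2 e he.1)

theorem isLayering_layeredD (M : Matroid E) (F : Set E) (hF : F ⊆ M.E) :
    IsLayering M (X.layeredD M F) F (X.level .D) := by
  induction h : F.ncard using Nat.strong_induction_on generalizing M F with
  | _ m ih =>
    subst h
    rw [layeredD]
    split_ifs with hF0
    · subst hF0; exact IsLayering.emptyOn _ _
    · refine IsLayering.directSum hF (X.head_subset .D F) (fun t ht x hx =>
        X.level_lt_of_head .D ht hx) (fun t ht t' ht' => X.level_eq_of_head .D ht ht') ?_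
      refine ih _ (X.ncard_diff_head_lt .D hF0) _ _ ?_ rfl
      exact Set.sdiff_subset_sdiff_left hF

theorem isLayering_matroidD (K : Set E) :
    IsLayering (X.M .D) (X.matroidD K) K (X.level .D) :=
  X.isLayering_layeredD _ _ (by rw [X.ground]; exact Set.subset_univ _)

theorem isLayering_layeredH (M : Matroid E) (F : Set E) (hF : F ⊆ M.E) :
    IsLayering M (X.layeredH M F) F X.levelH := by
  induction h : F.ncard using Nat.strong_induction_on generalizing M F with
  | _ m ih =>
    subst h
    rw [layeredH]
    split_ifs with hF0
    · subst hF0; exact IsLayering.emptyOn _ _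
    have hsub := X.head_subset .H F
    have hdiff : (F \ (X.head .H F ∩ X.E1)) \ (X.head .H F ∩ X.E2) = F \ X.head .H F := by
      ext e
      simp only [Set.mem_sdiff, Set.mem_inter_iff, mem_E2_iff]
      tauto
    refine IsLayering.directSum hF (Set.inter_subset_left.trans hsub) ?_ ?_ ?_
    · rintro t ⟨ht, ht1⟩ x ⟨hx, hxT⟩
      by_cases hxh : x ∈ X.head .H F
      · have hx1 : x ∉ X.E1 := fun h => hxT ⟨hxh, h⟩
        have := X.level_eq_of_head .H ht hxh
        simp [levelH, ht1, hx1, this]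
      · have := X.level_lt_of_head .H ht ⟨hx, hxh⟩
        simp only [levelH, ht1, if_true]
        omega
    · rintro t ⟨ht, ht1⟩ t' ⟨ht', ht1'⟩
      simp [levelH, ht1, ht1', X.level_eq_of_head .H ht ht']
    have hF' : F \ (X.head .H F ∩ X.E1) ⊆ (M.contract (X.head .H F ∩ X.E1)).E :=
      Set.sdiff_subset_sdiff_left hF
    refine IsLayering.directSum hF' ?_ ?_ ?_ ?_
    · rintro t ⟨ht, ht2⟩
      exact ⟨hsub ht, fun h => (X.mem_E2_iff.1 ht2) h.2⟩
    · rintro t ⟨ht, ht2⟩ x hx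
      have := X.level_lt_of_head .H ht (hdiff ▸ hx)
      simp only [levelH, X.mem_E2_iff.1 ht2, if_false]
      omega
    · rintro t ⟨ht, ht2⟩ t' ⟨ht', ht2'⟩
      rw [mem_E2_iff] at ht2 ht2'
      simp [levelH, ht2, ht2', X.level_eq_of_head .H ht ht']
    · rw [hdiff]
      refine ih _ (X.ncard_diff_head_lt .H hF0) _ _ ?_ rfl
      rw [← hdiff]
      exact Set.sdiff_subset_sdiff_left hF'

theorem isLayering_matroidH (K : Set E) :
    IsLayering (X.M .H) (X.matroidH K) K X.levelH :=
  X.isLayering_layeredH _ _ (by rw [X.ground]; exact Set.subset_univ _)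

/-- The successive contractions add exactly the strictly better elements of F to the closure, so not
being a loop of the current minor means not being spanned by them. -/
theorem mem_layeredChoice (M : Matroid E) (F : Set E) (hF : F ⊆ M.E) (e : E) :
    e ∈ X.layeredChoice M F ↔
      e ∈ F ∧ e ∉ M.closure {f ∈ F | X.level .D f < X.level .D e} := by
  induction h : F.ncard using Nat.strong_induction_on generalizing M F with
  | _ m ih =>
    subst h
    rw [layeredChoice]
    split_ifs with hF0
    · simp [hF0]
    rw [Set.mem_union, ih _ (X.ncard_diff_head_lt .D hF0) _ _
      (Set.sdiff_subset_sdiff_left hF) rfl]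
    by_cases he : e ∈ X.head .D F
    · have hempty : {f ∈ F | X.level .D f < X.level .D e} = ∅ := by
        ext f
        simp only [Set.mem_ofPred_eq, Set.mem_empty_iff_false, iff_false, not_and, not_lt]
        exact fun hf => ((X.mem_head_iff .D).1 he).2 f hf
      have heF := X.head_subset .D F he
      have : M.Indep {e} ↔ e ∉ M.closure ∅ := by
        have := M.empty_indep.notMem_closure_iff_of_notMem (Set.notMem_empty e) (hF heF)
        simpa using this.symm
      simp only [Set.mem_ofPred_eq, he, heF, hempty, this, Set.mem_sdiff, not_true, and_false,
        false_and, or_false, true_and]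
    · have hleft : e ∉ {e ∈ X.head .D F | M.Indep {e}} := fun h => he h.1
      rw [or_iff_right hleft, Set.mem_sdiff, and_iff_left he]
      refine and_congr_right fun heF => ?_
      have : {f ∈ F \ X.head .D F | X.level .D f < X.level .D e} ∪ X.head .D F
          = {f ∈ F | X.level .D f < X.level .D e} := by
        ext f
        by_cases hf : f ∈ X.head .D F
        · simp [hf, X.head_subset .D F hf, X.level_lt_of_head .D hf ⟨heF, he⟩]
        · simp [hf]
      rw [Matroid.contract_closure_eq, this]
      simp [he]

theorem mem_choiceD {F : Set E} {e : E} : e ∈ X.choiceD F ↔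
      e ∈ F ∧ e ∉ (X.M .D).closure {f ∈ F | X.level .D f < X.level .D e} :=
  X.mem_layeredChoice _ _ (by rw [X.ground]; exact Set.subset_univ _) e

end StableInstance

end Layering

/-- A potential that increases until T holds is at least the number of rounds made without T. After
B such rounds, one more would exceed its bound. This serves both for the saturation of the search
and for the number of augmentations. -/
theorem Function.terminal_iterate {α : Type*} {f : α → α} (Φ : α → ℕ) {B : ℕ} {Inv T : α → Prop}
    (hInv : ∀ a, Inv a → Inv (f a)) (hB : ∀ a, Inv a → Φ a ≤ B) (hT : ∀ a, Inv a → T a → T (f a))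
    (hlt : ∀ a, Inv a → ¬ T a → Φ a < Φ (f a)) {m : ℕ} (hm : B ≤ m) {a : α} (ha : Inv a) :
    Inv (f^[m] a) ∧ T (f^[m] a) := by
  have key : ∀ m, Inv (f^[m] a) ∧ (¬ T (f^[m] a) → m ≤ Φ (f^[m] a)) := by
    intro m
    induction m with
    | zero => exact ⟨ha, fun _ => Nat.zero_le _⟩
    | succ m ih =>
      rw [Function.iterate_succ_apply']
      refine ⟨hInv _ ih.1, fun h => ?_⟩
      have h' : ¬ T (f^[m] a) := fun h' => h (hT _ ih.1 h')
      exact (ih.2 h').trans_lt (hlt _ ih.1 h')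
  refine ⟨(key m).1, ?_⟩
  by_contra h
  have h1 := hlt _ (key m).1 h
  have h2 := hB _ (hInv _ (key m).1)
  have h3 := (key m).2 h
  omega

/-! ### Matroid intersection: exchange graph, cuts and critical subsets. -/

namespace Matroid

variable {α : Type*} {M N : Matroid α} {I J L X Z : Set α} {e f t x : α} {k : ℕ}

/-- Elements of I that can be omitted one at a time can be omitted together, since all of them avoid
the unique fundamental circuit of x. -/
theorem Indep.mem_closure_sep_of_forall (hI : M.Indep I) (hx : x ∈ M.closure I) (p : α → Prop)
    (h : ∀ f ∈ I, ¬ p f → x ∈ M.closure (I \ {f})) : x ∈ M.closure {f ∈ I | p f} := by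
  by_cases hxI : x ∈ I
  · by_cases hp : p x
    · exact M.mem_closure_of_mem' ⟨hxI, hp⟩ (hI.subset_ground hxI)
    · exact absurd (h x hxI hp) (hI.notMem_closure_sdiff_of_mem hxI)
  · have hxE := M.closure_subset_ground I hx
    by_contra hcon
    have := (hI.insert_indep_or_exists_exchange_iff hxE hxI (fun f => ¬ p f)).2
      (by simpa using hcon)
    rcases this with h' | ⟨-, f, hf, hpf, h'⟩
    · exact (hI.notMem_closure_iff_of_notMem hxI hxE).2 h' hx
    · exact (hI.insert_sdiff_singleton_indep_iff hxE hxI hf).1 h' (h f hf hpf)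

/-- The elements that extend `I` in `M`. -/
def sources (M : Matroid α) (I : Set α) : Set α := {x ∈ M.E | x ∉ M.closure I}

/-- One round of the search in the exchange graph of `I`. -/
def grow (M N : Matroid α) (I L : Set α) : Set α :=
  L ∪ {x ∈ M.E | x ∉ I ∧ ∃ e ∈ L, ∃ f ∈ I, e ∉ N.closure (I \ {f}) ∧ x ∉ M.closure (I \ {f})}

/-- The elements outside `I` that are reached within `k` rounds. -/
def reach (M N : Matroid α) (I : Set α) (k : ℕ) : Set α := (M.grow N I)^[k] (M.sources I)

theorem reach_succ : M.reach N I (k + 1) = M.grow N I (M.reach N I k) :=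
  Function.iterate_succ_apply' _ _ _

theorem subset_grow : L ⊆ M.grow N I L := Set.subset_union_left

theorem reach_mono : Monotone (M.reach N I) :=
  monotone_nat_of_le_succ fun k => by rw [reach_succ]; exact subset_grow

theorem reach_subset (k : ℕ) : M.reach N I k ⊆ M.E \ I := by
  induction k with
  | zero =>
    rintro x ⟨hx, hxI⟩
    exact ⟨hx, fun h => hxI (M.mem_closure_of_mem' h hx)⟩
  | succ k ih =>
    rw [reach_succ]
    exact Set.union_subset ih fun x hx => ⟨hx.1, hx.2.1⟩

theorem grow_reach_card [Finite α] : M.grow N I (M.reach N I (Nat.card α)) =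
    M.reach N I (Nat.card α) := by
  refine (Function.terminal_iterate (f := M.grow N I) (T := fun L => M.grow N I L = L)
    (Inv := fun _ => True) Set.ncard (fun _ _ => trivial) (fun L _ => Set.ncard_le_card L)
    (fun L _ h => by rw [h, h]) (fun L _ h => ?_) le_rfl trivial).2
  exact Set.ncard_lt_ncard (subset_grow.ssubset_of_ne (Ne.symm h)) (Set.toFinite _)

/-- The set that the elements of `L` reach in the exchange graph of `I`. -/
def cut (N : Matroid α) (I L : Set α) : Set α := L ∪ {f ∈ I | ∃ e ∈ L, e ∉ N.closure (I \ {f})}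

theorem eRk_le_encard_of_subset_closure (h : X ⊆ M.closure J) : M.eRk X ≤ J.encard :=
  (M.eRk_mono h).trans (by rw [eRk_closure_eq]; exact eRk_le_encard _ _)

/-- Weak duality of matroid intersection: J is split into its parts outside and inside X. -/
theorem encard_le_edmondsFun (hM : M.Indep J) (hN : N.Indep J) :
    J.encard ≤ edmondsFun M N X := by
  rw [← Set.encard_sdiff_add_encard_inter J X]
  exact add_le_add
    ((hM.subset Set.sdiff_subset).encard_le_eRk_of_subset
      (Set.sdiff_subset_sdiff_left hM.subset_ground))
    ((hN.subset Set.inter_subset_left).encard_le_eRk_of_subset Set.inter_subset_right)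

section Optimal

variable (hE : N.E = M.E) (hM : M.Indep I) (hN : N.Indep I)
include hE hM hN

omit hE in
-- If a search closed under exchange edges contains all sources but no sink, then I outside the cut
-- spans the complement of the cut in M, and I inside the cut spans the cut in N. Any further span
-- would need an edge out of the cut. Hence weak duality is attained.
theorem edmondsFun_cut (hL : L ⊆ M.E \ I) (hs : M.sources I ⊆ L) (hg : M.grow N I L = L)
    (hsink : L ⊆ N.closure I) : edmondsFun M N (N.cut I L) = I.encard := by
  refine le_antisymm ?_ (encard_le_edmondsFun hM hN)
  rw [← Set.encard_sdiff_add_encard_inter I (N.cut I L)]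
  refine add_le_add ?_ ?_
  · refine eRk_le_encard_of_subset_closure ?_
    · rintro x ⟨hx, hxZ⟩
      have hxL : x ∉ L := fun h => hxZ (Or.inl h)
      have hxI : x ∈ M.closure I := by
        by_contra h
        exact hxL (hs ⟨hx, h⟩)
      refine hM.mem_closure_sep_of_forall hxI (fun f => f ∉ N.cut I L) fun f hf hfZ => ?_
      rcases not_not.1 hfZ with hfL | ⟨-, e, he, hef⟩
      · exact absurd hf (hL hfL).2
      by_contra hxf
      by_cases hxI' : x ∈ I
      · by_cases hxf' : x = f
        · exact hxZ (hxf' ▸ not_not.1 hfZ)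
        · exact hxf (M.mem_closure_of_mem' ⟨hxI', hxf'⟩ hx)
      · exact hxL (hg ▸ Or.inr ⟨hx, hxI', e, he, f, hf, hef, hxf⟩)
  · refine eRk_le_encard_of_subset_closure ?_
    · rintro x (hx | hx)
      · refine hN.mem_closure_sep_of_forall (hsink hx) (fun f => f ∈ N.cut I L)
          fun f hf hfZ => ?_
        by_contra h
        exact hfZ (Or.inr ⟨hf, x, hx, h⟩)
      · exact N.mem_closure_of_mem' ⟨hx.1, Or.inr hx⟩ (hN.subset_ground hx.1)

/-- Complementary slackness: if X attains the bound, then I outside X spans the complement of X in M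
and I inside X spans X in N. All sources therefore lie in X and no edge leaves X, so X contains
everything reachable. This makes the cut the least minimizer, which is the critical subset. -/
theorem cut_subset_of_edmondsFun_le [Finite α] (hX : X ⊆ M.E) (h : edmondsFun M N X ≤ I.encard) :
    N.cut I (M.reach N I k) ⊆ X := by
  have hle1 : (I \ X).encard ≤ M.eRk (M.E \ X) :=
    (hM.subset Set.sdiff_subset).encard_le_eRk_of_subset
      (Set.sdiff_subset_sdiff_left hM.subset_ground)
  have hle2 : (I ∩ X).encard ≤ N.eRk X :=
    (hN.subset Set.inter_subset_left).encard_le_eRk_of_subset Set.inter_subset_right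
  rw [edmondsFun, ← Set.encard_sdiff_add_encard_inter I X] at h
  have hf1 : (I \ X).encard ≠ ⊤ := (Set.toFinite _).encard_lt_top.ne
  have hf2 : (I ∩ X).encard ≠ ⊤ := (Set.toFinite _).encard_lt_top.ne
  have h1 : M.eRk (M.E \ X) ≤ (I \ X).encard := by
    by_contra hlt
    exact (h.trans_lt (ENat.add_lt_add_of_lt_of_le hf2 (not_le.1 hlt) hle2)).false
  have h2 : N.eRk X ≤ (I ∩ X).encard := by
    by_contra hlt
    exact (h.trans_lt (ENat.add_lt_add_of_le_of_lt hf1 hle1 (not_le.1 hlt))).false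
  have hb1 : M.E \ X ⊆ M.closure (I \ X) := by
    refine ((hM.subset Set.sdiff_subset).isBasis_of_eRk_ge (Set.toFinite _)
      (Set.sdiff_subset_sdiff_left hM.subset_ground) ?_).subset_closure
    rwa [(hM.subset Set.sdiff_subset).eRk_eq_encard]
  have hb2 : X ⊆ N.closure (I ∩ X) := by
    refine ((hN.subset Set.inter_subset_left).isBasis_of_eRk_ge (Set.toFinite _)
      Set.inter_subset_right ?_ (hE ▸ hX)).subset_closure
    rwa [(hN.subset Set.inter_subset_left).eRk_eq_encard]
  have hback : ∀ e ∈ X, ∀ f ∈ I, e ∉ N.closure (I \ {f}) → f ∈ X := by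
    intro e he f hf hef
    by_contra hfX
    exact hef (mem_closure_of_subset (hb2 he) fun g hg => ⟨hg.1, fun h => hfX (h ▸ hg.2)⟩)
  have hreach : M.reach N I k ⊆ X := by
    induction k with
    | zero =>
      rintro x ⟨hx, hxI⟩
      by_contra hxX
      exact hxI (mem_closure_of_subset (hb1 ⟨hx, hxX⟩) Set.sdiff_subset)
    | succ k ih =>
      rw [reach_succ]
      refine Set.union_subset ih ?_
      rintro x ⟨hx, -, e, he, f, hf, hef, hxf⟩
      by_contra hxX
      have hfX := hback e (ih he) f hf hef
      exact hxf (mem_closure_of_subset (hb1 ⟨hx, hxX⟩)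
        fun g hg => ⟨hg.1, fun h => hg.2 (h ▸ hfX)⟩)
  refine Set.union_subset hreach ?_
  rintro f ⟨hf, e, he, hef⟩
  exact hback e (hreach he) f hf hef

theorem isCriticalSubset_cut [Finite α]
    (hsink : M.reach N I (Nat.card α) ⊆ N.closure I) :
    edmondsFun M N (N.cut I (M.reach N I (Nat.card α))) = I.encard ∧
      IsMaxCommonIndep M N I ∧ IsCriticalSubset M N (N.cut I (M.reach N I (Nat.card α))) := by
  have h := edmondsFun_cut hM hN (reach_subset _) (reach_mono (Nat.zero_le _)) grow_reach_card
    hsink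
  refine ⟨h, ⟨hM, hN, fun J hJM hJN => h ▸ encard_le_edmondsFun hJM hJN⟩,
    ⟨Set.union_subset ((reach_subset _).trans Set.sdiff_subset)
      fun x hx => hM.subset_ground hx.1, fun Y hY => h ▸ encard_le_edmondsFun hM hN⟩, ?_⟩
  rintro Y ⟨hYE, hY⟩ -
  refine cut_subset_of_edmondsFun_le hE hM hN hYE (h ▸ hY _ ?_)
  exact Set.union_subset ((reach_subset _).trans Set.sdiff_subset)
      fun x hx => hM.subset_ground hx.1

/-- Only the last edge of a shortest path to the sink t is used: f is replaced by t, and the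
predecessor e becomes a sink, reachable within k rounds. Earlier edges survive because t is not
reached within k rounds. So t is M-spanned by I, and by I without g for every g on such an edge;
replacing f by t therefore enlarges no relevant M-closure. On the side N, t is independent of I
while the elements reached are spanned by I, so t does not help to span them. -/
theorem exchange (hk : M.reach N I k ⊆ N.closure I) (ht : t ∈ M.E) (htk : t ∉ M.reach N I k)
    (htN : t ∉ N.closure I) (hf : f ∈ I) (he : e ∈ M.reach N I k) (hef : e ∉ N.closure (I \ {f}))
    (htf : t ∉ M.closure (I \ {f})) :
    M.Indep (insert t (I \ {f})) ∧ N.Indep (insert t (I \ {f})) ∧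
      e ∈ M.reach N (insert t (I \ {f})) k ∧ e ∉ N.closure (insert t (I \ {f})) := by
  have htI : t ∉ I := fun h => htN (N.mem_closure_of_mem' h (hE ▸ ht))
  have htM : t ∈ M.closure I := by
    by_contra h
    exact htk (reach_mono (Nat.zero_le k) ⟨ht, h⟩)
  have hM' : M.Indep (insert t (I \ {f})) :=
    ((hM.subset Set.sdiff_subset).notMem_closure_iff_of_notMem (fun h => htI h.1) ht).1 htf
  have hN' : N.Indep (insert t (I \ {f})) :=
    ((hN.notMem_closure_iff_of_notMem htI (hE ▸ ht)).1 htN).subset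
      (Set.insert_subset_insert Set.sdiff_subset)
  have hexch : ∀ g, ∀ e ∈ M.reach N I k, e ∉ N.closure (I \ {g}) →
      e ∉ N.closure (insert t (I \ {g})) := by
    intro g e he heg h
    have h1 := N.closure_exchange ⟨h, heg⟩
    refine htN (mem_closure_of_forall_mem_closure h1.1 ?_)
    rintro y (rfl | hy)
    · exact hk he
    · exact N.mem_closure_of_mem' hy.1 (hN.subset_ground hy.1)
  have hreach : ∀ j ≤ k, M.reach N I j ⊆ M.reach N (insert t (I \ {f})) j := by
    intro j
    induction j with
    | zero =>
      rintro - x ⟨hx, hxI⟩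
      refine ⟨hx, fun h => hxI (mem_closure_of_forall_mem_closure h ?_)⟩
      rintro y (rfl | hy)
      · exact htM
      -- Sources stay sources, because the new set lies in the M-closure of I.
      · exact M.mem_closure_of_mem' hy.1 (hM.subset_ground hy.1)
    | succ j ih =>
      intro hj x hx
      have hxt : x ≠ t := fun h => htk (h ▸ reach_mono hj hx)
      rw [reach_succ] at hx ⊢
      rcases hx with hx | ⟨hx, hxI, e', he', g, hg, heg, hxg⟩
      · exact Or.inl (ih (Nat.le_of_succ_le hj) hx)
      have htg : t ∈ M.closure (I \ {g}) := by
        by_contra h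
        refine htk (reach_mono hj ?_)
        rw [reach_succ]
        exact Or.inr ⟨ht, htI, e', he', g, hg, heg, h⟩
      -- So g is still in the new set and the old exchange edge through g is available.
      have hgf : g ≠ f := by rintro rfl; exact htf htg
      refine Or.inr ⟨hx, ?_, e', ih (Nat.le_of_succ_le hj) he', g,
        Or.inr ⟨hg, hgf⟩, fun h => ?_, fun h => ?_⟩
      · rintro (h | h)
        · exact hxt h
        · exact hxI h.1
      · refine hexch g e' (reach_mono (Nat.le_of_succ_le hj) he') heg
          (mem_closure_of_subset h ?_)
        rintro y ⟨rfl | hy, hyg⟩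
        · exact Or.inl rfl
        · exact Or.inr ⟨hy.1, hyg⟩
      · refine hxg (mem_closure_of_forall_mem_closure h ?_)
        rintro y ⟨rfl | hy, hyg⟩
        · exact htg
        · exact M.mem_closure_of_mem' ⟨hy.1, hyg⟩ (hM.subset_ground hy.1)
  exact ⟨hM', hN', hreach k le_rfl he, hexch f e he hef⟩

theorem insert_indep_of_mem_sources (ht : t ∈ M.sources I) (htN : t ∉ N.closure I) :
    t ∉ I ∧ M.Indep (insert t I) ∧ N.Indep (insert t I) := by
  have htI : t ∉ I := fun h => ht.2 (M.mem_closure_of_mem' h ht.1)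
  exact ⟨htI, (hM.notMem_closure_iff_of_notMem htI ht.1).1 ht.2,
    (hN.notMem_closure_iff_of_notMem htI (hE ▸ ht.1)).1 htN⟩

omit hM hN in
-- Each exchange keeps the size and moves the sink one round closer to the sources. At distance zero
-- the sink is itself a source and can simply be added.
theorem exists_encard_lt_of_reach [Finite α] (k : ℕ) : ∀ I, M.Indep I → N.Indep I →
    ∀ t ∈ M.reach N I k, t ∉ N.closure I → ∃ J, M.Indep J ∧ N.Indep J ∧ I.encard < J.encard := by
  induction k with
  | zero =>
    intro I hM hN t ht htN
    obtain ⟨htI, h1, h2⟩ := insert_indep_of_mem_sources hE hM hN ht htN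
    refine ⟨_, h1, h2, ?_⟩
    rw [Set.encard_insert_of_notMem htI]
    exact ENat.lt_add_one_iff (Set.toFinite _).encard_lt_top.ne |>.2 le_rfl
  | succ k ih =>
    intro I hM hN t ht htN
    by_cases hk : M.reach N I k ⊆ N.closure I
    · rw [reach_succ] at ht
      rcases ht with ht | ⟨htE, htI, e, he, f, hf, hef, htf⟩
      · exact absurd (hk ht) htN
      · obtain ⟨h1, h2, h3, h4⟩ := exchange hE hM hN hk htE (fun h => htN (hk h)) htN hf he hef htf
        obtain ⟨J, hJ1, hJ2, hJ⟩ := ih _ h1 h2 e h3 h4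
        refine ⟨J, hJ1, hJ2, ?_⟩
        rwa [Set.encard_insert_of_notMem (fun h => htI h.1), Set.encard_sdiff_singleton_add_one hf]
          at hJ
    · obtain ⟨t', ht', htN'⟩ := Set.not_subset.1 hk
      exact ih I hM hN t' ht' htN'

end Optimal

theorem isCriticalSubset_cut_of_isMaxCommonIndep [Finite α] (hE : N.E = M.E)
    (h : IsMaxCommonIndep M N I) :
    edmondsFun M N (N.cut I (M.reach N I (Nat.card α))) = I.encard ∧
      IsCriticalSubset M N (N.cut I (M.reach N I (Nat.card α))) := by
  have := isCriticalSubset_cut hE h.1 h.2.1 fun t ht => by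
    by_contra htN
    obtain ⟨J, h1, h2, h3⟩ := exists_encard_lt_of_reach hE _ I h.1 h.2.1 t ht htN
    exact (h.2.2 J h1 h2).not_gt h3
  exact ⟨this.1, this.2.2⟩

theorem exists_isMaxCommonIndep [Finite α] (M N : Matroid α) : ∃ I, IsMaxCommonIndep M N I := by
  obtain ⟨I, hI, hmax⟩ := (Set.toFinite {I | M.Indep I ∧ N.Indep I}).exists_maximalFor Set.encard _
    ⟨∅, M.empty_indep, N.empty_indep⟩
  exact ⟨I, hI.1, hI.2, fun J h1 h2 => (le_total _ _).elim (hmax ⟨h1, h2⟩) id⟩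

end Matroid

/-! ### Blocking as a closure condition, and the elements that stable sets avoid. -/

namespace StableInstance

variable {E : Type*} (X : StableInstance E)

theorem subset_ground (S : Side) (F : Set E) : F ⊆ (X.M S).E := by
  rw [X.ground]; exact Set.subset_univ _

theorem mem_ground (S : Side) (e : E) : e ∈ (X.M S).E := by
  rw [X.ground]; exact Set.mem_univ _

theorem mem_closure {S : Side} {F : Set E} {e : E} (he : e ∈ F) : e ∈ (X.M S).closure F :=
  (X.M S).mem_closure_of_mem' he (X.mem_ground S e)

variable [Finite E]

/-- If e fails to extend I, the elements exchangeable for e form its fundamental circuit. None of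
them is weakly worse than e exactly when the circuit consists, apart from e, of strictly better
elements, that is, when these span e. -/
theorem weaklyBlocks_iff {S : Side} {I : Set E} {e : E} (hI : (X.M S).Indep I) (he : e ∉ I) :
    X.WeaklyBlocks S I e ↔ e ∉ (X.M S).closure {f ∈ I | X.level S f < X.level S e} := by
  have := hI.insert_indep_or_exists_exchange_iff (X.mem_ground S e) he (fun f => X.weak S e f)
  simpa only [← X.level_le_iff, not_le, WeaklyBlocks] using this

theorem stronglyBlocks_iff {S : Side} {I : Set E} {e : E} (hI : (X.M S).Indep I) (he : e ∉ I) :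
    X.StronglyBlocks S I e ↔ e ∉ (X.M S).closure {f ∈ I | X.level S f ≤ X.level S e} := by
  have := hI.insert_indep_or_exists_exchange_iff (X.mem_ground S e) he (fun f => X.strict S e f)
  simpa only [← X.level_lt_iff, not_lt, StronglyBlocks] using this

/-- No stable set meets `P`, and every element of `P` weakly blocks on the side `D` every
independent set that avoids `P`. -/
structure IsRejected (P : Set E) : Prop where
  disjoint : ∀ J, X.IsStable J → Disjoint J P
  notMem_closure : ∀ e ∈ P, e ∉ (X.M .D).closure {f ∈ Pᶜ | X.level .D f < X.level .D e}

theorem choiceD_subset {F : Set E} : X.choiceD F ⊆ F := fun _ h => (X.mem_choiceD.1 h).1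

/-- By induction on the level, since an element that is not chosen is spanned by strictly better
ones. Consequently K can replace E∖P in all D-closures. -/
theorem mem_closure_choiceD {F : Set E} {x : E} (hx : x ∈ F) :
    x ∈ (X.M .D).closure {y ∈ X.choiceD F | X.level .D y ≤ X.level .D x} := by
  induction h : X.level .D x using Nat.strong_induction_on generalizing x with
  | _ m ih =>
    subst h
    by_cases hxK : x ∈ X.choiceD F
    · exact X.mem_closure ⟨hxK, le_rfl⟩
    · have : x ∈ (X.M .D).closure {f ∈ F | X.level .D f < X.level .D x} := by
        by_contra h
        exact hxK (X.mem_choiceD.2 ⟨hx, h⟩)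
      refine Matroid.mem_closure_of_forall_mem_closure this fun f hf => ?_
      exact Matroid.mem_closure_of_subset (ih _ hf.2 hf.1 rfl)
        fun g hg => ⟨hg.1, hg.2.trans hf.2.le⟩

theorem eRk_choiceD (F : Set E) : (X.M .D).eRk (X.choiceD F) = (X.M .D).eRk F := by
  refine le_antisymm ((X.M .D).eRk_mono X.choiceD_subset) ?_
  rw [← Matroid.eRk_closure_eq _ (X.choiceD F)]
  exact (X.M .D).eRk_mono fun x hx =>
    Matroid.mem_closure_of_subset (X.mem_closure_choiceD hx) (Set.sep_subset _ _)

theorem eRank_matroidD (F : Set E) : (X.matroidD (X.choiceD F)).eRank = (X.M .D).eRk F := by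
  rw [(X.isLayering_matroidD _).eRank_eq (X.subset_ground _ _), eRk_choiceD]

theorem matroidD_ground (K : Set E) : (X.matroidD K).E = K := (X.isLayering_matroidD K).ground

theorem matroidH_ground (K : Set E) : (X.matroidH K).E = K := (X.isLayering_matroidH K).ground

theorem indep_D {K I : Set E} (h : (X.matroidD K).Indep I) : (X.M .D).Indep I :=
  (X.isLayering_matroidD K).indep_of_indep (X.subset_ground _ _) h

theorem indep_H {K I : Set E} (h : (X.matroidH K).Indep I) : (X.M .H).Indep I :=
  (X.isLayering_matroidH K).indep_of_indep (X.subset_ground _ _) h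

theorem subset_of_indep_D {K I : Set E} (h : (X.matroidD K).Indep I) : I ⊆ K :=
  h.subset_ground.trans (X.matroidD_ground K).subset

theorem subset_of_indep_H {K I : Set E} (h : (X.matroidH K).Indep I) : I ⊆ K :=
  h.subset_ground.trans (X.matroidH_ground K).subset

theorem mem_closure_of_isBase_matroidD {F I : Set E} {x : E}
    (hI : (X.matroidD (X.choiceD F)).IsBase I) (hx : x ∈ F) {m : ℕ} (hm : X.level .D x ≤ m) :
    x ∈ (X.M .D).closure {y ∈ I | X.level .D y ≤ m} := by
  refine Matroid.mem_closure_of_forall_mem_closure (X.mem_closure_choiceD hx) fun f hf => ?_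
  exact (X.isLayering_matroidD _).subset_closure_of_isBase (X.subset_ground _ _) hI m
    ⟨hf.1, hf.2.trans hm⟩

theorem mem_closure_of_isBase_matroidH {K I : Set E} {x : E}
    (hI : (X.matroidH K).IsBase I) (hx : x ∈ K) {m : ℕ} (hm : X.level .H x ≤ m) :
    x ∈ (X.M .H).closure {y ∈ I | X.level .H y ≤ m} := by
  -- Preference level m occupies the two layers 2m (for E_1) and 2m + 1 (for E_2); the bound 2m + 1
  -- takes in both.
  have h := (X.isLayering_matroidH K).subset_closure_of_isBase (X.subset_ground _ _) hI (2 * m + 1)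
  have hx' : x ∈ {x ∈ K | X.levelH x ≤ 2 * m + 1} := by
    refine ⟨hx, ?_⟩
    rw [levelH]; split_ifs <;> omega
  refine Matroid.mem_closure_of_subset (h hx') ?_
  rintro y ⟨hy, hym⟩
  refine ⟨hy, ?_⟩
  rw [levelH] at hym
  split_ifs at hym <;> omega

section Stable

variable {X} {P J K : Set E} {e f : E} (hP : X.IsRejected P) (hJ : X.IsStable J)
include hP hJ

omit [Finite E] in
theorem IsStable.subset_compl : J ⊆ Pᶜ :=
  Set.subset_compl_iff_disjoint_right.2 (hP.disjoint J hJ)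

/-- J avoids P, so the hypothesis on f makes f weakly block J on D. For f not to block, it must fail
to block weakly on H, or lie in E_2 and fail to block strongly on either side. Every later property
of stable sets is drawn from this dichotomy. -/
theorem IsStable.not_blocks_cases (hfJ : f ∉ J)
    (hf : f ∉ (X.M .D).closure {g ∈ Pᶜ | X.level .D g < X.level .D f}) :
    f ∈ (X.M .H).closure {g ∈ J | X.level .H g < X.level .H f} ∨
      f ∉ X.E1 ∧ f ∈ (X.M .H).closure {g ∈ J | X.level .H g ≤ X.level .H f} ∧
        f ∈ (X.M .D).closure {g ∈ J | X.level .D g ≤ X.level .D f} := by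
  have hweakD : X.WeaklyBlocks .D J f := (X.weaklyBlocks_iff (hJ.1 _) hfJ).2 fun h =>
    hf (Matroid.mem_closure_of_subset h fun g hg => ⟨hJ.subset_compl hP hg.1, hg.2⟩)
  have hnb := hJ.2 f hfJ
  by_contra! hcon
  have hweakH : X.WeaklyBlocks .H J f := (X.weaklyBlocks_iff (hJ.1 _) hfJ).2 hcon.1
  have hweak : ∀ S, X.WeaklyBlocks S J f := fun S => by cases S <;> assumption
  refine hnb ⟨fun _ => hweak, fun h2 => ⟨hweak, ?_⟩⟩
  by_cases h : f ∈ (X.M .H).closure {g ∈ J | X.level .H g ≤ X.level .H f}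
  · exact ⟨.D, (X.stronglyBlocks_iff (hJ.1 _) hfJ).2 (hcon.2 (X.mem_E2_iff.1 h2) h)⟩
  · exact ⟨.H, (X.stronglyBlocks_iff (hJ.1 _) hfJ).2 h⟩

theorem IsStable.mem_closure_le (hfJ : f ∉ J)
    (hf : f ∉ (X.M .D).closure {g ∈ Pᶜ | X.level .D g < X.level .D f}) :
    f ∈ (X.M .H).closure {g ∈ J | X.level .H g ≤ X.level .H f} := by
  rcases hJ.not_blocks_cases hP hfJ hf with h | h
  · exact Matroid.mem_closure_of_subset h fun g hg => ⟨hg.1, hg.2.le⟩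
  · exact h.2.1

theorem IsStable.choiceD_subset_closure : X.choiceD Pᶜ ⊆ (X.M .H).closure J := by
  intro f hf
  by_cases hfJ : f ∈ J
  · exact X.mem_closure hfJ
  · exact Matroid.mem_closure_of_subset (hJ.mem_closure_le hP hfJ (X.mem_choiceD.1 hf).2)
      (Set.sep_subset _ _)

omit [Finite E] in
theorem IsStable.encard_le : J.encard ≤ (X.M .D).eRk Pᶜ :=
  (hJ.1 .D).encard_le_eRk_of_subset (hJ.subset_compl hP)

/-- J spans K on H and is independent in E∖P on D, so its size lies between the two ranks. This
justifies the answer "No" in the inner loop. -/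
theorem IsStable.eRk_choiceD_le : (X.M .H).eRk (X.choiceD Pᶜ) ≤ (X.M .D).eRk Pᶜ :=
  (Matroid.eRk_le_encard_of_subset_closure (hJ.choiceD_subset_closure hP)).trans (hJ.encard_le hP)

/-- Suppose J contains an element e of K ∩ E_1 outside Q. Members of Q in layers up to that of e
span e on H. Each of them is in J, or is spanned by strictly better members of J, or is an E_2
element spanned by members of J at least as good. In the last case it is strictly better than e,
because E_1 precedes E_2 within a tie. So e is never needed, against the independence of J. -/
theorem IsStable.disjoint_of_isBase_matroidH {Q : Set E}
    (hQ : (X.matroidH (X.choiceD Pᶜ)).IsBase Q) :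
    Disjoint J ((X.choiceD Pᶜ \ Q) ∩ X.E1) := by
  rw [Set.disjoint_left]
  rintro e heJ ⟨⟨heK, heQ⟩, he1⟩
  refine (hJ.1 .H).notMem_closure_sdiff_of_mem heJ (Matroid.mem_closure_of_forall_mem_closure
    ((X.isLayering_matroidH _).subset_closure_of_isBase (X.subset_ground _ _) hQ (X.levelH e)
    ⟨heK, le_rfl⟩) ?_)
  rintro f ⟨hfQ, hfe⟩
  have hne : f ≠ e := by rintro rfl; exact heQ hfQ
  by_cases hfJ : f ∈ J
  · exact X.mem_closure ⟨hfJ, hne⟩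
  have hfK := X.mem_choiceD.1 (X.matroidH_ground _ ▸ hQ.subset_ground hfQ)
  rw [levelH, levelH, if_pos he1] at hfe
  rcases hJ.not_blocks_cases hP hfJ hfK.2 with h | ⟨hf1, h, -⟩
  · refine Matroid.mem_closure_of_subset h ?_
    rintro g ⟨hg, hgf⟩
    refine ⟨hg, ?_⟩
    rintro rfl
    omega
  · rw [if_neg hf1] at hfe
    refine Matroid.mem_closure_of_subset h ?_
    rintro g ⟨hg, hgf⟩
    refine ⟨hg, ?_⟩
    rintro rfl
    omega

/-- A member of J outside K is D-spanned by strictly better elements of E∖P, hence by members of K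
in layers before that of f. The layered matroid has contracted these, so only J ∩ K matters. -/
theorem IsStable.mem_closure_matroidD (hf : f ∈ X.choiceD Pᶜ)
    (hfD : f ∈ (X.M .D).closure {g ∈ J | X.level .D g ≤ X.level .D f}) :
    f ∈ (X.matroidD (X.choiceD Pᶜ)).closure (J ∩ X.choiceD Pᶜ) := by
  rw [(X.isLayering_matroidD _).mem_closure_iff _ Set.inter_subset_right _ hf]
  refine Matroid.mem_closure_of_forall_mem_closure hfD ?_
  rintro g ⟨hg, hgf⟩
  by_cases hgK : g ∈ X.choiceD Pᶜ
  · rcases hgf.lt_or_eq with h | h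
    · exact X.mem_closure (Or.inl ⟨hgK, h⟩)
    · exact X.mem_closure (Or.inr ⟨⟨hg, hgK⟩, h⟩)
  · have : g ∈ (X.M .D).closure {f ∈ Pᶜ | X.level .D f < X.level .D g} := by
      by_contra h
      exact hgK (X.mem_choiceD.2 ⟨hJ.subset_compl hP hg, h⟩)
    refine Matroid.mem_closure_of_forall_mem_closure this ?_
    rintro x ⟨hx, hxg⟩
    refine Matroid.mem_closure_of_subset (X.mem_closure_choiceD hx) ?_
    rintro y ⟨hy, hyx⟩
    exact Or.inl ⟨hy, by omega⟩

/-- The elements of K in earlier layers, the elements of A in the layer of e, and the rest of T are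
all H-spanned by J without e. If they spanned e, J would be dependent. So members of J keep their
full rank over A in the layered matroid. -/
theorem IsStable.notMem_closure_matroidH {A T : Set E} (hA : A ⊆ X.choiceD Pᶜ)
    (hAJ : ∀ f ∈ A, f ∈ (X.M .H).closure {g ∈ J | X.level .H g < X.level .H f})
    (hT : T ⊆ J ∩ X.choiceD Pᶜ) (he : e ∈ T) :
    e ∉ (X.matroidH (X.choiceD Pᶜ)).closure (A ∪ T \ {e}) := by
  have heT := hT he
  rw [(X.isLayering_matroidH _).mem_closure_iff _ (Set.union_subset hA
    (Set.sdiff_subset.trans (hT.trans Set.inter_subset_right))) _ heT.2]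
  intro hcl
  refine (hJ.1 .H).notMem_closure_sdiff_of_mem heT.1
    (Matroid.mem_closure_of_forall_mem_closure hcl ?_)
  have hlt : ∀ y, X.level .H y ≤ X.level .H e →
      y ∈ (X.M .H).closure {g ∈ J | X.level .H g < X.level .H y} →
      y ∈ (X.M .H).closure (J \ {e}) := fun y hye h =>
    Matroid.mem_closure_of_subset h fun g hg => ⟨hg.1, by rintro rfl; exact hye.not_gt hg.2⟩
  rintro y (⟨hyK, hye⟩ | ⟨hy, hye⟩)
  · by_cases hyJ : y ∈ J
    · exact X.mem_closure ⟨hyJ, by rintro rfl; exact hye.false⟩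
    rw [levelH, levelH] at hye
    rcases hJ.not_blocks_cases hP hyJ (X.mem_choiceD.1 hyK).2 with h | ⟨hy1, h, -⟩
    · refine hlt y ?_ h
      split_ifs at hye <;> omega
    · rw [if_neg hy1] at hye
      refine Matroid.mem_closure_of_subset h ?_
      rintro g ⟨hg, hgy⟩
      refine ⟨hg, ?_⟩
      rintro rfl
      split_ifs at hye <;> omega
  · rcases hy with hy | hy
    · refine hlt y ?_ (hAJ y hy)
      rw [levelH, levelH] at hye
      split_ifs at hye <;> omega
    · exact X.mem_closure ⟨(hT hy.1).1, hy.2⟩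

/-- Let A be the elements of Z outside J that are H-spanned by strictly better elements of J.
Passing from Z to A lowers the layered H-rank by at least the size of Z ∩ J. It raises the layered
D-rank of the complement by at most that number, since the remaining elements of Z are, by the other
case of the dichotomy, D-spanned by J ∩ K. Hence A is again a minimizer, and minimality forces Z =
A, which misses J. -/
theorem IsStable.disjoint_of_isCriticalSubset {Z : Set E}
    (hZ : IsCriticalSubset (X.matroidD (X.choiceD Pᶜ)) (X.matroidH (X.choiceD Pᶜ)) Z) :
    Disjoint J Z := by
  set K := X.choiceD Pᶜ with hK
  set N₁ := X.matroidD K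
  set N₂ := X.matroidH K
  have hE₁ : N₁.E = K := X.matroidD_ground K
  have hE₂ : N₂.E = K := X.matroidH_ground K
  have hZK : Z ⊆ K := hE₁ ▸ hZ.prop.1
  set A := {f ∈ Z | f ∉ J ∧ f ∈ (X.M .H).closure {g ∈ J | X.level .H g < X.level .H f}} with hA
  have hAZ : A ⊆ Z := Set.sep_subset _ _
  have h2 : N₂.eRk A + (Z ∩ J).encard ≤ N₂.eRk Z := by
    refine (Matroid.eRk_add_encard_le_of_forall_notMem_closure
      (hE₂ ▸ Set.inter_subset_left.trans hZK) fun e he => ?_).trans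
      (N₂.eRk_mono (Set.union_subset hAZ Set.inter_subset_left))
    exact hJ.notMem_closure_matroidH hP (hAZ.trans hZK) (fun f hf => hf.2.2)
      (fun f hf => ⟨hf.2, hZK hf.1⟩) he
  have h1 : N₁.eRk (N₁.E \ A) ≤ N₁.eRk (N₁.E \ Z) + (Z ∩ J).encard := by
    refine le_trans ?_ (N₁.eRk_union_le_eRk_add_encard _ _)
    rw [← Matroid.eRk_closure_eq _ (N₁.E \ Z ∪ Z ∩ J)]
    refine N₁.eRk_mono ?_
    rintro f ⟨hf, hfA⟩
    by_cases hfZ : f ∈ Z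
    swap
    · exact N₁.mem_closure_of_mem' (Or.inl ⟨hf, hfZ⟩) hf
    by_cases hfJ : f ∈ J
    · exact N₁.mem_closure_of_mem' (Or.inr ⟨hfZ, hfJ⟩) hf
    rcases hJ.not_blocks_cases hP hfJ (X.mem_choiceD.1 (hZK hfZ)).2 with h | ⟨-, -, h⟩
    · exact absurd ⟨hfZ, hfJ, h⟩ hfA
    · refine Matroid.mem_closure_of_subset (hJ.mem_closure_matroidD hP (hZK hfZ) h) ?_
      rintro g ⟨hgJ, hgK⟩
      by_cases hgZ : g ∈ Z
      · exact Or.inr ⟨hgZ, hgJ⟩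
      · exact Or.inl ⟨hE₁ ▸ hgK, hgZ⟩
  have hle : edmondsFun N₁ N₂ A ≤ edmondsFun N₁ N₂ Z := by
    calc N₁.eRk (N₁.E \ A) + N₂.eRk A
        ≤ N₁.eRk (N₁.E \ Z) + (Z ∩ J).encard + N₂.eRk A := add_le_add_left h1 _
      _ = N₁.eRk (N₁.E \ Z) + (N₂.eRk A + (Z ∩ J).encard) := by rw [add_assoc, add_comm (Z ∩ J).encard]
      _ ≤ N₁.eRk (N₁.E \ Z) + N₂.eRk Z := add_le_add_right h2 _
  have hZA : Z ⊆ A := hZ.2 ⟨hAZ.trans hZ.prop.1, fun Y hY => hle.trans (hZ.prop.2 Y hY)⟩ hAZ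
  exact Set.disjoint_left.2 fun e heJ heZ => (hZA heZ).2.1 heJ

end Stable

end StableInstance

/-! ### The situation after the inner loop, and tails of blocking circuits. -/

namespace StableInstance

variable {E : Type*} (X : StableInstance E) [Finite E]

/-- The state of affairs after the inner loop. -/
structure IsSettled (P I : Set E) : Prop where
  baseD : (X.matroidD (X.choiceD Pᶜ)).IsBase I
  baseH : (X.matroidH (X.choiceD Pᶜ)).IsBase I
  E1_subset : X.choiceD Pᶜ ∩ X.E1 ⊆ I

variable {X} {P J I : Set E} {b e : E}

namespace IsSettled

theorem subset (hI : X.IsSettled P I) : I ⊆ X.choiceD Pᶜ :=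
  X.subset_of_indep_D hI.baseD.indep

theorem subset_compl (hI : X.IsSettled P I) : I ⊆ Pᶜ := hI.subset.trans X.choiceD_subset

theorem isCommonIndep (hI : X.IsSettled P I) : X.IsCommonIndep I := by
  rintro (_ | _)
  · exact X.indep_D hI.baseD.indep
  · exact X.indep_H hI.baseH.indep

theorem encard_eq (hI : X.IsSettled P I) : I.encard = (X.M .D).eRk Pᶜ := by
  rw [hI.baseD.encard_eq_eRank, X.eRank_matroidD]

end IsSettled

/-- Assume J contains a worst element e of the circuit of b. Let A be the members of I outside J
that are H-spanned by strictly better members of J. The rest of I is spanned by J ∩ K in the layered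
matroid of D, so I has at most as many members as A and J ∩ K together. But A, J ∩ K and b together
are independent on H and lie in the closure of I, which is one element too many. -/
theorem IsStable.false_of_mem_tail (hP : X.IsRejected P) (hI : X.IsSettled P I)
    (hJ : X.IsStable J) (hb : b ∈ P ∩ X.blockSet I)
    (he : e ∈ X.tail .H ((X.M .H).fundCircuit b I)) (heJ : e ∈ J) : False := by
  obtain ⟨hbP, hbI, hbcl, hbb⟩ := hb
  have hIH := hI.isCommonIndep .H
  have hC := hIH.fundCircuit_isCircuit hbcl hbI
  have hCI : ∀ f ∈ (X.M .H).fundCircuit b I \ {b}, f ∈ I := fun f hf =>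
    (Set.mem_insert_iff.1 ((X.M .H).fundCircuit_subset_insert b I hf.1)).resolve_left hf.2
  obtain ⟨heC, hemax⟩ := (X.mem_tail_iff .H).1 he
  have hbC := (X.M .H).mem_fundCircuit b I
  have hbJ : b ∉ J := fun h => Set.disjoint_left.1 (hP.disjoint J hJ) h hbP
  have heb : e ≠ b := by rintro rfl; exact hbJ heJ
  have heI : e ∈ I := hCI e ⟨heC, heb⟩
  have hbIe : b ∉ (X.M .H).closure (I \ {e}) := by
    rw [← hIH.insert_sdiff_singleton_indep_iff (X.mem_ground _ _) hbI heI]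
    exact (hIH.mem_fundCircuit_iff hbcl hbI).1 heC
  have hbC' := hC.mem_closure_sdiff_singleton_of_mem hbC
  -- `b` is spanned by the elements of `J` that are strictly better than `e`
  have hbJlt : b ∈ (X.M .H).closure {g ∈ J | X.level .H g < X.level .H e} := by
    rcases hJ.not_blocks_cases hP hbJ (hP.notMem_closure b hbP) with h | ⟨hb1, h, hD⟩
    · exact Matroid.mem_closure_of_subset h fun g hg => ⟨hg.1, hg.2.trans_le (hemax b hbC)⟩
    obtain ⟨S, hS⟩ := (hbb.2 (X.mem_E2_iff.2 hb1)).2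
    rw [X.stronglyBlocks_iff (hI.isCommonIndep S) hbI] at hS
    cases S with
    | D =>
      refine absurd (Matroid.mem_closure_of_forall_mem_closure hD ?_) hS
      rintro g ⟨hg, hgb⟩
      exact X.mem_closure_of_isBase_matroidD hI.baseD (hJ.subset_compl hP hg) hgb
    | H =>
      -- If b ties with the worst element of its circuit, the members of I at least as good as b
      -- already span b, and b does not strongly block I on H.
      rcases (hemax b hbC).lt_or_eq with hlt | heq
      · exact Matroid.mem_closure_of_subset h fun g hg => ⟨hg.1, hg.2.trans_lt hlt⟩
      · refine absurd (Matroid.mem_closure_of_subset hbC' ?_) hS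
        exact fun g hg => ⟨hCI g hg, (hemax g hg.1).trans heq.ge⟩
  set K := X.choiceD Pᶜ with hK
  set A := {f ∈ I | f ∉ J ∧ f ∈ (X.M .H).closure {g ∈ J | X.level .H g < X.level .H f}} with hA
  have hAI : A ⊆ I := Set.sep_subset _ _
  -- Members of I outside A and J fall under the second case of the dichotomy, so J ∩ K spans them
  -- in the layered matroid of D, where I is independent.
  have hle : (I \ A).encard ≤ (J ∩ K).encard := by
    refine ((hI.baseD.indep.subset Set.sdiff_subset).encard_le_eRk_of_subset ?_).trans
      (Matroid.eRk_le_encard_of_subset_closure (M := X.matroidD K) subset_rfl)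
    rintro f ⟨hf, hfA⟩
    by_cases hfJ : f ∈ J
    · exact (X.matroidD K).mem_closure_of_mem' ⟨hfJ, hI.subset hf⟩
        (hI.baseD.subset_ground hf)
    rcases hJ.not_blocks_cases hP hfJ (X.mem_choiceD.1 (hI.subset hf)).2 with h | ⟨-, -, h⟩
    · exact absurd ⟨hf, hfJ, h⟩ hfA
    · exact hJ.mem_closure_matroidD hP (hI.subset hf) h
  have hbW : b ∉ A ∪ J ∩ K := by
    rintro (h | h)
    · exact hbI (hAI h)
    · exact hbJ h.1
  have hKH : ∀ x ∈ K, ∀ m, X.level .H x ≤ m →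
      x ∈ (X.M .H).closure {y ∈ I | X.level .H y ≤ m} := fun x hx m hm =>
    X.mem_closure_of_isBase_matroidH hI.baseH hx hm
  -- the order in which the independence of `A ∪ (J ∩ K) ∪ {b}` is checked
  classical
  let r : E → ℕ := fun y => if y = b then 3 * X.level .H e + 1 else
    if y ∈ A then 3 * X.level .H y else 3 * X.level .H y + 2
  have hrb : r b = 3 * X.level .H e + 1 := if_pos rfl
  have hrA : ∀ y ∈ A, r y = 3 * X.level .H y := fun y hy => by
    have : y ≠ b := by rintro rfl; exact hbI (hAI hy)
    simp [r, this, hy]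
  have hrJ : ∀ y ∈ J ∩ K, r y = 3 * X.level .H y + 2 := fun y hy => by
    have h1 : y ≠ b := by rintro rfl; exact hbJ hy.1
    have h2 : y ∉ A := fun h => h.2.1 hy.1
    simp [r, h1, h2]
  -- Let y be the last member of a circuit. For y = b, the other members are spanned by I without e,
  -- contrary to e lying on the circuit of b. For y in A they are spanned by I without y, and for y
  -- in J by J without y. The factor 3 leaves room within each level for A first, then b at the
  -- level of e, then J ∩ K.
  have hindep : (X.M .H).Indep (insert b (A ∪ J ∩ K)) := by
    by_contra hdep
    obtain ⟨C, hCW, hCC⟩ := ((Matroid.not_indep_iff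
      (X.subset_ground _ _)).1 hdep).exists_isCircuit_subset
    obtain ⟨y, hy, hmax⟩ := (Set.toFinite C).exists_maximalFor r C hCC.nonempty
    have hmax' : ∀ z ∈ C, r z ≤ r y := fun z hz => by
      by_contra h
      exact h (hmax hz (not_le.1 h).le)
    have hycl := hCC.mem_closure_sdiff_singleton_of_mem hy
    rcases hCW hy with rfl | hyA | hyJ
    · refine hbIe (Matroid.mem_closure_of_forall_mem_closure hycl ?_)
      rintro z ⟨hz, hzy⟩
      have hzr := hmax' z hz
      rw [hrb] at hzr
      rcases hCW hz with rfl | hzA | hzJ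
      · exact absurd rfl hzy
      · exact X.mem_closure ⟨hAI hzA, by rintro rfl; exact hzA.2.1 heJ⟩
      · rw [hrJ z hzJ] at hzr
        refine Matroid.mem_closure_of_subset (hKH z hzJ.2 _ le_rfl) ?_
        rintro g ⟨hg, hgz⟩
        refine ⟨hg, ?_⟩
        rintro rfl
        omega
    · refine hIH.notMem_closure_sdiff_of_mem (hAI hyA)
        (Matroid.mem_closure_of_forall_mem_closure hycl ?_)
      rintro z ⟨hz, hzy⟩
      have hzr := hmax' z hz
      rw [hrA y hyA] at hzr
      rcases hCW hz with rfl | hzA | hzJ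
      · rw [hrb] at hzr
        refine Matroid.mem_closure_of_subset hbC' fun g hg => ⟨hCI g hg, ?_⟩
        rintro rfl
        have := hemax g hg.1
        omega
      · exact X.mem_closure ⟨hAI hzA, hzy⟩
      · rw [hrJ z hzJ] at hzr
        refine Matroid.mem_closure_of_subset (hKH z hzJ.2 _ le_rfl) ?_
        rintro g ⟨hg, hgz⟩
        refine ⟨hg, ?_⟩
        rintro rfl
        omega
    · refine (hJ.1 .H).notMem_closure_sdiff_of_mem hyJ.1
        (Matroid.mem_closure_of_forall_mem_closure hycl ?_)
      rintro z ⟨hz, hzy⟩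
      have hzr := hmax' z hz
      rw [hrJ y hyJ] at hzr
      rcases hCW hz with rfl | hzA | hzJ
      · rw [hrb] at hzr
        refine Matroid.mem_closure_of_subset hbJlt ?_
        rintro g ⟨hg, hgz⟩
        refine ⟨hg, ?_⟩
        rintro rfl
        omega
      · rw [hrA z hzA] at hzr
        refine Matroid.mem_closure_of_subset hzA.2.2 ?_
        rintro g ⟨hg, hgz⟩
        refine ⟨hg, ?_⟩
        rintro rfl
        omega
      · exact X.mem_closure ⟨hzJ.1, hzy⟩
  have hcard : (insert b (A ∪ J ∩ K)).encard ≤ I.encard := by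
    rw [← hindep.eRk_eq_encard]
    refine Matroid.eRk_le_encard_of_subset_closure ?_
    rintro x (rfl | hx | hx)
    · exact hbcl
    · exact X.mem_closure (hAI hx)
    · exact Matroid.mem_closure_of_subset (hKH x hx.2 _ le_rfl) (Set.sep_subset _ _)
  have hdis : Disjoint A (J ∩ K) := Set.disjoint_left.2 fun x h h' => h.2.1 h'.1
  rw [Set.encard_insert_of_notMem hbW, Set.encard_union_eq hdis,
    ← Set.encard_sdiff_add_encard_of_subset hAI] at hcard
  simp only [← (Set.toFinite _).cast_ncard_eq] at hcard hle
  norm_cast at hcard hle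
  omega

/-! ### Preservation of the invariant, progress and the number of steps. -/

omit [Finite E] in
theorem IsRejected.empty (X : StableInstance E) : X.IsRejected ∅ :=
  ⟨fun _ _ => Set.disjoint_empty _, fun _ h => h.elim⟩

/-- Enlarging P leaves fewer elements outside it to span with, and new members coming from K are
unspanned by the definition of K. -/
theorem IsRejected.union {Z : Set E} (hP : X.IsRejected P) (hZ : Z ⊆ P ∪ X.choiceD Pᶜ)
    (h : ∀ J, X.IsStable J → Disjoint J Z) : X.IsRejected (P ∪ Z) := by
  refine ⟨fun J hJ => Set.disjoint_union_right.2 ⟨hP.disjoint J hJ, h J hJ⟩, fun e he hcl => ?_⟩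
  have hcl' : e ∈ (X.M .D).closure {f ∈ Pᶜ | X.level .D f < X.level .D e} :=
    Matroid.mem_closure_of_subset hcl fun f hf => ⟨fun h => hf.1 (Or.inl h), hf.2⟩
  have he' : e ∈ P ∪ X.choiceD Pᶜ := he.elim Or.inl fun h => hZ h
  rcases he' with he | he
  · exact hP.notMem_closure e he hcl'
  · exact (X.mem_choiceD.1 he).2 hcl'

/-- The invariant of the main algorithm. -/
def Invariant (X : StableInstance E) : Config E → Prop
  | .inner P => X.IsRejected P
  | .outer P I => X.IsRejected P ∧ X.IsSettled P I
  | .final R I => X.IsRejected R ∧ X.IsSettled R I ∧ R ∩ X.blockSet I = ∅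
  | .no => ¬ ∃ J, X.IsStable J
  | .found I => X.IsStable I

/-- The rank tests make I large enough to be a base on both sides. An element of K ∩ E_1 missing
from I would be spanned by earlier layers and the members of I in its own layer. That layer lies in
E_1 and hence in Q, so Q would be dependent. -/
theorem isSettled_of_not_lt {K Q : Set E} (hK : K = X.choiceD Pᶜ)
    (hQ : (X.matroidH K).IsBase Q) (hrk : ¬ (X.M .D).eRk Pᶜ < (X.M .H).eRk K)
    (hE1 : Q ∩ X.E1 = K ∩ X.E1) (hI : IsMaxCommonIndep (X.matroidD K) (X.matroidH K) I)
    (hlt : ¬ I.encard < (X.M .D).eRk Pᶜ) : X.IsSettled P I := by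
  subst hK
  have hIK : I ⊆ X.choiceD Pᶜ := X.subset_of_indep_D hI.1
  have hbase : (X.matroidD (X.choiceD Pᶜ)).IsBase I := by
    refine hI.1.isBase_of_eRk_ge (Set.toFinite _) ?_
    rw [X.eRank_matroidD, hI.1.eRk_eq_encard]
    exact not_lt.1 hlt
  refine ⟨hbase, ?_, ?_⟩
  · refine hI.2.1.isBase_of_eRk_ge (Set.toFinite _) ?_
    rw [(X.isLayering_matroidH _).eRank_eq (X.subset_ground _ _), hI.2.1.eRk_eq_encard]
    exact (not_lt.1 hrk).trans (not_lt.1 hlt)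
  · intro x hx
    by_contra hxI
    have hbaseH : (X.matroidH (X.choiceD Pᶜ)).IsBase I := by
      refine hI.2.1.isBase_of_eRk_ge (Set.toFinite _) ?_
      rw [(X.isLayering_matroidH _).eRank_eq (X.subset_ground _ _), hI.2.1.eRk_eq_encard]
      exact (not_lt.1 hrk).trans (not_lt.1 hlt)
    have hxcl : x ∈ (X.matroidH (X.choiceD Pᶜ)).closure I := by
      rw [hbaseH.closure_eq, matroidH_ground]; exact hx.1
    have hxQ : x ∈ Q := (hE1.ge hx).1
    have hQK : Q ⊆ X.choiceD Pᶜ := X.subset_of_indep_H hQ.indep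
    refine hQ.indep.notMem_closure_sdiff_of_mem hxQ ?_
    rw [(X.isLayering_matroidH _).mem_closure_iff _ hIK _ hx.1] at hxcl
    rw [(X.isLayering_matroidH _).mem_closure_iff _ (Set.sdiff_subset.trans hQK) _ hx.1]
    refine Matroid.mem_closure_of_subset hxcl (Set.union_subset_union_right _ ?_)
    rintro y ⟨hy, hyx⟩
    have hy1 : y ∈ X.E1 := by
      by_contra h
      rw [levelH, levelH, if_neg h, if_pos hx.2] at hyx
      omega
    exact ⟨⟨(hE1.ge ⟨hIK hy, hy1⟩).1, by rintro rfl; exact hxI hy⟩, hyx⟩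

/-- A blocking element of P is either in the H-closure of I or extends I there, and both are
excluded. A blocking element outside P must lie in K, since otherwise strictly better members of I
span it on D. It is not in E_1 because K ∩ E_1 is inside I. In E_2 it would need to block strongly,
but I spans it by elements at least as good on both sides. -/
theorem IsSettled.isStable (hI : X.IsSettled P I) (hblock : P ∩ X.blockSet I = ∅)
    (hspan : ∀ e ∈ P, ¬ (X.M .H).Indep (insert e I)) : X.IsStable I := by
  have hII := hI.isCommonIndep
  refine ⟨hII, fun e he hbl => ?_⟩
  have hweakD : X.WeaklyBlocks .D I e := by
    by_cases h : e ∈ X.E1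
    · exact hbl.1 h .D
    · exact (hbl.2 (X.mem_E2_iff.2 h)).1 .D
  by_cases heP : e ∈ P
  · refine Set.notMem_empty e (hblock ▸ ⟨heP, he, ?_, hbl⟩)
    by_contra hcl
    exact hspan e heP (((hII .H).notMem_closure_iff_of_notMem he (X.mem_ground _ _)).1 hcl)
  rw [X.weaklyBlocks_iff (hII .D) he] at hweakD
  have heK : e ∈ X.choiceD Pᶜ := by
    refine X.mem_choiceD.2 ⟨heP, fun h => hweakD ?_⟩
    refine Matroid.mem_closure_of_forall_mem_closure h ?_
    rintro f ⟨hf, hfe⟩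
    refine Matroid.mem_closure_of_subset
      (X.mem_closure_of_isBase_matroidD hI.baseD hf le_rfl) ?_
    exact fun g hg => ⟨hg.1, hg.2.trans_lt hfe⟩
  have he1 : e ∉ X.E1 := fun h => he (hI.E1_subset ⟨heK, h⟩)
  obtain ⟨S, hS⟩ := (hbl.2 (X.mem_E2_iff.2 he1)).2
  rw [X.stronglyBlocks_iff (hII S) he] at hS
  cases S with
  | D => exact hS (X.mem_closure_of_isBase_matroidD hI.baseD heP le_rfl)
  | H => exact hS (X.mem_closure_of_isBase_matroidH hI.baseH heK le_rfl)

/-- A stable J spans K, hence I, on H and is no larger than I, so both have the same H-closure.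
Every element of P lies in the closure of J, thus none can extend I. -/
theorem IsSettled.not_exists_isStable (hP : X.IsRejected P) (hI : X.IsSettled P I) (he : e ∈ P)
    (heI : (X.M .H).Indep (insert e I)) : ¬ ∃ J, X.IsStable J := by
  rintro ⟨J, hJ⟩
  have hIH := hI.isCommonIndep .H
  have hIJ : (X.M .H).IsBasis I ((X.M .H).closure J) := by
    refine hIH.isBasis_of_eRk_ge (Set.toFinite _)
      (hI.subset.trans (hJ.choiceD_subset_closure hP)) ?_
    rw [Matroid.eRk_closure_eq, hIH.eRk_eq_encard, (hJ.1 .H).eRk_eq_encard, hI.encard_eq]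
    exact hJ.encard_le hP
  have heJ : e ∉ J := fun h => Set.disjoint_left.1 (hP.disjoint J hJ) h he
  have h1 : e ∈ (X.M .H).closure J := Matroid.mem_closure_of_subset
    (hJ.mem_closure_le hP heJ (hP.notMem_closure e he)) (Set.sep_subset _ _)
  exact (hIH.notMem_closure_iff_of_notMem (fun h => hI.subset_compl h he) (X.mem_ground _ _)).2 heI
    (hIJ.subset_closure h1)

/-- I avoids P, so a tail inside P could only be b alone. Then all other circuit elements are
strictly better and span b, which would not weakly block. Hence treating a blocking element always
enlarges P. -/
theorem IsSettled.tail_not_subset (hI : X.IsSettled P I) (hb : b ∈ P ∩ X.blockSet I) :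
    ¬ X.tail .H ((X.M .H).fundCircuit b I) ⊆ P := by
  intro hsub
  obtain ⟨hbP, hbI, hbcl, hbb⟩ := hb
  have hIH := hI.isCommonIndep .H
  have hC := hIH.fundCircuit_isCircuit hbcl hbI
  have hCI : ∀ f ∈ (X.M .H).fundCircuit b I, f ≠ b → f ∈ I := fun f hf hfb =>
    (Set.mem_insert_iff.1 ((X.M .H).fundCircuit_subset_insert b I hf)).resolve_left hfb
  have htail : ∀ e ∈ X.tail .H ((X.M .H).fundCircuit b I), e = b := fun e he => by
    by_contra h
    exact hI.subset_compl (hCI e ((X.mem_tail_iff .H).1 he).1 h) (hsub he)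
  obtain ⟨e, he, hmax⟩ := (Set.toFinite ((X.M .H).fundCircuit b I)).exists_maximalFor
    (X.level .H) _ hC.nonempty
  have hmax' : ∀ f ∈ (X.M .H).fundCircuit b I, X.level .H f ≤ X.level .H e := fun f hf => by
    by_contra h
    exact h (hmax hf (not_le.1 h).le)
  obtain rfl := htail e ((X.mem_tail_iff .H).2 ⟨he, hmax'⟩)
  have hweak : X.WeaklyBlocks .H I e := by
    by_cases h : e ∈ X.E1
    · exact hbb.1 h .H
    · exact (hbb.2 (X.mem_E2_iff.2 h)).1 .H
  rw [X.weaklyBlocks_iff hIH hbI] at hweak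
  refine hweak (Matroid.mem_closure_of_subset (hC.mem_closure_sdiff_singleton_of_mem he) ?_)
  rintro f ⟨hf, hfe⟩
  refine ⟨hCI f hf hfe, lt_of_le_of_ne (hmax' f hf) fun heq => hfe ?_⟩
  exact htail f ((X.mem_tail_iff .H).2 ⟨hf, fun g hg => heq ▸ hmax' g hg⟩)

theorem Invariant.step {c c' : Config E} (hc : X.Invariant c) (h : X.Step c c') :
    X.Invariant c' := by
  cases h with
  | rank hK hQ hrk =>
    subst hK
    rintro ⟨J, hJ⟩
    exact (hJ.eRk_choiceD_le hc).not_gt hrk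
  | E1 hK hQ hrk hE1 hP =>
    subst hK
    exact hc.union (fun x hx => Or.inr hx.1.1) fun J hJ => hJ.disjoint_of_isBase_matroidH hc hQ
  | critical hK hQ hrk hE1 hI hlt hZ hP =>
    subst hK
    exact hc.union (fun x hx => Or.inr ((X.matroidD_ground _).subset (hZ.prop.1 hx)))
      fun J hJ => hJ.disjoint_of_isCriticalSubset hc hZ
  | @critical_exit P K Q I Z hK hQ hrk hE1 hI hlt hZ hP =>
    subst hK
    exfalso
    -- Z lies in K, which avoids P, so not enlarging P means that Z is empty. The empty set is then
    -- a minimizer of value rk_D(E∖P), and duality makes this the size of I, contrary to the test.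
    have hZ0 : Z = ∅ := by
      refine Set.eq_empty_of_forall_notMem fun x hx => ?_
      exact X.choiceD_subset ((X.matroidD_ground _).subset (hZ.prop.1 hx)) (hP.subset (Or.inr hx))
    subst hZ0
    have hE : (X.matroidH (X.choiceD Pᶜ)).E = (X.matroidD (X.choiceD Pᶜ)).E := by
      rw [matroidH_ground, matroidD_ground]
    obtain ⟨h1, h2⟩ := Matroid.isCriticalSubset_cut_of_isMaxCommonIndep hE hI
    have h3 := hZ.prop.2 _ h2.prop.1
    rw [h1, edmondsFun, Set.sdiff_empty, Matroid.eRk_empty, add_zero, Matroid.eRk_ground,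
      X.eRank_matroidD] at h3
    exact h3.not_gt hlt
  | exit hK hQ hrk hE1 hI hlt => exact ⟨hc, isSettled_of_not_lt hK hQ hrk hE1 hI hlt⟩
  | repeat_outer hb hR hne =>
    subst hR
    obtain ⟨hP, hI⟩ := hc
    refine hP.union (fun x hx => ?_) fun J hJ => Set.disjoint_left.2 fun e heJ he =>
      hJ.false_of_mem_tail hP hI hb he heJ
    rcases (X.M .H).fundCircuit_subset_insert _ _ ((X.mem_tail_iff .H).1 hx).1 with rfl | h
    · exact Or.inl hb.1
    · exact Or.inr (hI.subset h)
  | exit_outer hb hR heq =>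
    subst hR
    exact absurd (Set.union_eq_left.1 heq) (hc.2.tail_not_subset hb)
  | exit_outer_of_empty hb => exact ⟨hc.1, hc.2, hb⟩
  | output_no he hI => exact hc.2.1.not_exists_isStable hc.1 he hI
  | output_found hI => exact hc.2.1.isStable hc.2.2 hI

theorem ReachesIn.invariant {k : ℕ} {c : Config E} (h : X.ReachesIn k c) : X.Invariant c := by
  induction h with
  | start => exact IsRejected.empty X
  | step _ hs ih => exact ih.step hs

theorem exists_step {c : Config E} (hc : ¬ c.Halted) : ∃ c', X.Step c c' := by
  match c with
  | .inner P =>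
    obtain ⟨Q, hQ⟩ := (X.matroidH (X.choiceD Pᶜ)).exists_isBase
    by_cases hrk : (X.M .D).eRk Pᶜ < (X.M .H).eRk (X.choiceD Pᶜ)
    · exact ⟨_, .rank rfl hQ hrk⟩
    by_cases hE1 : Q ∩ X.E1 = X.choiceD Pᶜ ∩ X.E1
    · have hE : (X.matroidH (X.choiceD Pᶜ)).E = (X.matroidD (X.choiceD Pᶜ)).E := by
        rw [matroidH_ground, matroidD_ground]
      obtain ⟨I, hI⟩ := Matroid.exists_isMaxCommonIndep (X.matroidD (X.choiceD Pᶜ))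
        (X.matroidH (X.choiceD Pᶜ))
      by_cases hlt : I.encard < (X.M .D).eRk Pᶜ
      · have hZ := (Matroid.isCriticalSubset_cut_of_isMaxCommonIndep hE hI).2
        exact (em _).elim (fun hP => ⟨_, .critical_exit rfl hQ hrk hE1 hI hlt hZ hP⟩)
          fun hP => ⟨_, .critical rfl hQ hrk hE1 hI hlt hZ hP⟩
      · exact ⟨_, .exit rfl hQ hrk hE1 hI hlt⟩
    · refine ⟨_, .E1 rfl hQ hrk hE1 fun h => hE1 ?_⟩
      have hQK : Q ⊆ X.choiceD Pᶜ := X.subset_of_indep_H hQ.indep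
      refine (Set.inter_subset_inter_left _ hQK).antisymm fun x hx => ⟨?_, hx.2⟩
      by_contra hxQ
      exact X.choiceD_subset hx.1 (h.subset (Or.inr ⟨⟨hx.1, hxQ⟩, hx.2⟩))
  | .outer P I =>
    by_cases hb : P ∩ X.blockSet I = ∅
    · exact ⟨_, .exit_outer_of_empty hb⟩
    · obtain ⟨b, hb⟩ := Set.nonempty_iff_ne_empty.2 hb
      by_cases hR : P ∪ X.tail .H ((X.M .H).fundCircuit b I) = P
      · exact ⟨_, .exit_outer hb rfl hR⟩
      · exact ⟨_, .repeat_outer hb rfl hR⟩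
  | .final R I =>
    by_cases h : ∀ e ∈ R, ¬ (X.M .H).Indep (insert e I)
    · exact ⟨_, .output_found h⟩
    · push Not at h
      obtain ⟨e, he, hI⟩ := h
      exact ⟨_, .output_no he hI⟩
  | .no => exact absurd (Or.inl rfl) hc
  | .found I => exact absurd (Or.inr ⟨I, rfl⟩) hc

/-- A bound on the number of steps that lead to a configuration. -/
noncomputable def stepBound : Config E → ℕ
  | .inner P => 2 * P.ncard
  | .outer P _ => 2 * P.ncard + 1
  | .final R _ => 2 * R.ncard + 2
  | .no => 2 * Nat.card E + 3
  | .found _ => 2 * Nat.card E + 3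

theorem stepBound_le (c : Config E) : stepBound c ≤ 2 * Nat.card E + 3 := by
  cases c with
  | inner P => have := Set.ncard_le_card P; simp only [stepBound]; omega
  | outer P I => have := Set.ncard_le_card P; simp only [stepBound]; omega
  | final P I => have := Set.ncard_le_card P; simp only [stepBound]; omega
  | no => exact le_rfl
  | found I => exact le_rfl

/-- Returning to the inner loop loses at most one phase, while a new element of P is worth two. -/
theorem Step.stepBound_lt {c c' : Config E} (h : X.Step c c') : stepBound c < stepBound c' := by
  have hgrow : ∀ P Z : Set E, P ∪ Z ≠ P → P.ncard < (P ∪ Z).ncard := fun P Z h =>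
    Set.ncard_lt_ncard (Set.subset_union_left.ssubset_of_ne h.symm) (Set.toFinite _)
  cases h with
  | @rank P => have := Set.ncard_le_card P; simp only [stepBound]; omega
  | E1 _ _ _ _ hP => have := hgrow _ _ hP; simp only [stepBound]; omega
  | critical _ _ _ _ _ _ _ hP => have := hgrow _ _ hP; simp only [stepBound]; omega
  | critical_exit => simp only [stepBound]; omega
  | exit => simp only [stepBound]; omega
  | repeat_outer _ hR hne => subst hR; have := hgrow _ _ hne; simp only [stepBound]; omega
  | exit_outer _ _ heq => subst heq; simp only [stepBound]; omega
  | exit_outer_of_empty => simp only [stepBound]; omega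
  | @output_no P => have := Set.ncard_le_card P; simp only [stepBound]; omega
  | @output_found P => have := Set.ncard_le_card P; simp only [stepBound]; omega

theorem ReachesIn.le {k : ℕ} {c : Config E} (h : X.ReachesIn k c) : k ≤ 2 * Nat.card E + 3 := by
  have : k ≤ stepBound c := by
    induction h with
    | start => exact Nat.zero_le _
    | step _ hs ih => exact Nat.succ_le_of_lt (ih.trans_lt hs.stepBound_lt)
  exact this.trans (stepBound_le c)

theorem ReachesIn.correct {k : ℕ} {c : Config E} (h : X.ReachesIn k c) (hc : c.Halted) :
    ((∃ J, X.IsStable J) → ∃ I, c = .found I ∧ X.IsStable I) ∧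
      ((¬ ∃ J, X.IsStable J) → c = .no) := by
  have hinv := h.invariant
  rcases hc with rfl | ⟨I, rfl⟩
  · exact ⟨fun h => absurd h hinv, fun _ => rfl⟩
  · exact ⟨fun _ => ⟨I, rfl, hinv⟩, fun h => absurd ⟨I, hinv⟩ h⟩

end StableInstance

/-! ### Bounded execution -/

/-- From the state `s`, the program `p` halts within `T` units of time in a state that
satisfies `Q`. -/
def Runs {n : ℕ} (X : StableInstance (Fin n)) (p : Prog) (s : Store) (T : ℕ) (Q : Store → Prop) :
    Prop :=
  ∃ s' t, Exec X p s s' t ∧ t ≤ T ∧ Q s'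

section Runs

variable {n : ℕ} {X : StableInstance (Fin n)} {p q : Prog} {s : Store} {T T' : ℕ}
  {Q R : Store → Prop}

theorem Runs.mono (h : Runs X p s T Q) (hT : T ≤ T') (hQ : ∀ s', Q s' → R s') :
    Runs X p s T' R := by
  obtain ⟨s', t, he, ht, hq⟩ := h
  exact ⟨s', t, he, ht.trans hT, hQ _ hq⟩

theorem Runs.assign {x : ℕ} {e : Expr} (h : Q (s.setReg x (e.eval n s))) :
    Runs X (.assign x e) s 1 Q :=
  ⟨_, _, .assign x e s, le_rfl, h⟩

theorem Runs.write {a : ℕ} {i e : Expr} (h : Q (s.setArr a (i.eval n s) (e.eval n s))) :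
    Runs X (.write a i e) s 1 Q :=
  ⟨_, _, .write a i e s, le_rfl, h⟩

theorem Runs.indep {S : Side} {x a : ℕ}
    (h : Q (s.setReg x (answer ((X.M S).Indep (s.decode n a))))) :
    Runs X (.indep S x a) s 1 Q :=
  ⟨_, _, .indep S x a s, le_rfl, h⟩

theorem Runs.seq (hp : Runs X p s T R) (hq : ∀ s', R s' → Runs X q s' T' Q) :
    Runs X (.seq p q) s (T + T') Q := by
  obtain ⟨s', t, he, ht, hr⟩ := hp
  obtain ⟨s'', t', he', ht', hq⟩ := hq s' hr
  exact ⟨s'', t + t', .seq he he', add_le_add ht ht', hq⟩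

theorem Runs.ite {e : Expr} (hp : e.eval n s ≠ 0 → Runs X p s T Q)
    (hq : e.eval n s = 0 → Runs X q s T' Q) : Runs X (.ite e p q) s (T + T' + 1) Q := by
  by_cases h : e.eval n s = 0
  · obtain ⟨s', t, he, ht, hr⟩ := hq h
    exact ⟨s', t + 1, .ite_false h he, by omega, hr⟩
  · obtain ⟨s', t, he, ht, hr⟩ := hp h
    exact ⟨s', t + 1, .ite_true h he, by omega, hr⟩

end Runs

/-- A program without effect. -/
def Prog.skip : Prog := .assign 1 (.reg 1)

/-- Run `p` for all values `0, …, n - 1` of the variable `v`, which is held in register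
`4 * v + 4`. -/
def Prog.forAll (v : ℕ) (p : Prog) : Prog :=
  .seq (.assign (4 * v + 4) (.num 0))
    (.loop (.lt (.reg (4 * v + 4)) .size)
      (.seq p (.assign (4 * v + 4) (.add (.reg (4 * v + 4)) (.num 1)))))

theorem Runs.skip {n : ℕ} {X : StableInstance (Fin n)} {s : Store} {Q : Store → Prop} (h : Q s) :
    Runs X .skip s 1 Q := by
  refine Runs.assign ?_
  have : s.setReg 1 ((Expr.reg 1).eval n s) = s := by
    simp [Store.setReg, Expr.eval]
  rwa [this]

/-- A round costs the body, the increment and the test. The two extra units are the initialization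
and the final failing test. The body must leave the counter intact. -/
theorem Runs.forAll {n : ℕ} {X : StableInstance (Fin n)} {v : ℕ} {p : Prog} {s : Store} {T : ℕ}
    (Inv : ℕ → Store → Prop) (h0 : Inv 0 (s.setReg (4 * v + 4) 0))
    (hp : ∀ i < n, ∀ s, s.reg (4 * v + 4) = i → Inv i s →
      Runs X p s T fun s' => s'.reg (4 * v + 4) = i ∧ Inv (i + 1) (s'.setReg (4 * v + 4) (i + 1))) :
    Runs X (.forAll v p) s (n * (T + 2) + 2) (Inv n) := by
  have key : ∀ m i, i + m = n → ∀ s, s.reg (4 * v + 4) = i → Inv i s →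
      Runs X (.loop (.lt (.reg (4 * v + 4)) .size)
        (.seq p (.assign (4 * v + 4) (.add (.reg (4 * v + 4)) (.num 1))))) s
        (m * (T + 2) + 1) (Inv n) := by
    intro m
    induction m with
    | zero =>
      intro i hi s hs hinv
      refine ⟨s, 1, .loop_false ?_, by simp, by rwa [← hi]⟩
      simp only [Expr.eval, hs]
      rw [if_neg (by omega)]
    | succ m ih =>
      intro i hi s hs hinv
      obtain ⟨s', t, he, ht, hs', hinv'⟩ := hp i (by omega) s hs hinv
      have hev : (Expr.add (.reg (4 * v + 4)) (.num 1)).eval n s' = i + 1 := by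
        simp [Expr.eval, hs']
      obtain ⟨s'', t', he', ht', hinv''⟩ := ih (i + 1) (by omega)
        (s'.setReg (4 * v + 4) (i + 1)) (by simp [Store.setReg]) hinv'
      have hstep : Exec X (.assign (4 * v + 4) (.add (.reg (4 * v + 4)) (.num 1))) s'
          (s'.setReg (4 * v + 4) (i + 1)) 1 := hev ▸ Exec.assign _ _ _
      refine ⟨s'', _, .loop_true ?_ (.seq he hstep) he', ?_, hinv''⟩
      · simp only [Expr.eval, hs]
        rw [if_pos (by omega)]
        exact one_ne_zero
      · rw [Nat.succ_mul]
        omega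
  obtain ⟨s', t, he, ht, hinv⟩ := key n 0 (by simp) (s.setReg (4 * v + 4) 0)
    (by simp [Store.setReg]) h0
  exact ⟨s', _, .seq (.assign _ _ _) he, by omega, hinv⟩

/-! ### A query language and its compiler -/

/-- Formulas about elements of the ground set (the values of variables) and about sets of elements.
`ex v φ` quantifies over the variable `v`; `cl S v φ x` says that `x` lies in the closure of
`{v | φ}` in `M S`; `cardLt v φ ψ` says that `{v | φ}` has fewer elements than `{v | ψ}`. -/
inductive Form
  | mem (a x : ℕ)
  | lt (x y : ℕ)
  | weak (S : Side) (x y : ℕ)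
  | memE1 (x : ℕ)
  | neg (φ : Form)
  | and (φ ψ : Form)
  | ex (v : ℕ) (φ : Form)
  | cl (S : Side) (v : ℕ) (φ : Form) (x : ℕ)
  | cardLt (v : ℕ) (φ ψ : Form)

namespace Form

/-- The truth of a formula, for the sets `A` and the values `ρ` of the variables. -/
def eval {n : ℕ} (X : StableInstance (Fin n)) (A : ℕ → Set (Fin n)) (ρ : ℕ → ℕ) : Form → Prop
  | mem a x => ∃ i : Fin n, (i : ℕ) = ρ x ∧ i ∈ A a
  | lt x y => ρ x < ρ y
  | weak S x y => ∃ i j : Fin n, (i : ℕ) = ρ x ∧ (j : ℕ) = ρ y ∧ X.weak S i j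
  | memE1 x => ∃ i : Fin n, (i : ℕ) = ρ x ∧ i ∈ X.E1
  | neg φ => ¬ φ.eval X A ρ
  | and φ ψ => φ.eval X A ρ ∧ ψ.eval X A ρ
  | ex v φ => ∃ i : Fin n, φ.eval X A (Function.update ρ v i)
  | cl S v φ x => ∃ i : Fin n, (i : ℕ) = ρ x ∧
      i ∈ (X.M S).closure {j : Fin n | φ.eval X A (Function.update ρ v j)}
  | cardLt v φ ψ => {j : Fin n | φ.eval X A (Function.update ρ v j)}.ncard <
      {j : Fin n | ψ.eval X A (Function.update ρ v j)}.ncard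

/-- All free variables lie in `[l, b)`, a variable bound at depth `k` is called `b + k`, and all set
variables lie below `32`. -/
def wf (l : ℕ) : ℕ → Form → Bool
  | b, mem a x => decide (a < 32 ∧ l ≤ x ∧ x < b)
  | b, lt x y => decide (l ≤ x ∧ x < b ∧ l ≤ y ∧ y < b)
  | b, weak _ x y => decide (l ≤ x ∧ x < b ∧ l ≤ y ∧ y < b)
  | b, memE1 x => decide (l ≤ x ∧ x < b)
  | b, neg φ => wf l b φ
  | b, and φ ψ => wf l b φ && wf l b ψ
  | b, ex v φ => decide (b = v) && wf l (v + 1) φ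
  | b, cl _ v φ x => decide (b = v ∧ l ≤ x ∧ x < b) && wf l (v + 1) φ
  | b, cardLt v φ ψ => decide (b = v) && (wf l (v + 1) φ && wf l (v + 1) ψ)

theorem eval_congr {n : ℕ} (X : StableInstance (Fin n)) {A A' : ℕ → Set (Fin n)}
    (hA : ∀ a < 32, A a = A' a) {l : ℕ} (φ : Form) : ∀ {b : ℕ} {ρ ρ' : ℕ → ℕ}, φ.wf l b →
      (∀ x, l ≤ x → x < b → ρ x = ρ' x) → (φ.eval X A ρ ↔ φ.eval X A' ρ') := by
  have hupd : ∀ {b : ℕ} {ρ ρ' : ℕ → ℕ} (i : ℕ), (∀ x, l ≤ x → x < b → ρ x = ρ' x) →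
      ∀ x, l ≤ x → x < b + 1 → Function.update ρ b i x = Function.update ρ' b i x := by
    intro b ρ ρ' i h x hl hb
    by_cases hx : x = b
    · simp [hx]
    · simp only [Function.update_of_ne hx]
      exact h x hl (by omega)
  induction φ with
  | mem a x =>
    intro b ρ ρ' hwf h
    simp only [wf, decide_eq_true_eq] at hwf
    simp only [eval, hA a hwf.1, h x hwf.2.1 hwf.2.2]
  | lt x y =>
    intro b ρ ρ' hwf h
    simp only [wf, decide_eq_true_eq] at hwf
    simp only [eval, h x hwf.1 hwf.2.1, h y hwf.2.2.1 hwf.2.2.2]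
  | weak S x y =>
    intro b ρ ρ' hwf h
    simp only [wf, decide_eq_true_eq] at hwf
    simp only [eval, h x hwf.1 hwf.2.1, h y hwf.2.2.1 hwf.2.2.2]
  | memE1 x =>
    intro b ρ ρ' hwf h
    simp only [wf, decide_eq_true_eq] at hwf
    simp only [eval, h x hwf.1 hwf.2]
  | neg φ ih =>
    intro b ρ ρ' hwf h
    simp only [eval, ih hwf h]
  | and φ ψ ih₁ ih₂ =>
    intro b ρ ρ' hwf h
    simp only [wf, Bool.and_eq_true] at hwf
    simp only [eval, ih₁ hwf.1 h, ih₂ hwf.2 h]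
  | ex v φ ih =>
    intro b ρ ρ' hwf h
    simp only [wf, Bool.and_eq_true, decide_eq_true_eq] at hwf
    obtain ⟨rfl, hwf⟩ := hwf
    simp only [eval, ih hwf (hupd _ h)]
  | cl S v φ x ih =>
    intro b ρ ρ' hwf h
    simp only [wf, Bool.and_eq_true, decide_eq_true_eq] at hwf
    obtain ⟨⟨rfl, hx⟩, hwf⟩ := hwf
    simp only [eval, ih hwf (hupd _ h), h x hx.1 hx.2]
  | cardLt v φ ψ ih₁ ih₂ =>
    intro b ρ ρ' hwf h
    simp only [wf, Bool.and_eq_true, decide_eq_true_eq] at hwf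
    obtain ⟨rfl, hwf₁, hwf₂⟩ := hwf
    simp only [eval, ih₁ hwf₁ (hupd _ h), ih₂ hwf₂ (hupd _ h)]

open Prog in
/-- The program that leaves the truth value of a formula in register `1`. -/
def compile : Form → Prog
  -- The sum of two bits exceeds 1 only if both are set. The second bit is needed because array
  -- entries beyond the ground set may be nonzero.
  | mem a x => .assign 1 (.lt (.num 1) (.add (.lt (.num 0) (.arr a (.reg (4 * x + 4))))
      (.lt (.reg (4 * x + 4)) .size)))
  | lt x y => .assign 1 (.lt (.reg (4 * x + 4)) (.reg (4 * y + 4)))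
  | weak S x y => .weak S 1 (.reg (4 * x + 4)) (.reg (4 * y + 4))
  | memE1 x => .memE1 1 (.reg (4 * x + 4))
  | neg φ => .seq φ.compile (.assign 1 (.sub (.num 1) (.reg 1)))
  | and φ ψ => .seq φ.compile (.ite (.reg 1) ψ.compile skip)
  | ex v φ => .seq (.assign (4 * v + 5) (.num 0))
      (.seq (forAll v (.seq φ.compile (.ite (.reg 1) (.assign (4 * v + 5) (.num 1)) skip)))
        (.assign 1 (.reg (4 * v + 5))))
  -- A greedy basis of the set is built in the scratch array; x is spanned iff it is in the basis or
  -- makes it dependent. The entry at x is cleared separately because the value of x may lie beyond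
  -- the range of the clearing loop.
  | cl S v φ x => .seq (.write (32 + v) (.reg (4 * x + 4)) (.num 0))
      (.seq (forAll v (.write (32 + v) (.reg (4 * v + 4)) (.num 0)))
        (.seq (forAll v (.seq φ.compile (.ite (.reg 1)
            (.seq (.write (32 + v) (.reg (4 * v + 4)) (.num 1)) (.seq (.indep S 1 (32 + v))
              (.ite (.reg 1) skip (.write (32 + v) (.reg (4 * v + 4)) (.num 0))))) skip)))
          (.ite (.arr (32 + v) (.reg (4 * x + 4))) (.assign 1 (.num 1))
            (.seq (.write (32 + v) (.reg (4 * x + 4)) (.num 1))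
              (.seq (.indep S 1 (32 + v)) (.assign 1 (.sub (.num 1) (.reg 1))))))))
  | cardLt v φ ψ => .seq (.assign (4 * v + 5) (.num 0)) (.seq (.assign (4 * v + 6) (.num 0))
      (.seq (forAll v (.seq φ.compile
          (.ite (.reg 1) (.assign (4 * v + 5) (.add (.reg (4 * v + 5)) (.num 1))) skip)))
        (.seq (forAll v (.seq ψ.compile
            (.ite (.reg 1) (.assign (4 * v + 6) (.add (.reg (4 * v + 6)) (.num 1))) skip)))
          (.assign 1 (.lt (.reg (4 * v + 5)) (.reg (4 * v + 6)))))))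

end Form

/-- The states agree on the set variables, on the variables below `b` and on the registers that are
not used for the evaluation of formulas. -/
structure Store.Agree (b : ℕ) (s s' : Store) : Prop where
  reg : ∀ r < 4 * b + 4, r ≠ 1 → s'.reg r = s.reg r
  arr : ∀ a < 32 + b, s'.arr a = s.arr a

namespace Store

variable {n b c : ℕ} {s s' s'' : Store}

theorem Agree.refl (b : ℕ) (s : Store) : s.Agree b s := ⟨fun _ _ _ => rfl, fun _ _ => rfl⟩

theorem Agree.trans (h : s.Agree b s') (h' : s'.Agree b s'') : s.Agree b s'' :=
  ⟨fun r hr h1 => (h'.reg r hr h1).trans (h.reg r hr h1),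
    fun a ha => (h'.arr a ha).trans (h.arr a ha)⟩

theorem Agree.mono (h : s.Agree c s') (hbc : b ≤ c) : s.Agree b s' :=
  ⟨fun r hr h1 => h.reg r (by omega) h1, fun a ha => h.arr a (by omega)⟩

theorem Agree.setReg (h : s.Agree b s') {r : ℕ} (hr : r = 1 ∨ 4 * b + 4 ≤ r) (k : ℕ) :
    s.Agree b (s'.setReg r k) :=
  ⟨fun r' hr' h1 => (Function.update_of_ne (by omega) _ _).trans (h.reg r' hr' h1), h.arr⟩

theorem Agree.setArr (h : s.Agree b s') {a : ℕ} (ha : 32 + b ≤ a) (i k : ℕ) :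
    s.Agree b (s'.setArr a i k) :=
  ⟨h.reg, fun a' ha' => (Function.update_of_ne (by omega) _ _).trans (h.arr a' ha')⟩

/-- The values of the variables. -/
def vars (s : Store) (x : ℕ) : ℕ := s.reg (4 * x + 4)

theorem decode_congr {a : ℕ} (h : s'.arr a = s.arr a) : s'.decode n a = s.decode n a := by
  simp [decode, h]

theorem Agree.decode (h : s.Agree b s') {a : ℕ} (ha : a < 32) : s'.decode n a = s.decode n a :=
  decode_congr (h.arr a (by omega))

theorem Agree.vars (h : s.Agree b s') {x : ℕ} (hx : x < b) : s'.vars x = s.vars x :=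
  h.reg _ (by omega) (by omega)

theorem Agree.eval_iff (h : s.Agree b s') {X : StableInstance (Fin n)} {φ : Form}
    (hφ : φ.wf 0 b) :
    φ.eval X (s'.decode n) s'.vars ↔ φ.eval X (s.decode n) s.vars :=
  φ.eval_congr X (fun _ ha => h.decode ha) hφ (fun _ _ hx => h.vars hx)

theorem Agree.eval_update_iff (h : s.Agree b s') {X : StableInstance (Fin n)} {φ : Form}
    (hφ : φ.wf 0 (b + 1)) {i : Fin n} (hi : s'.reg (4 * b + 4) = i) :
    φ.eval X (s'.decode n) s'.vars ↔
      φ.eval X (s.decode n) (Function.update s.vars b i) := by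
  refine φ.eval_congr X (fun _ ha => h.decode ha) hφ (fun x _ hx => ?_)
  by_cases hxb : x = b
  · subst hxb; simpa [Store.vars] using hi
  · rw [Function.update_of_ne hxb]; exact h.vars (by omega)

@[simp] theorem setReg_reg_self (r k : ℕ) : (s.setReg r k).reg r = k := by simp [setReg]

theorem setReg_reg_of_ne {r r' : ℕ} (h : r' ≠ r) (k : ℕ) : (s.setReg r k).reg r' = s.reg r' := by
  simp [setReg, h]

@[simp] theorem setReg_arr (r k : ℕ) : (s.setReg r k).arr = s.arr := rfl

@[simp] theorem setArr_reg (a i k : ℕ) : (s.setArr a i k).reg = s.reg := rfl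

theorem setArr_arr (a i k j : ℕ) : (s.setArr a i k).arr a j = if j = i then k else s.arr a j := by
  simp [setArr, Function.update_apply]

variable {a : ℕ}

theorem decode_setArr_zero (i : Fin n) : (s.setArr a i 0).decode n a = s.decode n a \ {i} := by
  ext j
  by_cases h : j = i <;>
  simp [decode, Set.mem_ofPred_eq, setArr_arr, ← Fin.ext_iff, h]

theorem decode_setArr_one (i : Fin n) :
    (s.setArr a i 1).decode n a = insert i (s.decode n a) := by
  ext j
  by_cases h : j = i <;>
  simp [decode, Set.mem_ofPred_eq, setArr_arr, ← Fin.ext_iff, h]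

end Store

theorem answer_ne_zero {p : Prop} : answer p ≠ 0 ↔ p := by
  classical
  simp [answer]

theorem one_sub_answer (p : Prop) : 1 - answer p = answer (¬ p) := by
  classical
  by_cases h : p <;> simp [answer, h]

theorem answer_congr {p q : Prop} (h : p ↔ q) : answer p = answer q := by rw [propext h]

theorem answer_eq_ite {p : Prop} [Decidable p] : answer p = if p then 1 else 0 := by
  rw [answer]; congr

theorem answer_of {p : Prop} (h : p) : answer p = 1 := by classical simp [answer, h]

theorem answer_of_not {p : Prop} (h : ¬ p) : answer p = 0 := by classical simp [answer, h]

/-- The postcondition of `φ.compile`. -/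
def Form.Post (φ : Form) (b : ℕ) {n : ℕ} (X : StableInstance (Fin n)) (s s' : Store) : Prop :=
  s'.reg 1 = answer (φ.eval X (s.decode n) s.vars) ∧ s.Agree b s'

/-- `φ.compile` is correct and takes polynomial time. -/
def Form.Correct (φ : Form) (b : ℕ) : Prop :=
  ∃ T : Polynomial ℕ, ∀ (n : ℕ) (X : StableInstance (Fin n)) (s : Store),
    Runs X φ.compile s (T.eval n) (φ.Post b X s)

/-- The common shape of the quantifier, counting and closure loops: evaluate φ for each value and
act only if it holds. The truth value always refers to the initial state s, which every intermediate
state agrees with where φ looks. -/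
theorem Runs.forAll_test {n b : ℕ} {X : StableInstance (Fin n)} {φ : Form} {p : Prog}
    {s s₀ : Store} {T Tp : ℕ} (hwf : φ.wf 0 (b + 1))
    (hT : ∀ s, Runs X φ.compile s T (φ.Post (b + 1) X s))
    (Inv : ℕ → Store → Prop) (hag : ∀ i s', Inv i s' → s.Agree b s')
    (h0 : Inv 0 (s₀.setReg (4 * b + 4) 0))
    (hyes : ∀ (i : Fin n) (s₁ s₂ : Store), Inv i s₁ → s₁.Agree (b + 1) s₂ →
      s₂.reg (4 * b + 4) = i → φ.eval X (s.decode n) (Function.update s.vars b i) →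
      Runs X p s₂ Tp fun s₃ => s₃.reg (4 * b + 4) = i ∧ Inv (i + 1) (s₃.setReg (4 * b + 4) (i + 1)))
    (hno : ∀ (i : Fin n) (s₁ s₂ : Store), Inv i s₁ → s₁.Agree (b + 1) s₂ →
      s₂.reg (4 * b + 4) = i → ¬ φ.eval X (s.decode n) (Function.update s.vars b i) →
      Inv (i + 1) (s₂.setReg (4 * b + 4) (i + 1))) :
    Runs X (.forAll b (.seq φ.compile (.ite (.reg 1) p .skip))) s₀ (n * (T + Tp + 4) + 2)
      (Inv n) := by
  refine Runs.forAll (T := T + (Tp + 1 + 1)) Inv h0 fun i hi s₁ hs₁ hinv => ?_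
  refine Runs.seq (hT s₁) fun s₂ hs₂ => ?_
  have hev := ((hag i s₁ hinv).eval_update_iff (X := X) (i := ⟨i, hi⟩) hwf hs₁)
  have hri : s₂.reg (4 * b + 4) = i := by
    rw [hs₂.2.reg _ (by omega) (by omega)]; exact hs₁
  refine Runs.ite (fun h => ?_) (fun h => Runs.skip ?_)
  · rw [Expr.eval, hs₂.1, answer_ne_zero, hev] at h
    exact hyes ⟨i, hi⟩ s₁ s₂ hinv hs₂.2 hri h
  · rw [Expr.eval, hs₂.1, ← not_ne_iff, answer_ne_zero, hev] at h
    exact ⟨hri, hno ⟨i, hi⟩ s₁ s₂ hinv hs₂.2 hri h⟩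

/-- A loop that counts the elements of `{v | φ}` in register `c`. -/
theorem Runs.forAll_count {n b c : ℕ} {X : StableInstance (Fin n)} {φ : Form} {s s₀ : Store}
    {T : ℕ} (hwf : φ.wf 0 (b + 1)) (hT : ∀ s, Runs X φ.compile s T (φ.Post (b + 1) X s))
    (hag : s.Agree b s₀) (hc : 4 * b + 5 ≤ c) (hcb : c < 4 * b + 8) (h0 : s₀.reg c = 0)
    {Q : Store → Prop} (hQ : ∀ s₁ s₂, Q s₁ → s₁.Agree (b + 1) s₂ → Q s₂) (hQ0 : Q s₀)
    (hQr : ∀ s r k, Q s → r = c ∨ r = 4 * b + 4 → Q (s.setReg r k)) :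
    Runs X (.forAll b (.seq φ.compile (.ite (.reg 1) (.assign c (.add (.reg c) (.num 1))) .skip)))
      s₀ (n * (T + 1 + 4) + 2) fun s' => s.Agree b s' ∧ Q s' ∧ s'.reg c =
        {j : Fin n | φ.eval X (s.decode n) (Function.update s.vars b j)}.ncard := by
  set F := {j : Fin n | φ.eval X (s.decode n) (Function.update s.vars b j)} with hF
  refine (Runs.forAll_test (s := s) hwf hT (fun i s' => s.Agree b s' ∧ Q s' ∧
    s'.reg c = {j ∈ F | (j : ℕ) < i}.ncard) (fun i s' h => h.1) ?_ ?_ ?_).mono le_rfl ?_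
  · refine ⟨hag.setReg (by omega) _, hQr _ _ _ hQ0 (Or.inr rfl), ?_⟩
    rw [Store.setReg_reg_of_ne (by omega), h0]
    simp
  · intro i s₁ s₂ hinv hag₂ hi hev
    refine Runs.assign ⟨by rw [Store.setReg_reg_of_ne (by omega), hi],
      ((hinv.1.trans (hag₂.mono (by omega))).setReg (by omega) _).setReg (by omega) _,
      hQr _ _ _ (hQr _ _ _ (hQ _ _ hinv.2.1 hag₂) (Or.inl rfl)) (Or.inr rfl), ?_⟩
    rw [Store.setReg_reg_of_ne (by omega), Store.setReg_reg_self, Expr.eval, Expr.eval, Expr.eval,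
      hag₂.reg _ (by omega) (by omega), hinv.2.2]
    have : {j ∈ F | (j : ℕ) < (i : ℕ) + 1} = insert i {j ∈ F | (j : ℕ) < i} := by
      ext j
      simp only [Set.mem_ofPred_eq, Set.mem_insert_iff, Nat.lt_succ_iff_lt_or_eq, ← Fin.ext_iff]
      constructor
      · rintro ⟨h, h' | h'⟩
        · exact Or.inr ⟨h, h'⟩
        · exact Or.inl h'
      · rintro (rfl | ⟨h, h'⟩)
        · exact ⟨hev, Or.inr rfl⟩
        · exact ⟨h, Or.inl h'⟩
    rw [this, Set.ncard_insert_of_notMem (by simp) (Set.toFinite _)]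
  · intro i s₁ s₂ hinv hag₂ hi hev
    refine ⟨(hinv.1.trans (hag₂.mono (by omega))).setReg (by omega) _,
      hQr _ _ _ (hQ _ _ hinv.2.1 hag₂) (Or.inr rfl), ?_⟩
    rw [Store.setReg_reg_of_ne (by omega), hag₂.reg _ (by omega) (by omega), hinv.2.2]
    congr 1
    ext j
    simp only [Set.mem_ofPred_eq, Nat.lt_succ_iff_lt_or_eq, ← Fin.ext_iff]
    constructor
    · exact fun h => ⟨h.1, Or.inl h.2⟩
    · rintro ⟨h, h' | rfl⟩
      · exact ⟨h, h'⟩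
      · exact absurd h hev
  · rintro s' ⟨h1, h2, h3⟩
    refine ⟨h1, h2, ?_⟩
    rw [h3]
    congr 1
    ext j
    simp

/-! ### Correctness and running time of compiled formulas. -/

namespace Form

theorem correct_ex {b : ℕ} {φ : Form} (hwf : φ.wf 0 (b + 1)) (h : φ.Correct (b + 1)) :
    (ex b φ).Correct b := by
  obtain ⟨T, hT⟩ := h
  refine ⟨1 + ((Polynomial.X * (T + 1 + 4) + 2) + 1), fun n X s => ?_⟩
  simp only [Polynomial.eval_add, Polynomial.eval_mul, Polynomial.eval_X, Polynomial.eval_one,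
    Polynomial.eval_ofNat]
  refine Runs.seq (R := fun s' => s.Agree b s' ∧ s'.reg (4 * b + 5) = 0) (Runs.assign
    ⟨(Store.Agree.refl b s).setReg (by omega) _, by simp [Expr.eval]⟩) fun s₁ h₁ => ?_
  refine Runs.seq (Runs.forAll_test (s := s) hwf (hT n X) (fun i s' => s.Agree b s' ∧
    s'.reg (4 * b + 5) = answer (∃ j : Fin n, (j : ℕ) < i ∧
      φ.eval X (s.decode n) (Function.update s.vars b j))) (fun _ _ h => h.1) ?_ ?_ ?_)
    fun s₂ h₂ => Runs.assign ?_
  · refine ⟨h₁.1.setReg (by omega) _, ?_⟩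
    rw [Store.setReg_reg_of_ne (by omega), h₁.2, answer_of_not (by simp)]
  · intro i s₁ s₂ hinv hag hi hev
    refine Runs.assign ⟨by rw [Store.setReg_reg_of_ne (by omega), hi],
      ((hinv.1.trans (hag.mono (by omega))).setReg (by omega) _).setReg (by omega) _, ?_⟩
    rw [Store.setReg_reg_of_ne (by omega), Store.setReg_reg_self,
      answer_of ⟨i, Nat.lt_succ_self _, hev⟩, Expr.eval]
  · intro i s₁ s₂ hinv hag hi hev
    refine ⟨(hinv.1.trans (hag.mono (by omega))).setReg (by omega) _, ?_⟩
    rw [Store.setReg_reg_of_ne (by omega), hag.reg _ (by omega) (by omega), hinv.2]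
    refine answer_congr ⟨fun ⟨j, hj, h⟩ => ⟨j, by omega, h⟩, fun ⟨j, hj, h⟩ => ⟨j, ?_, h⟩⟩
    rcases Nat.lt_succ_iff_lt_or_eq.1 hj with h' | h'
    · exact h'
    · exact absurd (Fin.ext h' ▸ h) hev
  · refine ⟨?_, h₂.1.setReg (by omega) _⟩
    rw [Store.setReg_reg_self, Expr.eval, h₂.2]
    refine answer_congr ?_
    simp [eval]

theorem correct_cardLt {b : ℕ} {φ ψ : Form} (hwfφ : φ.wf 0 (b + 1)) (hφ : φ.Correct (b + 1))
    (hwfψ : ψ.wf 0 (b + 1)) (hψ : ψ.Correct (b + 1)) : (cardLt b φ ψ).Correct b := by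
  obtain ⟨T, hT⟩ := hφ
  obtain ⟨T', hT'⟩ := hψ
  refine ⟨1 + (1 + ((Polynomial.X * (T + 1 + 4) + 2) + ((Polynomial.X * (T' + 1 + 4) + 2) + 1))),
    fun n X s => ?_⟩
  simp only [Polynomial.eval_add, Polynomial.eval_mul, Polynomial.eval_X, Polynomial.eval_one,
    Polynomial.eval_ofNat]
  refine Runs.seq (R := fun s' => s.Agree b s' ∧ s'.reg (4 * b + 5) = 0) (Runs.assign
    ⟨(Store.Agree.refl b s).setReg (by omega) _, by simp [Expr.eval]⟩) fun s₁ h₁ => ?_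
  refine Runs.seq (R := fun s' => s.Agree b s' ∧ s'.reg (4 * b + 5) = 0 ∧ s'.reg (4 * b + 6) = 0)
    (Runs.assign ⟨h₁.1.setReg (by omega) _, by rw [Store.setReg_reg_of_ne (by omega), h₁.2],
      by simp [Expr.eval]⟩) fun s₂ h₂ => ?_
  refine Runs.seq (Runs.forAll_count hwfφ (hT n X) h₂.1 (by omega) (by omega) h₂.2.1
    (Q := fun s' => s'.reg (4 * b + 6) = 0) (fun s₁ s₂ h hag => by
      rw [hag.reg _ (by omega) (by omega), h]) h₂.2.2 (fun s r k h hr => by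
      rw [Store.setReg_reg_of_ne (by omega), h])) fun s₃ h₃ => ?_
  -- The extra invariant protects the first count during the second loop.
  refine Runs.seq (Runs.forAll_count hwfψ (hT' n X) h₃.1 (by omega) (by omega) h₃.2.1
    (Q := fun s' => s'.reg (4 * b + 5) = s₃.reg (4 * b + 5)) (fun s₁ s₂ h hag => by
      rw [hag.reg _ (by omega) (by omega), h]) rfl (fun s r k h hr => by
      rw [Store.setReg_reg_of_ne (by omega), h])) fun s₄ h₄ => ?_
  refine Runs.assign ⟨?_, h₄.1.setReg (by omega) _⟩
  rw [Store.setReg_reg_self, Expr.eval, Expr.eval, Expr.eval, h₄.2.1, h₃.2.2, h₄.2.2]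
  rw [eval, answer_eq_ite]

theorem correct_cl {b x : ℕ} {S : Side} {φ : Form} (hx : x < b) (hwf : φ.wf 0 (b + 1))
    (h : φ.Correct (b + 1)) : (cl S b φ x).Correct b := by
  obtain ⟨T, hT⟩ := h
  refine ⟨1 + ((Polynomial.X * (1 + 2) + 2) + ((Polynomial.X * (T + (1 + (1 + (1 + 1 + 1))) + 4) + 2)
    + (1 + (1 + (1 + 1)) + 1))), fun n X s => ?_⟩
  simp only [Polynomial.eval_add, Polynomial.eval_mul, Polynomial.eval_X, Polynomial.eval_one,
    Polynomial.eval_ofNat]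
  set F := {j : Fin n | φ.eval X (s.decode n) (Function.update s.vars b j)} with hF
  -- G i is the greedy basis of the elements below i. Whether an element enters depends on smaller
  -- ones only, so one oracle call leads from G i to G (i + 1).
  let G : ℕ → Set (Fin n) := fun i =>
    {j ∈ {j ∈ F | (j : ℕ) < i} | j ∉ (X.M S).closure {k ∈ {j ∈ F | (j : ℕ) < i} | (k : ℕ) < j}}
  have hG : ∀ i, (X.M S).IsBasis (G i) {j ∈ F | (j : ℕ) < i} := fun i =>
    Matroid.isBasis_greedy (X.subset_ground _ _) Fin.val_injective
  have hmemG : ∀ (i : ℕ) (j : Fin n), j ∈ G i ↔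
      (j ∈ F ∧ (j : ℕ) < i) ∧ j ∉ (X.M S).closure {k ∈ F | (k : ℕ) < j} := fun i j => by
    have : ∀ hj : (j : ℕ) < i, {k ∈ {j ∈ F | (j : ℕ) < i} | (k : ℕ) < j} = {k ∈ F | (k : ℕ) < j} :=
      fun hj => by
        ext k
        simp only [Set.mem_ofPred_eq]
        exact ⟨fun h => ⟨h.1.1, h.2⟩, fun h => ⟨⟨h.1, h.2.trans hj⟩, h.2⟩⟩
    refine and_congr_right fun h => ?_
    rw [this h.2]
  have hFsucc' : ∀ i : Fin n, i ∉ F →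
      {j ∈ F | (j : ℕ) < (i : ℕ) + 1} = {j ∈ F | (j : ℕ) < i} := fun i hi => by
    ext j
    simp only [Set.mem_ofPred_eq, Nat.lt_succ_iff_lt_or_eq, ← Fin.ext_iff]
    constructor
    · rintro ⟨h, h' | rfl⟩
      · exact ⟨h, h'⟩
      · exact absurd h hi
    · exact fun h => ⟨h.1, Or.inl h.2⟩
  have hiG : ∀ i : Fin n, i ∉ G i := fun i h => absurd h.1.2 (lt_irrefl _)
  have hGsucc : ∀ i : Fin n, i ∈ F →
      G (i + 1) = {j ∈ insert i (G i) | j = i → (X.M S).Indep (insert i (G i))} := fun i hi => by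
    have hind : (X.M S).Indep (insert i (G i)) ↔ i ∉ (X.M S).closure {j ∈ F | (j : ℕ) < i} := by
      rw [← (hG i).closure_eq_closure,
        (hG i).indep.notMem_closure_iff_of_notMem (hiG i) (X.mem_ground _ _)]
    ext j
    change _ ↔ j ∈ insert i (G i) ∧ (j = i → (X.M S).Indep (insert i (G i)))
    rw [Set.mem_insert_iff, hind, hmemG, hmemG]
    rcases lt_trichotomy (j : ℕ) i with hlt | heq | hgt
    · have hne : j ≠ i := fun h => by simp [h] at hlt
      simp only [hne, false_or, false_imp_iff, and_true, hlt, Nat.lt_succ_of_lt hlt]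
    · obtain rfl := Fin.ext heq
      simp [hi]
    · have hne : j ≠ i := fun h => by simp [h] at hgt
      simp only [hne, false_or, hgt.not_gt, and_false, false_and, false_imp_iff, and_true]
      simp only [show ¬ (j : ℕ) < i + 1 by omega, and_false, false_and]
  have hGsucc' : ∀ i : Fin n, i ∉ F → G (i + 1) = G i := fun i hi => by
    simp only [G, hFsucc' i hi]
  let Q : ℕ → Store → Prop := fun i s' => s.Agree b s' ∧ s'.decode n (32 + b) = G i ∧
    (n ≤ s.vars x → s'.arr (32 + b) (s.vars x) = 0)
  have hvx : ∀ s', s.Agree b s' → (Expr.reg (4 * x + 4)).eval n s' = s.vars x :=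
    fun s' h => h.vars hx
  refine Runs.seq (R := fun s' => s.Agree b s' ∧ s'.arr (32 + b) (s.vars x) = 0)
    (Runs.write ⟨(Store.Agree.refl b s).setArr le_rfl _ _, ?_⟩) fun s₁ h₁ => ?_
  · exact (Store.setArr_arr _ _ _ _).trans (if_pos rfl)
  refine Runs.seq (Runs.forAll (fun i s' => s.Agree b s' ∧ s'.arr (32 + b) (s.vars x) = 0 ∧
    ∀ j < i, s'.arr (32 + b) j = 0) ⟨h₁.1.setReg (by omega) _, h₁.2, by simp⟩ ?_) fun s₂ h₂ => ?_
  · intro i hi s' hs' hinv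
    refine Runs.write ⟨by simpa using hs', (hinv.1.setArr le_rfl _ _).setReg (by omega) _, ?_, ?_⟩
    · rw [Store.setReg_arr, Store.setArr_arr, hinv.2.1]; split_ifs <;> rfl
    · intro j hj
      rw [Store.setReg_arr, Store.setArr_arr, Expr.eval, Expr.eval, hs']
      split_ifs with h
      · rfl
      · exact hinv.2.2 j (by omega)
  refine Runs.seq (Runs.forAll_test (s := s) hwf (hT n X) Q (fun _ _ h => h.1) ?_ ?_ ?_)
    fun s₃ h₃ => ?_
  · refine ⟨h₂.1.setReg (by omega) _, ?_, fun _ => h₂.2.1⟩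
    ext j
    simp [Store.decode, G, h₂.2.2 j j.2]
  · intro i s₁ s₂ hinv hag hi hev
    have hag' := hinv.1.trans (hag.mono (Nat.le_succ b))
    have hdec : s₂.decode n (32 + b) = G i := by
      rw [Store.decode_congr (hag.arr _ (by omega)), hinv.2.1]
    have hzero : n ≤ s.vars x → s₂.arr (32 + b) (s.vars x) = 0 := fun h => by
      rw [hag.arr _ (by omega), hinv.2.2 h]
    refine Runs.seq (R := fun s' => s.Agree b s' ∧ s'.reg (4 * b + 4) = i ∧
      s'.decode n (32 + b) = insert i (G i) ∧ (n ≤ s.vars x → s'.arr (32 + b) (s.vars x) = 0))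
      (Runs.write ?_) fun s₄ h₄ => ?_
    · rw [Expr.eval, Expr.eval, hi]
      refine ⟨hag'.setArr le_rfl _ _, hi, by rw [Store.decode_setArr_one, hdec], fun h => ?_⟩
      rw [Store.setArr_arr, if_neg (by omega), hzero h]
    refine Runs.seq (R := fun s' => s.Agree b s' ∧ s'.reg (4 * b + 4) = i ∧
      s'.decode n (32 + b) = insert i (G i) ∧ (n ≤ s.vars x → s'.arr (32 + b) (s.vars x) = 0) ∧
      s'.reg 1 = answer ((X.M S).Indep (insert i (G i))))
      (Runs.indep ⟨h₄.1.setReg (by omega) _, by rw [Store.setReg_reg_of_ne (by omega), h₄.2.1],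
        h₄.2.2.1, h₄.2.2.2, by rw [Store.setReg_reg_self, h₄.2.2.1]⟩) fun s₅ h₅ => ?_
    refine Runs.ite (fun h => Runs.skip ?_) fun h => Runs.write ?_
    · rw [Expr.eval, h₅.2.2.2.2, answer_ne_zero] at h
      refine ⟨h₅.2.1, h₅.1.setReg (by omega) _, ?_, h₅.2.2.2.1⟩
      rw [hGsucc i hev]
      simp only [h, implies_true, and_true]
      exact h₅.2.2.1
    · rw [Expr.eval, h₅.2.2.2.2, ← not_ne_iff, answer_ne_zero] at h
      rw [Expr.eval, Expr.eval, h₅.2.1]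
      refine ⟨h₅.2.1, (h₅.1.setArr le_rfl _ _).setReg (by omega) _, ?_, fun h' => ?_⟩
      · rw [hGsucc i hev]
        have := Store.decode_setArr_zero (s := s₅) (a := 32 + b) i
        rw [h₅.2.2.1] at this
        refine this.trans ?_
        ext j
        by_cases hj : j = i <;> simp [h, hj]
      · rw [Store.setReg_arr, Store.setArr_arr, if_neg (by omega), h₅.2.2.2.1 h']
  · intro i s₁ s₂ hinv hag hi hev
    refine ⟨(hinv.1.trans (hag.mono (by omega))).setReg (by omega) _, ?_, fun h => ?_⟩
    · rw [hGsucc' i hev, ← hinv.2.1]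
      exact Store.decode_congr (hag.arr _ (by omega))
    · rw [Store.setReg_arr, hag.arr _ (by omega), hinv.2.2 h]
  obtain ⟨hag, hdec, hzero⟩ := h₃
  have hFn : {j ∈ F | (j : ℕ) < n} = F := by ext j; simp
  have hB := hG n
  rw [hFn] at hB
  have heval : ∀ i : Fin n, (i : ℕ) = s.vars x →
      ((cl S b φ x).eval X (s.decode n) s.vars ↔ i ∈ (X.M S).closure (G n)) := by
    intro i hi
    rw [hB.closure_eq_closure]
    simp only [eval, ← hi, ← Fin.ext_iff, exists_eq_left]
    rfl
  refine Runs.ite (fun h => Runs.assign ⟨?_, hag.setReg (by omega) _⟩) fun h => ?_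
  · rw [Expr.eval, hvx _ hag] at h
    have hlt : s.vars x < n := by
      by_contra h'
      exact h (hzero (not_lt.1 h'))
    rw [Store.setReg_reg_self, Expr.eval, answer_of]
    rw [heval ⟨s.vars x, hlt⟩ rfl]
    refine X.mem_closure ?_
    rw [← hdec]
    exact h
  · rw [Expr.eval, hvx _ hag] at h
    refine Runs.seq (R := fun s' => s.Agree b s' ∧ (s'.decode n (32 + b) =
      {j : Fin n | (j : ℕ) = s.vars x ∨ j ∈ G n})) (Runs.write
        ⟨hag.setArr le_rfl _ _, ?_⟩) fun s₄ h₄ => ?_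
    · rw [hvx _ hag]
      ext j
      rw [← hdec]
      simp only [Store.decode, Set.mem_ofPred_eq, Store.setArr_arr, Expr.eval]
      split_ifs with hj <;> simp [hj]
    refine Runs.seq (R := fun s' => s.Agree b s' ∧ s'.reg 1 =
      answer ((X.M S).Indep {j : Fin n | (j : ℕ) = s.vars x ∨ j ∈ G n}))
      (Runs.indep ⟨h₄.1.setReg (by omega) _, by rw [Store.setReg_reg_self, h₄.2]⟩) fun s₅ h₅ => ?_
    refine Runs.assign ⟨?_, h₅.1.setReg (by omega) _⟩
    rw [Store.setReg_reg_self, Expr.eval, Expr.eval, Expr.eval, h₅.2, one_sub_answer]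
    refine answer_congr ?_
    by_cases hlt : s.vars x < n
    · rw [heval ⟨s.vars x, hlt⟩ rfl, ← not_iff_not, not_not]
      have hnot : (⟨s.vars x, hlt⟩ : Fin n) ∉ G n := by
        rw [← hdec]
        exact fun h' => h' h
      rw [hB.indep.notMem_closure_iff_of_notMem hnot (X.mem_ground _ _)]
      have : {j : Fin n | (j : ℕ) = s.vars x ∨ j ∈ G n} = insert ⟨s.vars x, hlt⟩ (G n) := by
        ext j
        simp [Fin.ext_iff]
      rw [this]
    -- A value off the ground set adds nothing to the stored set, so the oracle finds it independent
    -- and the query answers false, as its semantics demands.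
    · have h1 : {j : Fin n | (j : ℕ) = s.vars x ∨ j ∈ G n} = G n := by
        ext j
        have : (j : ℕ) ≠ s.vars x := by omega
        simp [this]
      rw [h1]
      refine iff_of_false (not_not.2 hB.indep) ?_
      rintro ⟨i, hi, -⟩
      omega

theorem correct (φ : Form) : ∀ b, φ.wf 0 b → φ.Correct b := by
  induction φ with
  | mem a x =>
    refine fun b hwf => ⟨1, fun n X s => Runs.mono (Runs.assign ?_) (by simp) fun _ h => h⟩
    refine ⟨?_, (Store.Agree.refl b s).setReg (by omega) _⟩
    rw [Store.setReg_reg_self]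
    simp only [Expr.eval, eval, Store.decode, Store.vars, Set.mem_ofPred_eq]
    by_cases hx : s.reg (4 * x + 4) < n
    · by_cases ha : s.arr a (s.reg (4 * x + 4)) = 0
      · rw [answer_of_not]
        · simp [ha, hx]
        · rintro ⟨i, hi, h⟩
          exact h (hi ▸ ha)
      · rw [answer_of ⟨⟨_, hx⟩, rfl, ha⟩]
        simp [Nat.pos_of_ne_zero ha, hx]
    · rw [answer_of_not]
      · simp only [hx, if_false]
        split_ifs <;> simp_all
      · rintro ⟨i, hi, -⟩
        omega
  | lt x y =>
    refine fun b hwf => ⟨1, fun n X s => Runs.mono (Runs.assign ?_) (by simp) fun _ h => h⟩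
    refine ⟨?_, (Store.Agree.refl b s).setReg (by omega) _⟩
    rw [Store.setReg_reg_self]
    rw [eval, answer_eq_ite]
    rfl
  | weak S x y =>
    refine fun b hwf => ⟨1, fun n X s => ⟨_, _, .weak S 1 _ _ s, by simp, ?_,
      (Store.Agree.refl b s).setReg (by omega) _⟩⟩
    rw [Store.setReg_reg_self]
    rfl
  | memE1 x =>
    refine fun b hwf => ⟨1, fun n X s => ⟨_, _, .memE1 1 _ s, by simp, ?_,
      (Store.Agree.refl b s).setReg (by omega) _⟩⟩
    rw [Store.setReg_reg_self]
    rfl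
  | neg φ ih =>
    intro b hwf
    obtain ⟨T, hT⟩ := ih b hwf
    refine ⟨T + 1, fun n X s => ?_⟩
    simp only [Polynomial.eval_add, Polynomial.eval_one]
    refine Runs.seq (hT n X s) fun s' h => Runs.assign ⟨?_, h.2.setReg (by omega) _⟩
    rw [Store.setReg_reg_self, Expr.eval, Expr.eval, Expr.eval, h.1, one_sub_answer]
    rfl
  | and φ ψ ih₁ ih₂ =>
    intro b hwf
    simp only [wf, Bool.and_eq_true] at hwf
    obtain ⟨T₁, hT₁⟩ := ih₁ b hwf.1
    obtain ⟨T₂, hT₂⟩ := ih₂ b hwf.2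
    refine ⟨T₁ + (T₂ + 1 + 1), fun n X s => ?_⟩
    simp only [Polynomial.eval_add, Polynomial.eval_one]
    refine Runs.seq (hT₁ n X s) fun s' h => Runs.ite (fun h' => ?_) fun h' => Runs.skip ?_
    · rw [Expr.eval, h.1, answer_ne_zero] at h'
      refine (hT₂ n X s').mono le_rfl fun s'' h'' => ⟨?_, h.2.trans h''.2⟩
      rw [h''.1]
      exact answer_congr ((h.2.eval_iff hwf.2).trans (and_iff_right h').symm)
    · rw [Expr.eval, h.1, ← not_ne_iff, answer_ne_zero] at h'
      refine ⟨?_, h.2⟩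
      rw [h.1]
      exact answer_congr ⟨fun h => absurd h h', fun h => h.1⟩
  | ex v φ ih =>
    intro b hwf
    simp only [wf, Bool.and_eq_true, decide_eq_true_eq] at hwf
    obtain ⟨rfl, hwf⟩ := hwf
    exact correct_ex hwf (ih _ hwf)
  | cl S v φ x ih =>
    intro b hwf
    simp only [wf, Bool.and_eq_true, decide_eq_true_eq] at hwf
    obtain ⟨⟨rfl, hx⟩, hwf⟩ := hwf
    exact correct_cl hx.2 hwf (ih _ hwf)
  | cardLt v φ ψ ih₁ ih₂ =>
    intro b hwf
    simp only [wf, Bool.and_eq_true, decide_eq_true_eq] at hwf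
    obtain ⟨rfl, hwf₁, hwf₂⟩ := hwf
    exact correct_cardLt hwf₁ (ih₁ _ hwf₁) hwf₂ (ih₂ _ hwf₂)

theorem wf_mono {l : ℕ} (φ : Form) : ∀ {b : ℕ}, φ.wf l b → φ.wf 0 b := by
  induction φ with
  | mem a x => intro b h; simp only [wf, decide_eq_true_eq] at h ⊢; omega
  | lt x y => intro b h; simp only [wf, decide_eq_true_eq] at h ⊢; omega
  | weak S x y => intro b h; simp only [wf, decide_eq_true_eq] at h ⊢; omega
  | memE1 x => intro b h; simp only [wf, decide_eq_true_eq] at h ⊢; omega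
  | neg φ ih => exact fun h => ih h
  | and φ ψ ih₁ ih₂ =>
    intro b h
    simp only [wf, Bool.and_eq_true] at h ⊢
    exact ⟨ih₁ h.1, ih₂ h.2⟩
  | ex v φ ih =>
    intro b h
    simp only [wf, Bool.and_eq_true] at h ⊢
    exact ⟨h.1, ih h.2⟩
  | cl S v φ x ih =>
    intro b h
    simp only [wf, Bool.and_eq_true, decide_eq_true_eq] at h ⊢
    exact ⟨⟨h.1.1, Nat.zero_le _, h.1.2.2⟩, ih h.2⟩
  | cardLt v φ ψ ih₁ ih₂ =>
    intro b h
    simp only [wf, Bool.and_eq_true] at h ⊢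
    exact ⟨h.1, ih₁ h.2.1, ih₂ h.2.2⟩

end Form

/-- A kind of configuration, and the values of the set variables. -/
abbrev SetState (n : ℕ) := ℕ × (ℕ → Set (Fin n))

/-- Commands: `set a v φ` assigns `{v | φ}` to the set variable `a`, `rep v c` repeats `c` as often
as the ground set has elements, using the variable `v` as a counter. -/
inductive Cmd
  | skip
  | kind (k : ℕ)
  | set (a v : ℕ) (φ : Form)
  | seq (c d : Cmd)
  | ite (v : ℕ) (φ : Form) (c d : Cmd)
  | rep (v : ℕ) (c : Cmd)

namespace Cmd

open Classical in
/-- The effect of a command. -/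
noncomputable def run {n : ℕ} (X : StableInstance (Fin n)) : Cmd → SetState n → SetState n
  | skip, σ => σ
  | kind k, σ => (k, σ.2)
  | set a v φ, σ => (σ.1, Function.update σ.2 a
      {j : Fin n | φ.eval X σ.2 (Function.update (fun _ => 0) v j)})
  | seq c d, σ => run X d (run X c σ)
  | ite _ φ c d, σ => if φ.eval X σ.2 (fun _ => 0) then run X c σ else run X d σ
  | rep _ c, σ => (run X c)^[n] σ

/-- Formulas have no free variables, and the counters of loops that are under way are not used
otherwise. -/
def wf : ℕ → Cmd → Bool
  | _, skip => true
  | _, kind _ => true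
  | b, set a v φ => decide (a < 32 ∧ b ≤ v) && φ.wf v (v + 1)
  | b, seq c d => wf b c && wf b d
  | b, ite v φ c d => decide (b ≤ v) && φ.wf v v && (wf b c && wf b d)
  | b, rep v c => decide (b ≤ v) && wf (v + 1) c

/-- The program of a command. -/
def compile : Cmd → Prog
  | skip => .skip
  | kind k => .assign 0 (.num k)
  -- The result is collected in a scratch array and then copied, because φ may refer to the old
  -- value of `a`.
  | set a v φ => .seq (.forAll v (.seq φ.compile (.write (32 + v) (.reg (4 * v + 4)) (.reg 1))))
      (.forAll v (.write a (.reg (4 * v + 4)) (.arr (32 + v) (.reg (4 * v + 4)))))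
  | seq c d => .seq c.compile d.compile
  | ite _ φ c d => .seq φ.compile (.ite (.reg 1) c.compile d.compile)
  | rep v c => .forAll v c.compile

end Cmd

/-- The state of the machine represents the state of the set variables. -/
def Store.Rep {n : ℕ} (s : Store) (σ : SetState n) : Prop :=
  s.reg 0 = σ.1 ∧ ∀ a < 32, s.decode n a = σ.2 a

/-- The postcondition of the program of a command. -/
def Cmd.Post (c : Cmd) (b : ℕ) {n : ℕ} (X : StableInstance (Fin n)) (s : Store) (σ : SetState n)
    (s' : Store) : Prop :=
  s'.Rep (c.run X σ) ∧ ∀ r, 4 ≤ r → r < 4 * b + 4 → s'.reg r = s.reg r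

/-- The program of the command `c` is correct and takes polynomial time. -/
def Cmd.Correct (c : Cmd) (b : ℕ) : Prop :=
  ∃ T : Polynomial ℕ, ∀ (n : ℕ) (X : StableInstance (Fin n)) (s : Store) (σ : SetState n),
    s.Rep σ → Runs X c.compile s (T.eval n) (c.Post b X s σ)

/-! ### Correctness and running time of compiled commands. -/

namespace Cmd

theorem correct_set {a v b : ℕ} {φ : Form} (ha : a < 32) (hb : b ≤ v) (hwf : φ.wf v (v + 1)) :
    (set a v φ).Correct b := by
  obtain ⟨T, hT⟩ := φ.correct _ (φ.wf_mono hwf)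
  refine ⟨(Polynomial.X * (T + 1 + 2) + 2) + (Polynomial.X * (1 + 2) + 2), fun n X s σ hs => ?_⟩
  simp only [Polynomial.eval_add, Polynomial.eval_mul, Polynomial.eval_X, Polynomial.eval_one,
    Polynomial.eval_ofNat]
  refine Runs.seq (Runs.forAll (fun i s' => s.Agree v s' ∧ ∀ j : Fin n, (j : ℕ) < i →
    (s'.arr (32 + v) j ≠ 0 ↔ φ.eval X (s.decode n) (Function.update s.vars v j)))
    ⟨(Store.Agree.refl v s).setReg (by omega) _, by simp⟩ ?_) fun s₁ h₁ => ?_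
  · intro i hi s₁ hi₁ hinv
    refine Runs.seq (hT n X s₁) fun s₂ h₂ => Runs.write ?_
    have hri : s₂.reg (4 * v + 4) = i := by
      rw [h₂.2.reg _ (by omega) (by omega)]; exact hi₁
    refine ⟨hri, ((hinv.1.trans (h₂.2.mono (by omega))).setArr le_rfl _ _).setReg (by omega) _,
      fun j hj => ?_⟩
    rw [Store.setReg_arr, Store.setArr_arr, Expr.eval, Expr.eval, hri]
    by_cases hji : (j : ℕ) = i
    · rw [if_pos hji, h₂.1, answer_ne_zero]
      exact hinv.1.eval_update_iff (φ.wf_mono hwf) (hi₁.trans hji.symm)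
    · rw [if_neg hji, h₂.2.arr _ (by omega)]
      exact hinv.2 j (by omega)
  · refine (Runs.forAll (fun i s' => (∀ r < 4 * v + 4, r ≠ 1 → s'.reg r = s.reg r) ∧
      (∀ a' < 32, a' ≠ a → s'.arr a' = s.arr a') ∧ s'.arr (32 + v) = s₁.arr (32 + v) ∧
      ∀ j < i, s'.arr a j = s₁.arr (32 + v) j) ?_ ?_).mono le_rfl ?_
    · refine ⟨fun r hr h1 => ?_, fun a' ha' _ => h₁.1.arr _ (by omega), rfl, by simp⟩
      rw [Store.setReg_reg_of_ne (by omega), h₁.1.reg r hr h1]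
    · intro i hi s₂ hi₂ hinv
      refine Runs.write ⟨hi₂, fun r hr h1 => ?_, fun a' ha' hne => ?_, ?_, fun j hj => ?_⟩
      · rw [Store.setReg_reg_of_ne (by omega)]; exact hinv.1 r hr h1
      · exact (Function.update_of_ne hne _ _).trans (hinv.2.1 a' ha' hne)
      · exact (Function.update_of_ne (by omega) _ _).trans hinv.2.2.1
      · rw [Store.setReg_arr, Store.setArr_arr, Expr.eval, Expr.eval, hi₂, Expr.eval, hi₂,
          hinv.2.2.1]
        split_ifs with h
        · rw [h]
        · exact hinv.2.2.2 j (by omega)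
    · rintro s₂ ⟨h1, h2, -, h4⟩
      refine ⟨⟨?_, fun a' ha' => ?_⟩, fun r hr hrb => h1 r (by omega) (by omega)⟩
      · exact (h1 0 (by omega) (by omega)).trans hs.1
      · simp only [run]
        by_cases haa : a' = a
        · subst haa
          rw [Function.update_self]
          ext j
          rw [Store.decode, Set.mem_ofPred_eq, h4 j j.2, h₁.2 j j.2, Set.mem_ofPred_eq]
          refine φ.eval_congr X hs.2 hwf fun x hx hxv => ?_
          obtain rfl : x = v := by omega
          simp
        · rw [Function.update_of_ne haa, ← hs.2 a' ha']
          exact Store.decode_congr (h2 a' ha' haa)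

theorem correct (c : Cmd) : ∀ b, c.wf b → c.Correct b := by
  induction c with
  | skip =>
    exact fun b _ => ⟨1, fun n X s σ hs => (Runs.skip ⟨hs, fun _ _ _ => rfl⟩).mono (by simp)
      fun _ h => h⟩
  | kind k =>
    refine fun b _ => ⟨1, fun n X s σ hs => (Runs.assign ⟨⟨?_, hs.2⟩, fun r hr _ => ?_⟩).mono
      (by simp) fun _ h => h⟩
    · rw [Store.setReg_reg_self]; rfl
    · rw [Store.setReg_reg_of_ne (by omega)]
  | set a v φ =>
    intro b hwf
    simp only [wf, Bool.and_eq_true, decide_eq_true_eq] at hwf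
    exact correct_set hwf.1.1 hwf.1.2 hwf.2
  | seq c d ih₁ ih₂ =>
    intro b hwf
    simp only [wf, Bool.and_eq_true] at hwf
    obtain ⟨T₁, h₁⟩ := ih₁ b hwf.1
    obtain ⟨T₂, h₂⟩ := ih₂ b hwf.2
    refine ⟨T₁ + T₂, fun n X s σ hs => ?_⟩
    simp only [Polynomial.eval_add]
    refine Runs.seq (h₁ n X s σ hs) fun s' h => (h₂ n X s' _ h.1).mono le_rfl fun s'' h' =>
      ⟨h'.1, fun r hr hrb => (h'.2 r hr hrb).trans (h.2 r hr hrb)⟩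
  | ite v φ c d ih₁ ih₂ =>
    intro b hwf
    simp only [wf, Bool.and_eq_true, decide_eq_true_eq] at hwf
    obtain ⟨T, hT⟩ := φ.correct _ (φ.wf_mono hwf.1.2)
    obtain ⟨T₁, h₁⟩ := ih₁ b hwf.2.1
    obtain ⟨T₂, h₂⟩ := ih₂ b hwf.2.2
    refine ⟨T + (T₁ + T₂ + 1), fun n X s σ hs => ?_⟩
    simp only [Polynomial.eval_add, Polynomial.eval_one]
    refine Runs.seq (hT n X s) fun s' h => ?_
    have hs' : s'.Rep σ := ⟨(h.2.reg 0 (by omega) (by omega)).trans hs.1,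
      fun a ha => (h.2.decode ha).trans (hs.2 a ha)⟩
    have hev : φ.eval X (s.decode n) s.vars ↔ φ.eval X σ.2 (fun _ => 0) :=
      φ.eval_congr X hs.2 hwf.1.2 fun x hx hxv => absurd hx (by omega)
    have hreg : ∀ r, 4 ≤ r → r < 4 * b + 4 → s'.reg r = s.reg r := fun r hr hrb =>
      h.2.reg r (by omega) (by omega)
    refine Runs.ite (fun h' => ?_) fun h' => ?_
    · rw [Expr.eval, h.1, answer_ne_zero, hev] at h'
      refine (h₁ n X s' σ hs').mono le_rfl fun s'' h'' => ⟨?_, fun r hr hrb =>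
        (h''.2 r hr hrb).trans (hreg r hr hrb)⟩
      rw [run, if_pos h']
      exact h''.1
    · rw [Expr.eval, h.1, ← not_ne_iff, answer_ne_zero, hev] at h'
      refine (h₂ n X s' σ hs').mono le_rfl fun s'' h'' => ⟨?_, fun r hr hrb =>
        (h''.2 r hr hrb).trans (hreg r hr hrb)⟩
      rw [run, if_neg h']
      exact h''.1
  | rep v c ih =>
    intro b hwf
    simp only [wf, Bool.and_eq_true, decide_eq_true_eq] at hwf
    -- Well-formedness above `v` guarantees that the body restores the loop counter.
    obtain ⟨T, h⟩ := ih (v + 1) hwf.2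
    refine ⟨Polynomial.X * (T + 2) + 2, fun n X s σ hs => ?_⟩
    simp only [Polynomial.eval_add, Polynomial.eval_mul, Polynomial.eval_X, Polynomial.eval_ofNat]
    refine (Runs.forAll (fun i s' => s'.Rep ((c.run X)^[i] σ) ∧
      ∀ r, 4 ≤ r → r < 4 * b + 4 → s'.reg r = s.reg r) ⟨?_, fun r hr hrb => ?_⟩ ?_).mono le_rfl
      fun _ h => h
    · exact ⟨(Store.setReg_reg_of_ne (by omega) _).trans hs.1, hs.2⟩
    · rw [Store.setReg_reg_of_ne (by omega)]
    · intro i hi s' hs' hinv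
      refine (h n X s' _ hinv.1).mono le_rfl fun s'' h' => ⟨?_, ?_, fun r hr hrb => ?_⟩
      · rw [h'.2 _ (by omega) (by omega), hs']
      · rw [Function.iterate_succ_apply']
        exact ⟨(Store.setReg_reg_of_ne (by omega) _).trans h'.1.1, h'.1.2⟩
      · rw [Store.setReg_reg_of_ne (by omega), h'.2 r hr (by omega), hinv.2 r hr hrb]

end Cmd

/-! ### The formulas of the main algorithm -/

theorem exists_val_eq {n : ℕ} {j : Fin n} {p : Fin n → Prop} :
    (∃ i : Fin n, (i : ℕ) = j ∧ p i) ↔ p j := by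
  simp [← Fin.ext_iff]

theorem exists_val_eq₂ {n : ℕ} {i j : Fin n} {p : Fin n → Fin n → Prop} :
    (∃ i' j' : Fin n, (i' : ℕ) = i ∧ (j' : ℕ) = j ∧ p i' j') ↔ p i j := by
  simp [← Fin.ext_iff]

theorem StableInstance.levelH_lt_iff {E : Type*} [Finite E] {X : StableInstance E} {e f : E} :
    X.levelH e < X.levelH f ↔
      X.level .H e < X.level .H f ∨ X.level .H e ≤ X.level .H f ∧ e ∈ X.E1 ∧ f ∉ X.E1 := by
  by_cases he : e ∈ X.E1 <;> by_cases hf : f ∈ X.E1 <;> simp [levelH, he, hf] <;> omega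

theorem StableInstance.levelH_eq_iff {E : Type*} [Finite E] {X : StableInstance E} {e f : E} :
    X.levelH e = X.levelH f ↔ X.level .H e = X.level .H f ∧ (e ∈ X.E1 ↔ f ∈ X.E1) := by
  by_cases he : e ∈ X.E1 <;> by_cases hf : f ∈ X.E1 <;> simp [levelH, he, hf] <;> omega

namespace Form

def or (φ ψ : Form) : Form := neg (and (neg φ) (neg ψ))

/-- The variables differ. -/
def ne (x y : ℕ) : Form := or (lt x y) (lt y x)

/-- The level of `x` is smaller than that of `y`. -/
def less (S : Side) (x y : ℕ) : Form := neg (weak S y x)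

/-- The levels of `x` and `y` agree. -/
def tie (S : Side) (x y : ℕ) : Form := and (weak S x y) (weak S y x)

/-- `x` precedes `y` in the order of the layers of the side `H`. -/
def lessH (x y : ℕ) : Form :=
  or (less .H x y) (and (weak .H x y) (and (memE1 x) (neg (memE1 y))))

/-- `x` and `y` lie in the same layer of the side `H`. -/
def tieH (x y : ℕ) : Form :=
  and (tie .H x y)
    (and (neg (and (memE1 x) (neg (memE1 y)))) (neg (and (memE1 y) (neg (memE1 x)))))

/-- `x` lies in the closure of `{v | φ}` in the layered matroid of the side `D`. -/
def clD (v x : ℕ) (φ : Form) : Form := cl .D v (or (and (mem 2 v) (less .D v x)) (and φ (tie .D v x))) x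

/-- `x` lies in the closure of `{v | φ}` in the layered matroid of the side `H`. -/
def clH (v x : ℕ) (φ : Form) : Form := cl .H v (or (and (mem 2 v) (lessH v x)) (and φ (tieH v x))) x

section eval

variable {n : ℕ} {X : StableInstance (Fin n)} {A : ℕ → Set (Fin n)} {ρ : ℕ → ℕ} {φ ψ : Form}
  {S : Side} {a v x y : ℕ} {i j : Fin n}

@[simp] theorem eval_or : (or φ ψ).eval X A ρ ↔ φ.eval X A ρ ∨ ψ.eval X A ρ := by
  simp only [or, eval]; tauto

@[simp] theorem eval_neg : (neg φ).eval X A ρ ↔ ¬ φ.eval X A ρ := Iff.rfl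

@[simp] theorem eval_and : (and φ ψ).eval X A ρ ↔ φ.eval X A ρ ∧ ψ.eval X A ρ := Iff.rfl

@[simp] theorem eval_ex :
    (ex v φ).eval X A ρ ↔ ∃ i : Fin n, φ.eval X A (Function.update ρ v i) := Iff.rfl

theorem eval_mem (hx : ρ x = i) : (mem a x).eval X A ρ ↔ i ∈ A a := by
  rw [eval, hx, exists_val_eq]

theorem eval_memE1 (hx : ρ x = i) : (memE1 x).eval X A ρ ↔ i ∈ X.E1 := by
  rw [eval, hx, exists_val_eq]

theorem eval_weak (hx : ρ x = i) (hy : ρ y = j) :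
    (weak S x y).eval X A ρ ↔ X.level S i ≤ X.level S j := by
  rw [eval, hx, hy, exists_val_eq₂, X.level_le_iff]

theorem eval_lt (hx : ρ x = i) (hy : ρ y = j) : (lt x y).eval X A ρ ↔ i < j := by
  rw [eval, hx, hy, Fin.lt_def]

theorem eval_ne (hx : ρ x = i) (hy : ρ y = j) : (ne x y).eval X A ρ ↔ i ≠ j := by
  rw [ne, eval_or, eval_lt hx hy, eval_lt hy hx, ne_iff_lt_or_gt]

theorem eval_less (hx : ρ x = i) (hy : ρ y = j) :
    (less S x y).eval X A ρ ↔ X.level S i < X.level S j := by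
  rw [less, eval_neg, eval_weak hy hx, not_le]

theorem eval_tie (hx : ρ x = i) (hy : ρ y = j) :
    (tie S x y).eval X A ρ ↔ X.level S i = X.level S j := by
  rw [tie, eval_and, eval_weak hx hy, eval_weak hy hx, le_antisymm_iff]

theorem eval_lessH (hx : ρ x = i) (hy : ρ y = j) :
    (lessH x y).eval X A ρ ↔ X.levelH i < X.levelH j := by
  rw [lessH, eval_or, eval_less hx hy, eval_and, eval_weak hx hy, eval_and, eval_memE1 hx, eval_neg,
    eval_memE1 hy, X.levelH_lt_iff]

theorem eval_tieH (hx : ρ x = i) (hy : ρ y = j) :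
    (tieH x y).eval X A ρ ↔ X.levelH i = X.levelH j := by
  simp only [tieH, eval_and, eval_neg, eval_tie hx hy, eval_memE1 hx, eval_memE1 hy,
    X.levelH_eq_iff]
  tauto

theorem eval_cl (hx : ρ x = i) {Y : Set (Fin n)}
    (hφ : ∀ j : Fin n, φ.eval X A (Function.update ρ v j) ↔ j ∈ Y) :
    (cl S v φ x).eval X A ρ ↔ i ∈ (X.M S).closure Y := by
  rw [eval, hx, exists_val_eq]
  simp only [hφ, Set.ofPred_mem_eq]

/-- Set variable 2 holds K. By the layering criterion a closure in the layered matroid is a single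
closure query in the original one, so the minors need not be constructed. -/
theorem eval_clD (hx : ρ x = i) (hvx : x ≠ v) (hi : i ∈ A 2) {Y : Set (Fin n)} (hY : Y ⊆ A 2)
    (hφ : ∀ j : Fin n, φ.eval X A (Function.update ρ v j) ↔ j ∈ Y) :
    (clD v x φ).eval X A ρ ↔ i ∈ (X.matroidD (A 2)).closure Y := by
  rw [(X.isLayering_matroidD (A 2)).mem_closure_iff Y hY i hi]
  refine eval_cl hx fun j => ?_
  have hv : Function.update ρ v (j : ℕ) v = j := Function.update_self ..
  have hx' : Function.update ρ v (j : ℕ) x = i := by rw [Function.update_of_ne hvx, hx]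
  rw [eval_or, eval_and, eval_and, hφ, eval_mem hv, eval_less hv hx', eval_tie hv hx']
  rfl

theorem eval_clH (hx : ρ x = i) (hvx : x ≠ v) (hi : i ∈ A 2) {Y : Set (Fin n)} (hY : Y ⊆ A 2)
    (hφ : ∀ j : Fin n, φ.eval X A (Function.update ρ v j) ↔ j ∈ Y) :
    (clH v x φ).eval X A ρ ↔ i ∈ (X.matroidH (A 2)).closure Y := by
  rw [(X.isLayering_matroidH (A 2)).mem_closure_iff Y hY i hi]
  refine eval_cl hx fun j => ?_
  have hv : Function.update ρ v (j : ℕ) v = j := Function.update_self ..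
  have hx' : Function.update ρ v (j : ℕ) x = i := by rw [Function.update_of_ne hvx, hx]
  rw [eval_or, eval_and, eval_and, hφ, eval_mem hv, eval_lessH hv hx', eval_tieH hv hx']
  rfl

end eval

/-- `x` is not in the closure of `I` in the layered matroid of the side `H`. -/
def sink (v x : ℕ) : Form := neg (clH v x (mem 1 v))

/-- `I - y + x` is independent in the layered matroid of the side `D`. -/
def exchD (v x y : ℕ) : Form := neg (clD v x (and (mem 1 v) (ne v y)))

/-- `I - y + x` is independent in the layered matroid of the side `H`. -/
def exchH (v x y : ℕ) : Form := neg (clH v x (and (mem 1 v) (ne v y)))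

section eval

variable {n : ℕ} {X : StableInstance (Fin n)} {A : ℕ → Set (Fin n)} {ρ : ℕ → ℕ}
  {v x y : ℕ} {i j : Fin n} (hI : A 1 ⊆ A 2) (hi : i ∈ A 2)
include hI hi

theorem eval_sink (hx : ρ x = i) (hvx : x ≠ v) :
    (sink v x).eval X A ρ ↔ i ∉ (X.matroidH (A 2)).closure (A 1) := by
  rw [sink, eval_neg, eval_clH hx hvx hi hI fun j => eval_mem (Function.update_self ..)]

theorem eval_exchD (hx : ρ x = i) (hvx : x ≠ v) (hy : ρ y = j) (hvy : y ≠ v) :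
    (exchD v x y).eval X A ρ ↔ i ∉ (X.matroidD (A 2)).closure (A 1 \ {j}) := by
  rw [exchD, eval_neg, eval_clD hx hvx hi (Set.sdiff_subset.trans hI) fun k => ?_]
  rw [eval_and, eval_mem (Function.update_self ..),
    eval_ne (Function.update_self ..) ((Function.update_of_ne hvy _ _).trans hy)]
  rfl

theorem eval_exchH (hx : ρ x = i) (hvx : x ≠ v) (hy : ρ y = j) (hvy : y ≠ v) :
    (exchH v x y).eval X A ρ ↔ i ∉ (X.matroidH (A 2)).closure (A 1 \ {j}) := by
  rw [exchH, eval_neg, eval_clH hx hvx hi (Set.sdiff_subset.trans hI) fun k => ?_]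
  rw [eval_and, eval_mem (Function.update_self ..),
    eval_ne (Function.update_self ..) ((Function.update_of_ne hvy _ _).trans hy)]
  rfl

end eval

end Form

/-! ### Augmentation -/

namespace Cmd

open Form

/-- Keep the first element of the set variable `a` only. -/
def least (a : ℕ) : Cmd := set a 3 (and (mem a 3) (neg (ex 4 (and (mem a 4) (lt 4 3)))))

/-- The set variable `4` contains an element that is not in the closure of `I`. -/
def hasSink : Form := ex 3 (and (mem 4 3) (and (mem 2 3) (sink 4 3)))

/-- `x` is reached in one round from the set variable `4`. -/
def growForm : Form :=
  or (mem 4 3) (and (mem 2 3) (and (neg (mem 1 3)) (ex 4 (and (and (mem 4 4) (mem 2 4))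
    (ex 5 (and (mem 1 5) (and (exchH 6 4 5) (exchD 6 3 5))))))))

/-- Continue the search in the exchange graph by one round, unless an element of the last round is
not in the closure of `I`. -/
def scan : Cmd := ite 3 hasSink skip (seq (set 5 3 (mem 4 3)) (set 4 3 growForm))

/-- Search for a shortest path in the exchange graph. -/
def search : Cmd :=
  seq (set 4 3 (and (mem 2 3) (neg (clD 4 3 (mem 1 4)))))
    (seq (set 5 3 (lt 3 3)) (rep 2 scan))

/-- Select the last element `t` of a shortest path. -/
def target : Cmd := seq (set 6 3 (and (mem 4 3) (and (mem 2 3) (sink 4 3)))) (least 6)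

/-- Select an element of `I` that precedes `t` on a shortest path. -/
def remove : Cmd :=
  seq (set 7 3 (and (mem 1 3) (ex 4 (and (and (mem 6 4) (mem 2 4)) (and (exchD 5 4 3)
    (ex 5 (and (and (mem 5 5) (mem 2 5)) (exchH 6 5 3))))))))
    (least 7)

/-- Replace `I` by a larger set, or by one of the same size with a shorter path. -/
def augment : Cmd :=
  seq search (seq target (seq remove
    (set 1 3 (or (mem 6 3) (and (mem 1 3) (neg (mem 7 3)))))))

/-- Compute a maximum-size common independent set. -/
def intersect : Cmd :=
  seq (set 1 3 (lt 3 3))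
    -- There are 3n² augmentations, which covers the bound n(n + 1) + n on the potential.
    (seq (rep 0 (rep 1 (seq augment (seq augment augment))))
      -- This extra round leaves I unchanged; it leaves the saturated search in set variable 4, from
      -- which the cut is formed.
      (seq augment
        (set 8 3 (or (mem 4 3) (and (mem 1 3) (ex 4 (and (and (mem 4 4) (mem 2 4)) (exchH 5 4 3))))))))

variable {n : ℕ} {X : StableInstance (Fin n)} {σ : SetState n}

theorem run_least (a : ℕ) : (least a).run X σ = (σ.1, Function.update σ.2 a
    {x ∈ σ.2 a | ∀ y ∈ σ.2 a, x ≤ y}) := by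
  simp only [least, run]
  congr 2
  ext x
  have h3 : Function.update (fun _ => 0) 3 (x : ℕ) 3 = (x : ℕ) := Function.update_self ..
  simp only [Set.mem_ofPred_eq, eval_and, eval_neg, eval_ex, eval_mem h3]
  refine and_congr_right fun _ => ?_
  push Not
  refine forall_congr' fun y => ?_
  rw [eval_mem (i := y) (by simp), eval_lt (i := y) (j := x) (by simp) (by simp), not_lt]

theorem eval_hasSink {A : ℕ → Set (Fin n)} (hI : A 1 ⊆ A 2) (hL : A 4 ⊆ A 2) {ρ : ℕ → ℕ} :
    hasSink.eval X A ρ ↔ ¬ A 4 ⊆ (X.matroidH (A 2)).closure (A 1) := by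
  rw [Set.not_subset]
  refine exists_congr fun x => ?_
  have h3 : Function.update ρ 3 (x : ℕ) 3 = (x : ℕ) := Function.update_self ..
  rw [eval_and, eval_mem h3, eval_and, eval_mem h3]
  refine and_congr_right fun hx => ?_
  rw [eval_sink hI (hL hx) h3 (by decide)]
  exact and_iff_right (hL hx)

theorem eval_growForm {A : ℕ → Set (Fin n)} (hI : A 1 ⊆ A 2) (hL : A 4 ⊆ A 2) {ρ : ℕ → ℕ}
    {x : Fin n} : growForm.eval X A (Function.update ρ 3 x) ↔
      x ∈ (X.matroidD (A 2)).grow (X.matroidH (A 2)) (A 1) (A 4) := by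
  have h3 : Function.update ρ 3 (x : ℕ) 3 = (x : ℕ) := Function.update_self ..
  simp only [growForm, eval_or, eval_and, eval_neg, eval_ex, eval_mem h3, Matroid.grow,
    X.matroidD_ground]
  refine or_congr Iff.rfl (and_congr_right fun hx => and_congr_right fun _ =>
    exists_congr fun e => ?_)
  rw [eval_mem (i := e) (by simp), eval_mem (i := e) (by simp), and_assoc]
  refine and_congr_right fun he => ?_
  rw [and_iff_right (hL he)]
  refine exists_congr fun f => ?_
  rw [eval_mem (i := f) (by simp), eval_exchH hI (hL he) (j := f) (by simp) (by decide) (by simp)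
    (by decide), eval_exchD hI hx (j := f) (by simp) (by decide) (by simp) (by decide)]

/-! ### Simulation of the search and of the augmentations. -/

section search

variable (hI : σ.2 1 ⊆ σ.2 2)
include hI

theorem run_sources : (set 4 3 (and (mem 2 3) (neg (clD 4 3 (mem 1 4))))).run X σ =
    (σ.1, Function.update σ.2 4 ((X.matroidD (σ.2 2)).sources (σ.2 1))) := by
  simp only [run]
  congr 2
  ext x
  have h3 : Function.update (fun _ => 0) 3 (x : ℕ) 3 = (x : ℕ) := Function.update_self ..
  simp only [Set.mem_ofPred_eq, eval_and, eval_neg, eval_mem h3, Matroid.sources,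
    X.matroidD_ground]
  refine and_congr_right fun hx => ?_
  rw [eval_clD (i := x) (by simp) (by decide) hx hI fun j => eval_mem (by simp)]

theorem run_scan (hL : σ.2 4 ⊆ σ.2 2) : scan.run X σ =
    open Classical in
    if σ.2 4 ⊆ (X.matroidH (σ.2 2)).closure (σ.2 1) then
      (σ.1, Function.update (Function.update σ.2 5 (σ.2 4)) 4
        ((X.matroidD (σ.2 2)).grow (X.matroidH (σ.2 2)) (σ.2 1) (σ.2 4)))
    else σ := by
  have h5 : {j : Fin n | (mem 4 3).eval X σ.2 (Function.update (fun _ => 0) 3 j)} = σ.2 4 := by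
    ext j
    exact eval_mem (X := X) (Function.update_self ..)
  simp only [scan, run, h5]
  by_cases h : σ.2 4 ⊆ (X.matroidH (σ.2 2)).closure (σ.2 1)
  · rw [if_pos h, if_neg (by rwa [eval_hasSink hI hL, not_not])]
    congr 2
    ext x
    rw [Set.mem_ofPred_eq, eval_growForm]
    · simp [Function.update_of_ne]
    · simpa [Function.update_of_ne] using hI
    · simpa [Function.update_of_ne] using hL
  · rw [if_neg h, if_pos (by rwa [eval_hasSink hI hL])]

/-- Here k is the first round that contains a sink, or n if there is none before. Keeping also the
previous round in variable 5 gives the candidates for the predecessor of the sink, so no path needs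
to be stored. -/
theorem run_search : ∃ k ≤ n, (∀ a < 4, (search.run X σ).2 a = σ.2 a) ∧
    (search.run X σ).2 4 = (X.matroidD (σ.2 2)).reach (X.matroidH (σ.2 2)) (σ.2 1) k ∧
    (k = 0 → (search.run X σ).2 5 = ∅) ∧
    (∀ i, k = i + 1 →
      (search.run X σ).2 5 = (X.matroidD (σ.2 2)).reach (X.matroidH (σ.2 2)) (σ.2 1) i) ∧
    (∀ i < k, (X.matroidD (σ.2 2)).reach (X.matroidH (σ.2 2)) (σ.2 1) i ⊆
      (X.matroidH (σ.2 2)).closure (σ.2 1)) ∧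
    (k < n → ¬ (X.matroidD (σ.2 2)).reach (X.matroidH (σ.2 2)) (σ.2 1) k ⊆
      (X.matroidH (σ.2 2)).closure (σ.2 1)) := by
  set M := X.matroidD (σ.2 2) with hM
  set N := X.matroidH (σ.2 2) with hN
  set σ₀ := (set 5 3 (lt 3 3)).run X
    ((set 4 3 (and (mem 2 3) (neg (clD 4 3 (mem 1 4))))).run X σ) with hσ₀
  have hσ₀' : σ₀ = (σ.1, Function.update (Function.update σ.2 4 (M.sources (σ.2 1))) 5 ∅) := by
    rw [hσ₀, run_sources hI]
    simp only [run]
    congr 2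
    ext x
    simp [eval]
  have key : ∀ m, ∃ k ≤ m, (∀ a < 4, ((scan.run X)^[m] σ₀).2 a = σ.2 a) ∧
      (((scan.run X)^[m] σ₀).2 4 = M.reach N (σ.2 1) k) ∧
      (k = 0 → ((scan.run X)^[m] σ₀).2 5 = ∅) ∧
      (∀ i, k = i + 1 → ((scan.run X)^[m] σ₀).2 5 = M.reach N (σ.2 1) i) ∧
      (∀ i < k, M.reach N (σ.2 1) i ⊆ N.closure (σ.2 1)) ∧
      (k < m → ¬ M.reach N (σ.2 1) k ⊆ N.closure (σ.2 1)) := by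
    intro m
    induction m with
    | zero =>
      refine ⟨0, le_rfl, fun a ha => ?_, ?_, ?_, by simp, by simp, by simp⟩
      · simp only [Function.iterate_zero, id, hσ₀']
        rw [Function.update_of_ne (by omega), Function.update_of_ne (by omega)]
      · simp [hσ₀', Matroid.reach]
      · simp [hσ₀']
    | succ m ih =>
      obtain ⟨k, hkm, h1, h2, h3, h4, h5, h6⟩ := ih
      rw [Function.iterate_succ_apply']
      set τ := (scan.run X)^[m] σ₀
      have hL : M.reach N (σ.2 1) k ⊆ σ.2 2 :=
        (Matroid.reach_subset k).trans (Set.sdiff_subset.trans (X.matroidD_ground _).subset)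
      rw [run_scan (by rwa [h1 1 (by omega), h1 2 (by omega)])
        (by rwa [h2, h1 2 (by omega)]), h1 1 (by omega), h1 2 (by omega), h2]
      by_cases hs : M.reach N (σ.2 1) k ⊆ N.closure (σ.2 1)
      · have hk : k = m := by
          by_contra hne
          exact h6 (by omega) hs
        rw [if_pos hs]
        subst hk
        refine ⟨k + 1, le_rfl, fun a ha => ?_, ?_, by simp, fun i hi => ?_, fun i hi => ?_,
          by simp⟩
        · simp only
          rw [Function.update_of_ne (by omega), Function.update_of_ne (by omega), h1 a ha]
        · simp [Matroid.reach_succ, hM, hN]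
        · obtain rfl : k = i := by omega
          simp
        · rcases Nat.lt_succ_iff_lt_or_eq.1 hi with hi | rfl
          · exact h5 i hi
          · exact hs
      · rw [if_neg hs]
        exact ⟨k, by omega, h1, h2, h3, h4, h5, fun _ => hs⟩
  exact key n

theorem run_target (hL : σ.2 4 ⊆ σ.2 2) : target.run X σ = (σ.1, Function.update σ.2 6
    {x ∈ σ.2 4 \ (X.matroidH (σ.2 2)).closure (σ.2 1) |
      ∀ y ∈ σ.2 4 \ (X.matroidH (σ.2 2)).closure (σ.2 1), x ≤ y}) := by
  have h : {x : Fin n | (and (mem 4 3) (and (mem 2 3) (sink 4 3))).eval X σ.2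
      (Function.update (fun _ => 0) 3 x)} = σ.2 4 \ (X.matroidH (σ.2 2)).closure (σ.2 1) := by
    ext x
    have h3 : Function.update (fun _ => 0) 3 (x : ℕ) 3 = (x : ℕ) := Function.update_self ..
    simp only [Set.mem_ofPred_eq, eval_and, eval_mem h3]
    refine and_congr_right fun hx => ?_
    rw [eval_sink hI (hL hx) h3 (by decide), and_iff_right (hL hx)]
  simp only [target, run, h, run_least, Function.update_idem, Function.update_self]

theorem run_remove (hL : σ.2 5 ⊆ σ.2 2) (hT : σ.2 6 ⊆ σ.2 2) : ∃ F : Set (Fin n),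
    F = {f ∈ σ.2 1 | ∃ t ∈ σ.2 6, t ∉ (X.matroidD (σ.2 2)).closure (σ.2 1 \ {f}) ∧
      ∃ e ∈ σ.2 5, e ∉ (X.matroidH (σ.2 2)).closure (σ.2 1 \ {f})} ∧
    remove.run X σ = (σ.1, Function.update σ.2 7 {x ∈ F | ∀ y ∈ F, x ≤ y}) := by
  refine ⟨_, rfl, ?_⟩
  simp only [remove, run, run_least, Function.update_idem, Function.update_self]
  congr 2
  have h : {f : Fin n | (and (mem 1 3) (ex 4 (and (and (mem 6 4) (mem 2 4)) (and (exchD 5 4 3)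
      (ex 5 (and (and (mem 5 5) (mem 2 5)) (exchH 6 5 3))))))).eval X σ.2
      (Function.update (fun _ => 0) 3 f)} =
      {f ∈ σ.2 1 | ∃ t ∈ σ.2 6, t ∉ (X.matroidD (σ.2 2)).closure (σ.2 1 \ {f}) ∧
      ∃ e ∈ σ.2 5, e ∉ (X.matroidH (σ.2 2)).closure (σ.2 1 \ {f})} := by
    ext f
    have h3 : Function.update (fun _ => 0) 3 (f : ℕ) 3 = (f : ℕ) := Function.update_self ..
    simp only [Set.mem_ofPred_eq, eval_and, eval_ex, eval_mem h3]
    refine and_congr_right fun hf => exists_congr fun t => ?_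
    rw [eval_mem (i := t) (by simp), eval_mem (i := t) (by simp), and_assoc]
    refine and_congr_right fun ht => ?_
    rw [and_iff_right (hT ht),
      eval_exchD hI (hT ht) (j := f) (by simp) (by decide) (by simp) (by decide)]
    refine and_congr_right fun _ => exists_congr fun e => ?_
    rw [eval_mem (i := e) (by simp), eval_mem (i := e) (by simp), and_assoc]
    refine and_congr_right fun he => ?_
    rw [and_iff_right (hL he),
      eval_exchH hI (hL he) (j := f) (by simp) (by decide) (by simp) (by decide)]
  rw [h]

omit hI in
theorem least_eq (F : Set (Fin n)) : F = ∅ ∧ {x ∈ F | ∀ y ∈ F, x ≤ y} = ∅ ∨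
    ∃ x ∈ F, {x ∈ F | ∀ y ∈ F, x ≤ y} = {x} := by
  rcases F.eq_empty_or_nonempty with rfl | hF
  · simp
  · obtain ⟨x, hx, hmin⟩ := (Set.toFinite F).exists_minimalFor id F hF
    refine Or.inr ⟨x, hx, ?_⟩
    have hle : ∀ y ∈ F, x ≤ y := fun y hy => (le_total x y).elim id (hmin hy)
    ext y
    refine ⟨fun hy => le_antisymm (hy.2 x hx) (hle y hy.1), ?_⟩
    rintro rfl
    exact ⟨hx, hle⟩

omit hI in
-- Three outcomes: no sink is reached and I is optimal; a source is a sink and I grows; or one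
-- exchange keeps the size and leaves a sink reachable in fewer rounds than any was before.
theorem run_augment (hM : (X.matroidD (σ.2 2)).Indep (σ.2 1))
    (hN : (X.matroidH (σ.2 2)).Indep (σ.2 1)) :
    ∃ M N I, M = X.matroidD (σ.2 2) ∧ N = X.matroidH (σ.2 2) ∧ I = (augment.run X σ).2 1 ∧
    (augment.run X σ).2 0 = σ.2 0 ∧ (augment.run X σ).2 2 = σ.2 2 ∧
    (M.reach N (σ.2 1) n ⊆ N.closure (σ.2 1) ∧ I = σ.2 1 ∧
        (augment.run X σ).2 4 = M.reach N (σ.2 1) n ∨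
      ¬ M.reach N (σ.2 1) n ⊆ N.closure (σ.2 1) ∧ M.Indep I ∧ N.Indep I ∧
        (I.ncard = (σ.2 1).ncard + 1 ∨ I.ncard = (σ.2 1).ncard ∧ ∃ k < n,
          (∀ i ≤ k, M.reach N (σ.2 1) i ⊆ N.closure (σ.2 1)) ∧
            ¬ M.reach N I k ⊆ N.closure I)) := by
  refine ⟨_, _, _, rfl, rfl, rfl, ?_⟩
  have hI : σ.2 1 ⊆ σ.2 2 := X.subset_of_indep_D hM
  obtain ⟨k, hkn, h1, h2, h3, h4, h5, h6⟩ := run_search (X := X) hI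
  set M := X.matroidD (σ.2 2) with hMdef
  set N := X.matroidH (σ.2 2) with hNdef
  set τ := search.run X σ with hτ
  have hE : N.E = M.E := by rw [hMdef, hNdef, X.matroidD_ground, X.matroidH_ground]
  have hreach : ∀ i, M.reach N (σ.2 1) i ⊆ σ.2 2 := fun i =>
    (Matroid.reach_subset i).trans (Set.sdiff_subset.trans (X.matroidD_ground _).subset)
  have hE₁ := h1 1 (by omega)
  have hE₂ := h1 2 (by omega)
  obtain ⟨T, hT⟩ : ∃ T, T = {x ∈ M.reach N (σ.2 1) k \ N.closure (σ.2 1) |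
    ∀ y ∈ M.reach N (σ.2 1) k \ N.closure (σ.2 1), x ≤ y} := ⟨_, rfl⟩
  have ht := run_target (X := X) (σ := τ) (by rwa [hE₁, hE₂]) (by rw [h2, hE₂]; exact hreach k)
  rw [hE₁, hE₂, h2, ← hNdef, ← hT] at ht
  have hL5 : τ.2 5 ⊆ σ.2 2 := by
    rcases k with _ | i
    · rw [h3 rfl]; exact Set.empty_subset _
    · rw [h4 i rfl]; exact hreach i
  have hTK : T ⊆ σ.2 2 := by
    rw [hT]
    exact fun x hx => hreach k hx.1.1
  obtain ⟨F, hF, hr⟩ := run_remove (X := X) (σ := target.run X τ) (by simpa [ht, hE₁, hE₂] using hI)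
    (by simpa [ht, hE₂] using hL5) (by simpa [ht, hE₂] using hTK)
  rw [ht] at hF hr
  simp only [Function.update_self, ne_eq, Nat.reduceEqDiff, not_false_eq_true, Function.update_of_ne,
    hE₁, hE₂, ← hMdef, ← hNdef] at hF hr
  obtain ⟨F', hF'⟩ : ∃ F', F' = {x ∈ F | ∀ y ∈ F, x ≤ y} := ⟨_, rfl⟩
  rw [← hF'] at hr
  have haug : augment.run X σ = (τ.1, Function.update (Function.update (Function.update τ.2 6 T) 7 F')
      1 (T ∪ σ.2 1 \ F')) := by
    have : augment.run X σ = (set 1 3 (or (mem 6 3) (and (mem 1 3) (neg (mem 7 3))))).run X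
      (remove.run X (target.run X τ)) := rfl
    rw [this, ht, hr]
    simp only [run]
    congr 2
    ext x
    have h3 : Function.update (fun _ => 0) 3 (x : ℕ) 3 = (x : ℕ) := Function.update_self ..
    simp [eval_mem h3, hE₁]
  have ha1 : (augment.run X σ).2 1 = T ∪ σ.2 1 \ F' := by simp [haug]
  have ha4 : (augment.run X σ).2 4 = M.reach N (σ.2 1) k := by simp [haug, h2]
  refine ⟨by simp [haug, h1 0], by simp [haug, hE₂], ?_⟩
  rw [ha1, ha4]
  rcases least_eq (M.reach N (σ.2 1) k \ N.closure (σ.2 1)) with ⟨h, hT'⟩ | ⟨t, ht, hT'⟩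
  · left
    rw [← hT] at hT'
    have hs := Set.sdiff_eq_empty.1 h
    obtain rfl : k = n := by
      by_contra hne
      exact h6 (by omega) hs
    have hFe : F = ∅ := by
      rw [hF, hT']
      simp
    have hFe' : F' = ∅ := by
      rw [hF', hFe]
      simp
    exact ⟨hs, by simp [hT', hFe'], rfl⟩
  · right
    rw [← hT] at hT'
    have htE : t ∈ M.E := (Matroid.reach_subset k ht.1).1
    have htI : t ∉ σ.2 1 := (Matroid.reach_subset k ht.1).2
    refine ⟨fun h => ht.2 (h (Matroid.reach_mono hkn ht.1)), ?_⟩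
    rcases k with _ | k
    -- At distance zero the previous round is stored as empty, so nothing is removed and the command
    -- is a plain insertion.
    · have hFe : F = ∅ := by
        rw [hF, h3 rfl]
        simp
      have hFe' : F' = ∅ := by
        rw [hF', hFe]
        simp
      rw [hFe', hT', Set.sdiff_empty, Set.singleton_union]
      obtain ⟨-, h1, h2⟩ := Matroid.insert_indep_of_mem_sources hE hM hN ht.1 ht.2
      exact ⟨h1, h2, Or.inl (Set.ncard_insert_of_notMem htI (Set.toFinite _))⟩
    · have htk : t ∉ M.reach N (σ.2 1) k := fun h => ht.2 (h5 k (by omega) h)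
      have hL := h4 k rfl
      rw [hL, hT'] at hF
      simp only [Set.mem_singleton_iff, exists_eq_left] at hF
      have hne : F.Nonempty := by
        have := ht.1
        rw [Matroid.reach_succ] at this
        obtain ⟨-, -, e, he, f, hf, h, h'⟩ := this.resolve_left htk
        exact ⟨f, hF ▸ ⟨hf, h', e, he, h⟩⟩
      rcases least_eq F with ⟨h, -⟩ | ⟨f, hf, h⟩
      · exact absurd h hne.ne_empty
      rw [← hF'] at h
      rw [hF] at hf
      obtain ⟨hfI, htf, e, he, hef⟩ := hf
      rw [h, hT', Set.singleton_union]
      obtain ⟨h1, h2, h3, h4⟩ := Matroid.exchange hE hM hN (h5 k (by omega)) htE htk ht.2 hfI he hef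
        htf
      refine ⟨h1, h2, Or.inr ⟨?_, k, by omega, fun i hi => h5 i (by omega), fun h => h4 (h h3)⟩⟩
      exact Set.ncard_exchange htI hfI

end search

/-- Size and distance are combined lexicographically: one more element outweighs any change of the
distance, which contributes at most n, and otherwise the distance drops. -/
theorem run_augment_iterate {K P : Set (Fin n)} {m : ℕ} (hm : n * (n + 1) + n ≤ m)
    (h2 : σ.2 2 = K) (h0 : σ.2 0 = P) (hM : (X.matroidD K).Indep (σ.2 1))
    (hN : (X.matroidH K).Indep (σ.2 1)) {τ : SetState n} (hτ : τ = (augment.run X)^[m] σ) :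
    τ.2 0 = P ∧ τ.2 2 = K ∧ (X.matroidD K).Indep (τ.2 1) ∧ (X.matroidH K).Indep (τ.2 1) ∧
      (X.matroidD K).reach (X.matroidH K) (τ.2 1) n ⊆ (X.matroidH K).closure (τ.2 1) := by
  subst hτ
  set M := X.matroidD K with hMdef
  set N := X.matroidH K with hNdef
  -- The value is 0 when no sink is ever reached. This is harmless, since distances are compared
  -- only where a sink exists.
  let dist (I : Set (Fin n)) : ℕ := sInf {k | ¬ M.reach N I k ⊆ N.closure I}
  have := Function.terminal_iterate (f := augment.run X)
    (fun τ => (τ.2 1).ncard * (n + 1) + (n - dist (τ.2 1)))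
    (Inv := fun τ => τ.2 0 = P ∧ τ.2 2 = K ∧ M.Indep (τ.2 1) ∧ N.Indep (τ.2 1))
    (T := fun τ => M.reach N (τ.2 1) n ⊆ N.closure (τ.2 1)) ?_ ?_ ?_ ?_ hm (a := σ)
    ⟨h0, h2, hM, hN⟩
  · exact ⟨this.1.1, this.1.2.1, this.1.2.2.1, this.1.2.2.2, this.2⟩
  · rintro τ ⟨h0, h2, hM, hN⟩
    rw [hMdef, ← h2] at hM
    rw [hNdef, ← h2] at hN
    obtain ⟨M', N', I, rfl, rfl, rfl, h0', h2', h⟩ := run_augment hM hN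
    rw [h2, ← hMdef, ← hNdef] at h
    refine ⟨h0'.trans h0, h2'.trans h2, ?_⟩
    rw [h2] at hM hN
    rcases h with h | h
    · rw [h.2.1]
      exact ⟨hM, hN⟩
    · exact ⟨h.2.1, h.2.2.1⟩
  · intro τ _
    have h : (τ.2 1).ncard ≤ n := (Set.ncard_le_card _).trans (by simp)
    have := Nat.mul_le_mul_right (n + 1) h
    omega
  · rintro τ ⟨h0, h2, hM, hN⟩ hT
    rw [hMdef, ← h2] at hM
    rw [hNdef, ← h2] at hN
    obtain ⟨M', N', I, rfl, rfl, rfl, -, -, h⟩ := run_augment hM hN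
    rw [h2, ← hMdef, ← hNdef] at h
    rcases h with h | h
    · rw [h.2.1]
      exact hT
    · exact absurd hT h.1
  · rintro τ ⟨h0, h2, hM, hN⟩ hT
    rw [hMdef, ← h2] at hM
    rw [hNdef, ← h2] at hN
    obtain ⟨M', N', I, rfl, rfl, rfl, -, -, h⟩ := run_augment hM hN
    rw [h2, ← hMdef, ← hNdef] at h
    rcases h with h | ⟨-, -, -, h | ⟨h, k, hk, hlow, hex⟩⟩
    · exact absurd h.1 hT
    · rw [h]
      have := Nat.sub_le n (dist (τ.2 1))
      rw [Nat.succ_mul]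
      omega
    · rw [h]
      have h1 : dist ((augment.run X τ).2 1) ≤ k := Nat.sInf_le hex
      have h2 : k < dist (τ.2 1) := by
        by_contra hle
        exact Nat.sInf_mem (s := {k | ¬ M.reach N (τ.2 1) k ⊆ N.closure (τ.2 1)}) ⟨n, hT⟩
          (hlow _ (not_lt.1 hle))
      omega

theorem run_intersect {K P : Set (Fin n)} (h2 : σ.2 2 = K) (h0 : σ.2 0 = P) {τ : SetState n}
    (hτ : τ = intersect.run X σ) : τ.2 0 = P ∧
      IsMaxCommonIndep (X.matroidD K) (X.matroidH K) (τ.2 1) ∧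
      IsCriticalSubset (X.matroidD K) (X.matroidH K) (τ.2 8) := by
  set M := X.matroidD K with hM
  set N := X.matroidH K with hN
  have hE : N.E = M.E := by rw [hM, hN, X.matroidD_ground, X.matroidH_ground]
  obtain ⟨σ₁, hσ₁⟩ : ∃ σ₁, σ₁ = (set 1 3 (lt 3 3)).run X σ := ⟨_, rfl⟩
  obtain ⟨σ₂, hσ₂⟩ : ∃ σ₂, σ₂ = (rep 0 (rep 1 (seq augment (seq augment augment)))).run X σ₁ :=
    ⟨_, rfl⟩
  obtain ⟨σ₃, hσ₃⟩ : ∃ σ₃, σ₃ = augment.run X σ₂ := ⟨_, rfl⟩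
  have hσ₁' : σ₁ = (σ.1, Function.update σ.2 1 ∅) := by
    rw [hσ₁]
    simp only [run]
    congr 2
    ext x
    simp [eval]
  have hit : σ₂ = (augment.run X)^[3 * n * n] σ₁ := by
    rw [hσ₂, Function.iterate_mul, Function.iterate_mul]
    rfl
  obtain ⟨g0, g2, gM, gN, gs⟩ := run_augment_iterate (X := X) (K := K) (P := P) (m := 3 * n * n)
    (by nlinarith [Nat.le_mul_self n]) (by simpa [hσ₁'] using h2)
    (by simpa [hσ₁'] using h0) (by simp [hσ₁']) (by simp [hσ₁']) hit
  rw [← g2] at gM gN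
  obtain ⟨M', N', I, rfl, rfl, rfl, h0', h2', h⟩ := run_augment gM gN
  rw [g2, ← hM, ← hN, ← hσ₃] at h
  rw [g2] at gM gN
  obtain ⟨-, h1', h4'⟩ := h.resolve_right fun h => h.1 gs
  rw [← hσ₃] at h0' h2'
  rw [g2] at h2'
  have hreach : ∀ i, M.reach N (σ₂.2 1) i ⊆ K := fun i =>
    (Matroid.reach_subset i).trans (Set.sdiff_subset.trans (X.matroidD_ground _).subset)
  have hIK : σ₂.2 1 ⊆ K := X.subset_of_indep_D gM
  have hτ' : τ = (σ₃.1, Function.update σ₃.2 8 (N.cut (σ₂.2 1) (M.reach N (σ₂.2 1) n))) := by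
    have : τ = (set 8 3 (or (mem 4 3) (and (mem 1 3)
      (ex 4 (and (and (mem 4 4) (mem 2 4)) (exchH 5 4 3)))))).run X σ₃ := by
      rw [hσ₃, hσ₂, hσ₁]; exact hτ
    rw [this]
    simp only [run]
    congr 2
    ext f
    have h3 : Function.update (fun _ => 0) 3 (f : ℕ) 3 = (f : ℕ) := Function.update_self ..
    simp only [Set.mem_ofPred_eq, eval_or, eval_and, eval_ex, eval_mem h3, h4', h1', Matroid.cut,
      Set.mem_union]
    refine or_congr Iff.rfl (and_congr_right fun hf => exists_congr fun e => ?_)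
    rw [eval_mem (i := e) (by simp), eval_mem (i := e) (by simp), and_assoc, h4', h2']
    refine and_congr_right fun he => ?_
    rw [and_iff_right (hreach _ he), eval_exchH (i := e) (j := f) (by rwa [h1', h2'])
      (by rw [h2']; exact hreach _ he) (by simp) (by decide) (by simp) (by decide), h1', h2']
  have hc : Nat.card (Fin n) = n := by simp
  have := Matroid.isCriticalSubset_cut hE gM gN (by rwa [hc])
  rw [hc] at this
  have e0 : τ.2 0 = P := by simp [hτ', h0', g0]
  have e1 : τ.2 1 = σ₂.2 1 := by simp [hτ', h1']
  have e8 : τ.2 8 = N.cut (σ₂.2 1) (M.reach N (σ₂.2 1) n) := by simp [hτ']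
  rw [e0, e1, e8]
  exact ⟨rfl, this.2⟩

/-- Membership of `x` in the greedy basis of the complement of `P` in `M .D`. -/
def basisD (v x : ℕ) : Form :=
  and (neg (mem 0 x)) (neg (cl .D v (and (neg (mem 0 v)) (lt v x)) x))

/-- Membership of `x` in the greedy basis of `K` in `M .H`. -/
def basisH (v x : ℕ) : Form := and (mem 2 x) (neg (cl .H v (and (mem 2 v) (lt v x)) x))

/-- Compute `K`, and a base `Q` of its layered matroid of the side `H`. -/
def choose : Cmd :=
  seq (set 2 3 (and (neg (mem 0 3)) (neg (cl .D 4 (and (neg (mem 0 4)) (less .D 4 3)) 3))))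
    (set 3 3 (and (mem 2 3) (neg (clH 4 3 (and (mem 2 4) (lt 4 3))))))

/-- One iteration of the inner loop. -/
def inner : Cmd :=
  -- Ranks are compared as sizes of greedy bases.
  seq choose (ite 3 (cardLt 3 (basisD 4 3) (basisH 4 3)) (kind 3)
    (ite 3 (ex 3 (and (mem 2 3) (and (memE1 3) (neg (mem 3 3)))))
      (seq (set 0 3 (or (mem 0 3) (and (mem 2 3) (and (memE1 3) (neg (mem 3 3)))))) (kind 0))
      (seq intersect (ite 3 (cardLt 3 (mem 1 3) (basisD 4 3))
        (ite 3 (ex 3 (and (mem 8 3) (neg (mem 0 3))))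
          (seq (set 0 3 (or (mem 0 3) (mem 8 3))) (kind 0)) (kind 1)) (kind 1)))))

/-- `x` weakly blocks `I`. -/
def weakBlock (S : Side) (v x : ℕ) : Form := neg (cl S v (and (mem 1 v) (less S v x)) x)

/-- `x` strongly blocks `I`. -/
def strongBlock (S : Side) (v x : ℕ) : Form := neg (cl S v (and (mem 1 v) (weak S v x)) x)

/-- `x` is an element of `P` that lies in `block I`. -/
def blockForm (v x : ℕ) : Form :=
  and (and (mem 0 x) (and (neg (mem 1 x)) (cl .H v (mem 1 v) x)))
    (and (and (weakBlock .D v x) (weakBlock .H v x))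
      (or (memE1 x) (or (strongBlock .D v x) (strongBlock .H v x))))

/-- `y` belongs to the fundamental circuit of `x` and `I`. -/
def circuitForm (v x y : ℕ) : Form :=
  or (neg (ne y x)) (and (mem 1 y) (neg (cl .H v (and (mem 1 v) (ne v y)) x)))

/-- The step after the inner loop. -/
def outer : Cmd :=
  -- Variable 2 now holds the chosen b as a set with at most one element. If nothing blocks, it is
  -- empty and R comes out as P, so both cases share the code.
  seq (set 2 3 (blockForm 4 3)) (seq (least 2)
    (seq (set 3 3 (or (mem 0 3) (ex 4 (and (mem 2 4) (and (circuitForm 5 4 3)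
      (neg (ex 5 (and (circuitForm 6 4 5) (neg (weak .H 5 3))))))))))
      (ite 3 (ex 3 (and (mem 3 3) (neg (mem 0 3))))
        (seq (set 0 3 (mem 3 3)) (kind 0)) (kind 2))))

/-- The step that determines the output. -/
def final : Cmd :=
  -- An element of I trivially keeps I independent but is in its closure, hence the separate
  -- membership test.
  ite 3 (ex 3 (and (mem 0 3) (or (mem 1 3) (neg (cl .H 4 (mem 1 4) 3))))) (kind 3) (kind 4)

/-- The initialization. -/
def setup : Cmd := seq (set 0 3 (lt 3 3)) (kind 0)

theorem wf_inner : inner.wf 0 = true := by decide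
theorem wf_outer : outer.wf 0 = true := by decide
theorem wf_final : final.wf 0 = true := by decide
theorem wf_setup : setup.wf 0 = true := by decide

/-! ### Simulation of the steps of the main algorithm. -/

variable {P I : Set (Fin n)}

/-- The state `σ` represents the configuration `c`. -/
def Describes (σ : SetState n) : Config (Fin n) → Prop
  | .inner P => σ.1 = 0 ∧ σ.2 0 = P
  | .outer P I => σ.1 = 1 ∧ σ.2 0 = P ∧ σ.2 1 = I
  | .final R I => σ.1 = 2 ∧ σ.2 0 = R ∧ σ.2 1 = I
  | .no => σ.1 = 3
  | .found I => σ.1 = 4 ∧ σ.2 1 = I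

theorem ncard_basisD : ({x : Fin n | (basisD 4 3).eval X σ.2
    (Function.update (fun _ => 0) 3 x)}.ncard : ℕ∞) = (X.M .D).eRk (σ.2 0)ᶜ := by
  have h := (X.M .D).isBasis_greedy (X.subset_ground .D (σ.2 0)ᶜ) (Fin.val_injective (n := n))
  rw [Set.Finite.cast_ncard_eq (Set.toFinite _), ← h.encard_eq_eRk]
  congr 1
  ext x
  have h3 : Function.update (fun _ => 0) 3 (x : ℕ) 3 = (x : ℕ) := Function.update_self ..
  simp only [Set.mem_ofPred_eq, basisD, eval_and, eval_neg, eval_mem h3]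
  refine and_congr_right fun hx => not_congr (eval_cl h3 fun y => ?_)
  rw [eval_and, eval_neg, eval_mem (i := y) (by simp), eval_lt (i := y) (j := x) (by simp) (by simp)]
  rfl

theorem ncard_basisH : ({x : Fin n | (basisH 4 3).eval X σ.2
    (Function.update (fun _ => 0) 3 x)}.ncard : ℕ∞) = (X.M .H).eRk (σ.2 2) := by
  have h := (X.M .H).isBasis_greedy (X.subset_ground .H (σ.2 2)) (Fin.val_injective (n := n))
  rw [Set.Finite.cast_ncard_eq (Set.toFinite _), ← h.encard_eq_eRk]
  congr 1
  ext x
  have h3 : Function.update (fun _ => 0) 3 (x : ℕ) 3 = (x : ℕ) := Function.update_self ..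
  simp only [Set.mem_ofPred_eq, basisH, eval_and, eval_neg, eval_mem h3]
  refine and_congr_right fun hx => not_congr (eval_cl h3 fun y => ?_)
  rw [eval_and, eval_mem (i := y) (by simp), eval_lt (i := y) (j := x) (by simp) (by simp)]
  rfl

theorem run_choose : ∃ τ, τ = choose.run X σ ∧ τ.2 0 = σ.2 0 ∧ τ.2 2 = X.choiceD (σ.2 0)ᶜ ∧
    (X.matroidH (X.choiceD (σ.2 0)ᶜ)).IsBase (τ.2 3) := by
  obtain ⟨σ₁, hσ₁⟩ : ∃ σ₁, σ₁ = (set 2 3 (and (neg (mem 0 3))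
    (neg (cl .D 4 (and (neg (mem 0 4)) (less .D 4 3)) 3)))).run X σ := ⟨_, rfl⟩
  have h₁ : σ₁ = (σ.1, Function.update σ.2 2 (X.choiceD (σ.2 0)ᶜ)) := by
    rw [hσ₁]
    simp only [run]
    congr 2
    ext x
    have h3 : Function.update (fun _ => 0) 3 (x : ℕ) 3 = (x : ℕ) := Function.update_self ..
    rw [X.mem_choiceD]
    simp only [Set.mem_ofPred_eq, eval_and, eval_neg, eval_mem h3]
    refine and_congr_right fun hx => not_congr (eval_cl h3 fun y => ?_)
    rw [eval_and, eval_neg, eval_mem (i := y) (by simp),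
      eval_less (i := y) (j := x) (by simp) (by simp)]
    rfl
  have e2 : σ₁.2 2 = X.choiceD (σ.2 0)ᶜ := by simp [h₁]
  refine ⟨_, rfl, ?_⟩
  have hrun : choose.run X σ = (set 3 3 (and (mem 2 3) (neg (clH 4 3
    (and (mem 2 4) (lt 4 3)))))).run X σ₁ := by rw [hσ₁]; rfl
  rw [hrun]
  set K := X.choiceD (σ.2 0)ᶜ
  refine ⟨by simp [run, h₁], by simp [run, h₁], ?_⟩
  have h := (X.matroidH K).isBasis_greedy (X.matroidH_ground K).symm.subset
    (Fin.val_injective (n := n))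
  rw [← Matroid.isBasis_ground_iff, X.matroidH_ground]
  simp only [run, Function.update_self]
  convert h using 1
  ext x
  have h3 : Function.update (fun _ => 0) 3 (x : ℕ) 3 = (x : ℕ) := Function.update_self ..
  simp only [Set.mem_ofPred_eq, eval_and, eval_neg, eval_mem h3, e2]
  refine and_congr_right fun hx => not_congr ?_
  rw [eval_clH (i := x) (Y := {y ∈ K | (y : ℕ) < x}) h3 (by decide) (by rwa [e2])
    (by rw [e2]; exact Set.sep_subset _ _) fun y => ?_, e2]
  rw [eval_and, eval_mem (i := y) (by simp), eval_lt (i := y) (j := x) (by simp) (by simp), e2]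
  rfl

theorem run_inner (hσ : Describes σ (.inner P)) :
    ∃ c', X.Step (.inner P) c' ∧ Describes (inner.run X σ) c' := by
  obtain ⟨-, rfl⟩ := hσ
  obtain ⟨τ, hτ, h0, h2, hQ⟩ := run_choose (X := X) (σ := σ)
  have hrk : (cardLt 3 (basisD 4 3) (basisH 4 3)).eval X τ.2 (fun _ => 0) ↔
      (X.M .D).eRk (σ.2 0)ᶜ < (X.M .H).eRk (X.choiceD (σ.2 0)ᶜ) := by
    rw [← h2, ← h0, ← ncard_basisD, ← ncard_basisH, Nat.cast_lt]
    rfl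
  have hE1 : (ex 3 (and (mem 2 3) (and (memE1 3) (neg (mem 3 3))))).eval X τ.2 (fun _ => 0) ↔
      ¬ X.choiceD (σ.2 0)ᶜ ∩ X.E1 ⊆ τ.2 3 := by
    rw [Set.not_subset, ← h2]
    refine exists_congr fun x => ?_
    have h3 : Function.update (fun _ => 0) 3 (x : ℕ) 3 = (x : ℕ) := Function.update_self ..
    rw [eval_and, eval_and, eval_neg, eval_mem h3, eval_memE1 h3, eval_mem h3, ← and_assoc]
    rfl
  have hQK : τ.2 3 ⊆ X.choiceD (σ.2 0)ᶜ := X.subset_of_indep_H hQ.indep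
  have hKP : ∀ x ∈ X.choiceD (σ.2 0)ᶜ, x ∉ σ.2 0 := fun x hx => X.choiceD_subset hx
  simp only [inner, run]
  rw [← hτ]
  by_cases h₁ : (X.M .D).eRk (σ.2 0)ᶜ < (X.M .H).eRk (X.choiceD (σ.2 0)ᶜ)
  · rw [if_pos (hrk.2 h₁)]
    exact ⟨.no, .rank rfl hQ h₁, rfl⟩
  rw [if_neg (mt hrk.1 h₁)]
  by_cases h₂ : X.choiceD (σ.2 0)ᶜ ∩ X.E1 ⊆ τ.2 3
  · have h₂' : τ.2 3 ∩ X.E1 = X.choiceD (σ.2 0)ᶜ ∩ X.E1 :=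
      Set.Subset.antisymm (Set.inter_subset_inter_left _ hQK) fun x hx => ⟨h₂ hx, hx.2⟩
    rw [if_neg (by rw [hE1, not_not]; exact h₂)]
    obtain ⟨ω, hω⟩ : ∃ ω, ω = intersect.run X τ := ⟨_, rfl⟩
    obtain ⟨i0, hI, hZ⟩ := run_intersect h2 h0 hω
    have hlt : (cardLt 3 (mem 1 3) (basisD 4 3)).eval X ω.2 (fun _ => 0) ↔
        (ω.2 1).encard < (X.M .D).eRk (σ.2 0)ᶜ := by
      rw [← i0, ← ncard_basisD, ← Set.Finite.cast_ncard_eq (Set.toFinite _), Nat.cast_lt, eval]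
      simp only [eval_mem (Function.update_self ..), Set.ofPred_mem_eq]
    have hex : (ex 3 (and (mem 8 3) (neg (mem 0 3)))).eval X ω.2 (fun _ => 0) ↔
        ¬ ω.2 8 ⊆ σ.2 0 := by
      rw [Set.not_subset, ← i0]
      refine exists_congr fun x => ?_
      have h3 : Function.update (fun _ => 0) 3 (x : ℕ) 3 = (x : ℕ) := Function.update_self ..
      rw [eval_and, eval_neg, eval_mem h3, eval_mem h3]
    rw [← hω]
    by_cases h₃ : (ω.2 1).encard < (X.M .D).eRk (σ.2 0)ᶜ
    · rw [if_pos (hlt.2 h₃)]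
      -- The case that P does not grow cannot occur, but it is simulated as the corresponding step
      -- rather than excluded here.
      by_cases h₄ : ω.2 8 ⊆ σ.2 0
      · rw [if_neg (by rwa [hex, not_not])]
        exact ⟨_, .critical_exit rfl hQ h₁ h₂' hI h₃ hZ (Set.union_eq_self_of_subset_right h₄),
          rfl, i0, rfl⟩
      · rw [if_pos (hex.2 h₄)]
        refine ⟨_, .critical rfl hQ h₁ h₂' hI h₃ hZ fun h => h₄ (Set.union_eq_left.1 h),
          rfl, ?_⟩
        simp only [Function.update_self]
        ext x
        have h3 : Function.update (fun _ => 0) 3 (x : ℕ) 3 = (x : ℕ) := Function.update_self ..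
        rw [Set.mem_ofPred_eq, eval_or, eval_mem h3, eval_mem h3, i0]
        rfl
    · rw [if_neg (mt hlt.1 h₃)]
      exact ⟨_, .exit rfl hQ h₁ h₂' hI h₃, rfl, i0, rfl⟩
  · have h₂' : τ.2 3 ∩ X.E1 ≠ X.choiceD (σ.2 0)ᶜ ∩ X.E1 := fun h => h₂ (h ▸ Set.inter_subset_left)
    rw [if_pos (hE1.2 h₂)]
    refine ⟨_, .E1 rfl hQ h₁ h₂' fun h => ?_, rfl, ?_⟩
    · obtain ⟨x, hx, hxQ⟩ := Set.not_subset.1 h₂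
      exact hKP x hx.1 (Set.union_eq_left.1 h ⟨⟨hx.1, hxQ⟩, hx.2⟩)
    · simp only [Function.update_self]
      ext x
      have h3 : Function.update (fun _ => 0) 3 (x : ℕ) 3 = (x : ℕ) := Function.update_self ..
      rw [Set.mem_ofPred_eq, eval_or, eval_and, eval_and, eval_neg, eval_mem h3, eval_mem h3,
        eval_memE1 h3, eval_mem h3, h0, h2]
      simp only [Set.mem_union, Set.mem_inter_iff, Set.mem_sdiff]
      tauto

theorem eval_circuitForm {A : ℕ → Set (Fin n)} {ρ : ℕ → ℕ} {v x y : ℕ} {b f : Fin n}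
    (hI : (X.M .H).Indep (A 1)) (hb : b ∉ A 1) (hcl : b ∈ (X.M .H).closure (A 1))
    (hx : ρ x = b) (hy : ρ y = f) (hvy : y ≠ v) :
    (circuitForm v x y).eval X A ρ ↔ f ∈ (X.M .H).fundCircuit b (A 1) := by
  rw [hI.mem_fundCircuit_iff hcl hb, circuitForm, eval_or, eval_neg, eval_ne hy hx, not_not,
    eval_and, eval_mem hy, eval_neg, eval_cl (Y := A 1 \ {f}) hx fun k => ?_]
  · by_cases hf : f ∈ A 1
    · rw [hI.insert_sdiff_singleton_indep_iff (X.mem_ground _ _) hb hf]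
      have : f ≠ b := fun h => hb (h ▸ hf)
      tauto
    · by_cases hfb : f = b
      · subst hfb
        simp [hf, hI]
      · have : f ∉ insert b (A 1) := by simp [hf, hfb]
        rw [Set.sdiff_singleton_eq_self this, ← hI.notMem_closure_iff_of_notMem hb]
        tauto
  · rw [eval_and, eval_mem (Function.update_self ..),
      eval_ne (Function.update_self ..) ((Function.update_of_ne hvy _ _).trans hy)]
    rfl

theorem eval_blockForm {A : ℕ → Set (Fin n)} (hI : X.IsCommonIndep (A 1)) {ρ : ℕ → ℕ} {v x : ℕ}
    {b : Fin n} (hx : ρ x = b) (hvx : x ≠ v) :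
    (blockForm v x).eval X A ρ ↔ b ∈ A 0 ∩ X.blockSet (A 1) := by
  have hmem : ∀ j : Fin n, (mem 1 v).eval X A (Function.update ρ v j) ↔ j ∈ A 1 :=
    fun j => eval_mem (Function.update_self ..)
  have hcl := eval_cl (S := .H) hx hmem
  have hweak : ∀ S, b ∉ A 1 → ((weakBlock S v x).eval X A ρ ↔ X.WeaklyBlocks S (A 1) b) := by
    intro S hb
    rw [X.weaklyBlocks_iff (hI S) hb, weakBlock, eval_neg, eval_cl hx fun j => ?_]
    rw [eval_and, hmem, eval_less (Function.update_self ..) ((Function.update_of_ne hvx _ _).trans hx)]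
    rfl
  have hstrong : ∀ S, b ∉ A 1 → ((strongBlock S v x).eval X A ρ ↔ X.StronglyBlocks S (A 1) b) := by
    intro S hb
    rw [X.stronglyBlocks_iff (hI S) hb, strongBlock, eval_neg, eval_cl hx fun j => ?_]
    rw [eval_and, hmem, eval_weak (Function.update_self ..) ((Function.update_of_ne hvx _ _).trans hx)]
    rfl
  have hall : ∀ p : Side → Prop, (∀ S, p S) ↔ p .D ∧ p .H :=
    fun p => ⟨fun h => ⟨h _, h _⟩, fun h S => by cases S; exacts [h.1, h.2]⟩
  have hex : ∀ p : Side → Prop, (∃ S, p S) ↔ p .D ∨ p .H :=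
    fun p => ⟨fun ⟨S, h⟩ => by cases S; exacts [Or.inl h, Or.inr h],
      fun h => h.elim (fun h => ⟨_, h⟩) fun h => ⟨_, h⟩⟩
  rw [blockForm, eval_and, eval_and, eval_and, eval_neg, eval_mem hx, eval_mem hx, hcl, and_assoc,
    and_assoc]
  refine and_congr_right fun _ => and_congr_right fun hb => and_congr_right fun _ => ?_
  rw [eval_and, eval_and, eval_or, eval_or, hweak _ hb, hweak _ hb, hstrong _ hb, hstrong _ hb,
    eval_memE1 hx, StableInstance.Blocks, X.mem_E2_iff, hall, hex]
  by_cases hE : b ∈ X.E1 <;> simp [hE]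

theorem run_outer (hI : X.IsCommonIndep I) (hσ : Describes σ (.outer P I)) :
    ∃ c', X.Step (.outer P I) c' ∧ Describes (outer.run X σ) c' := by
  obtain ⟨-, rfl, rfl⟩ := hσ
  obtain ⟨B, hB⟩ : ∃ B, B = {b ∈ σ.2 0 ∩ X.blockSet (σ.2 1) |
    ∀ y ∈ σ.2 0 ∩ X.blockSet (σ.2 1), b ≤ y} := ⟨_, rfl⟩
  have h₁ : (least 2).run X ((set 2 3 (blockForm 4 3)).run X σ) =
      (σ.1, Function.update σ.2 2 B) := by
    have : {x : Fin n | (blockForm 4 3).eval X σ.2 (Function.update (fun _ => 0) 3 x)} =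
        σ.2 0 ∩ X.blockSet (σ.2 1) := by
      ext x
      exact eval_blockForm hI (by simp) (by decide)
    rw [run_least]
    simp only [run, this, Function.update_self, Function.update_idem, hB]
  obtain ⟨τ, hτ⟩ : ∃ τ, τ = (set 3 3 (or (mem 0 3) (ex 4 (and (mem 2 4) (and (circuitForm 5 4 3)
      (neg (ex 5 (and (circuitForm 6 4 5) (neg (weak .H 5 3)))))))))).run X
      (σ.1, Function.update σ.2 2 B) := ⟨_, rfl⟩
  have hrun : outer.run X σ = (ite 3 (ex 3 (and (mem 3 3) (neg (mem 0 3))))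
        (seq (set 0 3 (mem 3 3)) (kind 0)) (kind 2)).run X τ := by
    rw [hτ, ← h₁]
    rfl
  have hBsub : ∀ b ∈ B, b ∈ σ.2 0 ∩ X.blockSet (σ.2 1) := fun b hb => by
    rw [hB] at hb
    exact hb.1
  obtain ⟨R, hR⟩ : ∃ R, R = σ.2 0 ∪ {x | ∃ b ∈ B, x ∈ X.tail .H ((X.M .H).fundCircuit b (σ.2 1))} :=
    ⟨_, rfl⟩
  have hτ' : τ = (σ.1, Function.update (Function.update σ.2 2 B) 3 R) := by
    rw [hτ]
    simp only [run]
    congr 2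
    ext x
    have h3 : Function.update (fun _ => 0) 3 (x : ℕ) 3 = (x : ℕ) := Function.update_self ..
    rw [hR]
    simp only [Set.mem_ofPred_eq, eval_or, eval_and, eval_ex, eval_neg, eval_mem h3, Set.mem_union]
    refine or_congr Iff.rfl (exists_congr fun b => ?_)
    rw [eval_mem (i := b) (by simp)]
    refine and_congr_right fun hb => ?_
    rw [Function.update_self] at hb
    obtain ⟨-, hbI, hbcl, -⟩ := hBsub b hb
    have e1 : Function.update σ.2 2 B 1 = σ.2 1 := Function.update_of_ne (by decide) ..
    rw [← e1] at hbI hbcl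
    have hI' := hI .H
    rw [← e1] at hI' ⊢
    rw [eval_circuitForm (b := b) (f := x) hI' hbI hbcl (by simp) (by simp)
      (by decide), X.mem_tail_iff]
    refine and_congr_right fun _ => ?_
    push Not
    refine forall_congr' fun y => ?_
    rw [eval_circuitForm (b := b) (f := y) hI' hbI hbcl (by simp) (by simp)
      (by decide), eval_weak (i := y) (j := x) (by simp) (by simp)]
  have hex : (ex 3 (and (mem 3 3) (neg (mem 0 3)))).eval X τ.2 (fun _ => 0) ↔ ¬ R ⊆ σ.2 0 := by
    rw [Set.not_subset]
    refine exists_congr fun x => ?_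
    have h3 : Function.update (fun _ => 0) 3 (x : ℕ) 3 = (x : ℕ) := Function.update_self ..
    rw [eval_and, eval_neg, eval_mem h3, eval_mem h3, hτ']
    rfl
  have hRsup : σ.2 0 ⊆ R := hR ▸ Set.subset_union_left
  -- What the program does next depends only on whether R exceeds P; which rule of the algorithm
  -- this matches is settled afterwards.
  have hfin : (R ≠ σ.2 0 → X.Step (.outer (σ.2 0) (σ.2 1)) (.inner R)) →
      (R = σ.2 0 → X.Step (.outer (σ.2 0) (σ.2 1)) (.final R (σ.2 1))) →
      ∃ c', X.Step (.outer (σ.2 0) (σ.2 1)) c' ∧ Describes (outer.run X σ) c' := by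
    intro hc hd
    simp only [hrun, run]
    by_cases h : R ⊆ σ.2 0
    · have hRe := h.antisymm hRsup
      rw [if_neg (by rwa [hex, not_not])]
      exact ⟨_, hd hRe, rfl, by simp [hτ', hRe], by simp [hτ']⟩
    · rw [if_pos (hex.2 h)]
      refine ⟨_, hc fun h' => h h'.subset, rfl, ?_⟩
      simp only [Function.update_self]
      ext x
      have h3 : Function.update (fun _ => 0) 3 (x : ℕ) 3 = (x : ℕ) := Function.update_self ..
      rw [Set.mem_ofPred_eq, eval_mem h3, hτ']
      simp
  rcases least_eq (σ.2 0 ∩ X.blockSet (σ.2 1)) with ⟨h, hB'⟩ | ⟨b, hb, hB'⟩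
  · rw [← hB] at hB'
    have hRe : R = σ.2 0 := by simp [hR, hB']
    refine hfin (fun h => absurd hRe h) fun _ => ?_
    rw [hRe]
    exact .exit_outer_of_empty h
  · rw [← hB] at hB'
    have hRe : R = σ.2 0 ∪ X.tail .H ((X.M .H).fundCircuit b (σ.2 1)) := by simp [hR, hB']
    exact hfin (fun h => .repeat_outer hb hRe h) fun h => .exit_outer hb hRe h

theorem run_final (hI : X.IsCommonIndep I) (hσ : Describes σ (.final P I)) :
    ∃ c', X.Step (.final P I) c' ∧ Describes (final.run X σ) c' := by
  obtain ⟨-, rfl, rfl⟩ := hσ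
  have hex : (ex 3 (and (mem 0 3) (or (mem 1 3) (neg (cl .H 4 (mem 1 4) 3))))).eval X σ.2
      (fun _ => 0) ↔ ∃ e ∈ σ.2 0, (X.M .H).Indep (insert e (σ.2 1)) := by
    refine exists_congr fun x => ?_
    have h3 : Function.update (fun _ => 0) 3 (x : ℕ) 3 = (x : ℕ) := Function.update_self ..
    rw [eval_and, eval_or, eval_neg, eval_mem h3, eval_mem h3,
      eval_cl h3 fun y => eval_mem (Function.update_self ..)]
    refine and_congr_right fun _ => ?_
    by_cases hx : x ∈ σ.2 1
    · simp [hx, hI .H]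
    · rw [← (hI .H).notMem_closure_iff_of_notMem hx (X.mem_ground _ _)]
      tauto
  simp only [final, run]
  by_cases h : ∃ e ∈ σ.2 0, (X.M .H).Indep (insert e (σ.2 1))
  · rw [if_pos (hex.2 h)]
    obtain ⟨e, he, h⟩ := h
    exact ⟨_, .output_no he h, rfl⟩
  · rw [if_neg (mt hex.1 h)]
    push Not at h
    exact ⟨_, .output_found h, rfl, rfl⟩

theorem run_setup : Describes (setup.run X σ) (.inner ∅) := by
  refine ⟨rfl, ?_⟩
  simp [setup, run, eval]

end Cmd

/-! ### The main algorithm as a program -/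

section Program

open Cmd

variable {n : ℕ} {X : StableInstance (Fin n)} {s : Store} {c : Config (Fin n)}

theorem Store.Rep.represents {σ : SetState n} (h : s.Rep σ) (hc : Describes σ c) :
    Represents s c := by
  obtain ⟨h0, h⟩ := h
  have hP := h 0 (by decide)
  have hI := h 1 (by decide)
  cases c <;> simp only [Describes] at hc <;> simp only [Represents, h0, hP, hI] <;> exact hc

theorem Represents.describes (h : Represents s c) :
    Describes ((s.reg 0, s.decode n) : SetState n) c := by
  cases c <;> exact h

theorem Represents.lt_three_iff (h : Represents s c) : s.reg 0 < 3 ↔ ¬ c.Halted := by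
  cases c <;> simp only [Represents] at h <;> simp [Config.Halted, h]

/-- The program that performs one step of the main algorithm. -/
def stepProg : Prog :=
  .ite (.reg 0) (.ite (.lt (.reg 0) (.num 2)) outer.compile final.compile) inner.compile

theorem exists_polynomial_setup : ∃ T : Polynomial ℕ, ∀ (n : ℕ) (X : StableInstance (Fin n))
    (s : Store), Runs X Cmd.setup.compile s (T.eval n) fun s' =>
      Represents s' (.inner (∅ : Set (Fin n))) := by
  obtain ⟨T, hT⟩ := Cmd.setup.correct 0 wf_setup
  exact ⟨T, fun n X s => (hT n X s (s.reg 0, s.decode n) ⟨rfl, fun _ _ => rfl⟩).mono le_rfl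
    fun s' h => h.1.represents run_setup⟩

/-- Reachability supplies the invariant, which makes I a common independent set; the closure queries
for blocking, circuits and extensions are valid only for such I. -/
theorem exists_polynomial_step : ∃ T : Polynomial ℕ, ∀ (n : ℕ) (X : StableInstance (Fin n))
    (k : ℕ) (c : Config (Fin n)) (s : Store), X.ReachesIn k c → ¬ c.Halted → Represents s c →
      ∃ c', X.Step c c' ∧ Runs X stepProg s (T.eval n) fun s' => Represents s' c' := by
  obtain ⟨Ti, hTi⟩ := Cmd.inner.correct 0 wf_inner
  obtain ⟨To, hTo⟩ := Cmd.outer.correct 0 wf_outer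
  obtain ⟨Tf, hTf⟩ := Cmd.final.correct 0 wf_final
  refine ⟨(To + Tf + 1) + Ti + 1, fun n X k c s hk hc hs => ?_⟩
  have hd := hs.describes
  have hrep : s.Rep ((s.reg 0, s.decode n) : SetState n) := ⟨rfl, fun _ _ => rfl⟩
  have hinv := hk.invariant
  simp only [Polynomial.eval_add, Polynomial.eval_one]
  cases c with
  | inner P =>
    obtain ⟨c', hstep, hc'⟩ := run_inner (X := X) hd
    have h0 : s.reg 0 = 0 := hs.1
    exact ⟨c', hstep, Runs.ite (fun h => absurd h0 h) fun _ =>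
      (hTi n X s _ hrep).mono le_rfl fun s' h => h.1.represents hc'⟩
  | outer P I =>
    obtain ⟨c', hstep, hc'⟩ := run_outer (X := X) hinv.2.isCommonIndep hd
    have h0 : s.reg 0 = 1 := hs.1
    exact ⟨c', hstep, Runs.ite (fun _ => Runs.ite (fun _ =>
      (hTo n X s _ hrep).mono le_rfl fun s' h => h.1.represents hc')
      fun h => by simp [Expr.eval, h0] at h) fun h => by simp [Expr.eval, h0] at h⟩
  | final R I =>
    obtain ⟨c', hstep, hc'⟩ := run_final (X := X) hinv.2.1.isCommonIndep hd
    have h0 : s.reg 0 = 2 := hs.1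
    exact ⟨c', hstep, Runs.ite (fun _ => Runs.ite (fun h => by simp [Expr.eval, h0] at h) fun _ =>
      (hTf n X s _ hrep).mono le_rfl fun s' h => h.1.represents hc')
      fun h => by simp [Expr.eval, h0] at h⟩
  | no => exact absurd (Or.inl rfl) hc
  | found I => exact absurd (Or.inr ⟨I, rfl⟩) hc

/-- The number m of rounds still allowed cannot run out: that would mean 2n + 4 steps, one more than
the bound on the length of an execution. -/
theorem exists_exec_loop {step : Prog} {T : ℕ}
    (hstep : ∀ k c s, X.ReachesIn k c → ¬ c.Halted → Represents s c →
      ∃ c', X.Step c c' ∧ Runs X step s T fun s' => Represents s' c') :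
    ∀ (m k : ℕ) (c : Config (Fin n)) (s : Store), k + m = 2 * n + 4 → X.ReachesIn k c →
      Represents s c → ∃ k' c', X.ReachesIn k' c' ∧ c'.Halted ∧
        Runs X (.loop (.lt (.reg 0) (.num 3)) step) s (m * (T + 1) + 1) fun s' =>
          Represents s' c' := by
  intro m
  induction m with
  | zero =>
    intro k c s hkm hk _
    have := hk.le
    rw [Nat.card_fin] at this
    omega
  | succ m ih =>
    intro k c s hkm hk hs
    by_cases hc : c.Halted
    · refine ⟨k, c, hk, hc, s, 1, .loop_false ?_, by omega, hs⟩
      exact if_neg (mt hs.lt_three_iff.1 (not_not.2 hc))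
    · obtain ⟨c', hcc', s', t, he, ht, hs'⟩ := hstep k c s hk hc hs
      obtain ⟨k'', c'', hk'', hc'', s'', t', he', ht', hs''⟩ :=
        ih (k + 1) c' s' (by omega) (hk.step hcc') hs'
      refine ⟨k'', c'', hk'', hc'', s'', t + t' + 1, .loop_true ?_ he he', ?_, hs''⟩
      · exact (if_pos (hs.lt_three_iff.2 hc)).trans_ne one_ne_zero
      · rw [Nat.succ_mul]
        omega

end Program

theorem mainTheorem1 :
    (∀ (E : Type u) [Finite E] (X : StableInstance E) (k : ℕ) (c : Config E),
      X.ReachesIn k c →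
        (¬ c.Halted → ∃ c', X.Step c c') ∧
        (c.Halted →
          ((∃ J, X.IsStable J) → ∃ I, c = .found I ∧ X.IsStable I) ∧
          ((¬ ∃ J, X.IsStable J) → c = .no))) ∧
    (∃ p : Polynomial ℕ, ∀ (E : Type u) [Finite E] (X : StableInstance E) (k : ℕ) (c : Config E),
      X.ReachesIn k c → k ≤ p.eval (Nat.card E)) ∧
    (∃ (p : Polynomial ℕ) (setup step : Prog), ∀ (n : ℕ) (X : StableInstance (Fin n)),
      (∀ s : Store, ∃ s' t, Exec X setup s s' t ∧ t ≤ p.eval n ∧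
        Represents s' (Config.inner (∅ : Set (Fin n)))) ∧
      (∀ (k : ℕ) (c : Config (Fin n)) (s : Store),
        X.ReachesIn k c → ¬ c.Halted → Represents s c →
          ∃ c' s' t, X.Step c c' ∧ Exec X step s s' t ∧ t ≤ p.eval n ∧ Represents s' c') ∧
      (∀ s : Store, ∃ (k : ℕ) (c : Config (Fin n)) (s' : Store) (t : ℕ),
        X.ReachesIn k c ∧ c.Halted ∧
          Exec X (iterateProg setup step) s s' t ∧ t ≤ p.eval n ∧ Represents s' c)) := by
  refine ⟨fun E _ X k c h => ⟨StableInstance.exists_step, h.correct⟩,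
    ⟨2 * Polynomial.X + 3, fun E _ X k c h => ?_⟩, ?_⟩
  · simpa using h.le
  · obtain ⟨T₀, h₀⟩ := exists_polynomial_setup
    obtain ⟨T, hT⟩ := exists_polynomial_step
    -- One polynomial dominates the time for initialization, for a single step and for the whole run
    -- of at most 2n + 4 rounds.
    refine ⟨T₀ + T + ((2 * Polynomial.X + 4) * (T + 1) + 1), Cmd.setup.compile, stepProg,
      fun n X => ?_⟩
    simp only [Polynomial.eval_add, Polynomial.eval_mul, Polynomial.eval_X, Polynomial.eval_one,
      Polynomial.eval_ofNat]
    refine ⟨fun s => ?_, fun k c s hk hc hs => ?_, fun s => ?_⟩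
    · obtain ⟨s', t, he, ht, hs'⟩ := h₀ n X s
      exact ⟨s', t, he, by omega, hs'⟩
    · obtain ⟨c', hcc', s', t, he, ht, hs'⟩ := hT n X k c s hk hc hs
      exact ⟨c', s', t, hcc', he, by omega, hs'⟩
    · obtain ⟨s', t, he, ht, hs'⟩ := h₀ n X s
      obtain ⟨k, c, hk, hc, s'', t', he', ht', hs''⟩ :=
        exists_exec_loop (hT n X) (2 * n + 4) 0 _ s' (by omega) .start hs'
      exact ⟨k, c, s'', t + t', hk, hc, .seq he he', by omega, hs''⟩
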